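/- Let $\Pi=(\mathbb R/\mathbb Z)\times\mathbb R$ be the periodic strip, and let $\rho(\mathbf x)=\bigl(\sin^2(\pi x_1)+\sinh^2(\pi x_2)\bigr)^{1/2}$, which is a function on $\Pi$. Let $S(\Pi)$ be the space of vector fields $\mathbf v\in L^\infty(\Pi)^2$ that are divergence-free and have $\operatorname{curl}\mathbf v=\partial_1v^2-\partial_2v^1\in L^\infty(\Pi)$, both in the sense of distributions on $\Pi$. For $\mathbf v\in S(\Pi)$ put $m_1(x_2)=\int_{-1/2}^{1/2}v^1(x_1,x_2)\,dx_1$ and $m_2=\int_{-1/2}^{1/2}v^2(x_1,x_2)\,dx_1$ (which does not depend on $x_2$), both for almost every $x_2$, and let $m_1(\pm\infty)$ be the (essential) limits of $m_1$ at $\pm\infty$. Let $\varepsilon>0$ and let $\Omega\subset\Pi$ be a bounded open set with $C^{1,\varepsilon}$ boundary, lying locally on one side of its boundary, with finitely many boundary components $\Gamma_1,\dots,\Gamma_J$. For each $j$ let $\gamma_j\colon[0,2\pi]\to\mathbb R^2$ be a $C^1$ curve whose projection to $\Pi$ is a simple closed parametrization of $\Gamma_j$, oriented so that $\Omega$ lies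 to its left (at every $\alpha$ with $\gamma_j'(\alpha)\neq0$). Let $\omega_0\in\mathbb R$. Then $$\mathbf u(\mathbf x)=-\frac{\omega_0}{2\pi}\sum_{j=1}^J\int_0^{2\pi}\log\rho(\mathbf x-\gamma_j(\alpha))\,\gamma_j'(\alpha)\,d\alpha ,$$ whose integrals converge absolutely for every $\mathbf x\in\Pi$, is (up to equality almost everywhere) the unique divergence-free vector field in $S(\Pi)$ with curl equal to $\omega_0\mathbf 1_\Omega$ for which $m_2=0$ and $m_1(-\infty)+m_1(\infty)=0$. -/

import Mathlib

open MeasureTheory Filter Topology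
open scoped NNReal ContDiff

noncomputable section

namespace PatchLaw

/-- The flat periodic strip `S¹ × ℝ ≅ ℝ² / (ℤ × {0})`, with circle of length one. -/
abbrev Cyl : Type := AddCircle (1 : ℝ) × ℝ

/-- The covering map from the plane to the strip. -/
def toCyl (x : ℝ × ℝ) : Cyl := ((x.1 : AddCircle (1 : ℝ)), x.2)

/-- Rotation by 90 degrees counterclockwise. -/
def perp (x : ℝ × ℝ) : ℝ × ℝ := (-x.2, x.1)

/-! ### Weak divergence and curl on the strip -/

/-- Partial derivative in the periodic direction. -/
def partial₁ (φ : Cyl → ℝ) (x : Cyl) : ℝ :=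
  deriv (fun s : ℝ => φ (x + toCyl (s, 0))) 0

/-- Partial derivative in the vertical direction. -/
def partial₂ (φ : Cyl → ℝ) (x : Cyl) : ℝ :=
  deriv (fun s : ℝ => φ (x + toCyl (0, s))) 0

/-- Test functions: smooth, with compact support in the strip. -/
def IsTest (φ : Cyl → ℝ) : Prop :=
  ContDiff ℝ ∞ (φ ∘ toCyl) ∧ HasCompactSupport φ

/-- `div v = 0` in the sense of distributions on the strip. -/
def WeakDivFree (v : Cyl → ℝ × ℝ) : Prop :=
  ∀ φ : Cyl → ℝ, IsTest φ →
    ∫ x, ((v x).1 * partial₁ φ x + (v x).2 * partial₂ φ x) = 0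

/-- `∂₁ v² - ∂₂ v¹ = w` in the sense of distributions on the strip. -/
def HasWeakCurl (v : Cyl → ℝ × ℝ) (w : Cyl → ℝ) : Prop :=
  ∀ φ : Cyl → ℝ, IsTest φ →
    ∫ x, ((v x).1 * partial₂ φ x - (v x).2 * partial₁ φ x) = ∫ x, w x * φ x

/-- The Serfati space on the strip: essentially bounded, divergence-free vector fields
whose curl is essentially bounded. -/
def MemSerfati (v : Cyl → ℝ × ℝ) : Prop :=
  MemLp v ⊤ (volume : Measure Cyl) ∧ WeakDivFree v ∧
    ∃ w : Cyl → ℝ, MemLp w ⊤ (volume : Measure Cyl) ∧ HasWeakCurl v w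

/-! ### Horizontal means

Fields are determined up to null sets, so the horizontal means are determined for almost every
height. -/

/-- The mean of the first component over the horizontal circle at height `a`. -/
def m₁ (v : Cyl → ℝ × ℝ) (a : ℝ) : ℝ := ∫ t : AddCircle (1 : ℝ), (v (t, a)).1

/-- The mean of the second component over horizontal circles is the constant `c`. -/
def HasM₂ (v : Cyl → ℝ × ℝ) (c : ℝ) : Prop :=
  ∀ᵐ a : ℝ, ∫ t : AddCircle (1 : ℝ), (v (t, a)).2 = c

/-- `m₁ (-∞) = a`, as an essential limit. -/
def HasM₁AtBot (v : Cyl → ℝ × ℝ) (a : ℝ) : Prop :=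
  Tendsto (m₁ v) (atBot ⊓ ae (volume : Measure ℝ)) (𝓝 a)

/-- `m₁ (∞) = a`, as an essential limit. -/
def HasM₁AtTop (v : Cyl → ℝ × ℝ) (a : ℝ) : Prop :=
  Tendsto (m₁ v) (atTop ⊓ ae (volume : Measure ℝ)) (𝓝 a)

/-! ### Regular bounded regions and parametrizations of their boundaries -/

/-- `g` is a `C^{1,ε}` function on the line. -/
def IsC1Holder (ε : ℝ≥0) (g : ℝ → ℝ) : Prop :=
  ContDiff ℝ 1 g ∧ ∃ C : ℝ≥0, HolderWith C ε (deriv g)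

/-- A bounded open subset of the strip with `C^{1,ε}` boundary: near each of its boundary points
it consists of the points lying on one side of the graph of a `C^{1,ε}` function of one of the
two coordinates. -/
structure IsC1HolderRegion (ε : ℝ≥0) (Ω : Set Cyl) : Prop where
  isOpen : IsOpen Ω
  isBounded : Bornology.IsBounded Ω
  local_graph : ∀ p : ℝ × ℝ, toCyl p ∈ frontier Ω → ∃ g : ℝ → ℝ, IsC1Holder ε g ∧
    ((∀ᶠ y in 𝓝 p, toCyl y ∈ Ω ↔ y.2 < g y.1) ∨
     (∀ᶠ y in 𝓝 p, toCyl y ∈ Ω ↔ g y.1 < y.2) ∨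
     (∀ᶠ y in 𝓝 p, toCyl y ∈ Ω ↔ y.1 < g y.2) ∨
     (∀ᶠ y in 𝓝 p, toCyl y ∈ Ω ↔ g y.2 < y.1))

/-- The parameter interval. -/
def paramI : Set ℝ := Set.Icc 0 (2 * Real.pi)

/-- The velocity of a curve parametrized by `[0, 2π]` (one-sided at the end points). -/
def tangent (γ : ℝ → ℝ × ℝ) (α : ℝ) : ℝ × ℝ := derivWithin γ paramI α

/-- The image in the strip of a curve in the plane. -/
def trace (γ : ℝ → ℝ × ℝ) : Set Cyl := (fun α => toCyl (γ α)) '' paramI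

/-- `γ 0, …, γ (J - 1) : [0, 2π] → ℝ²` are `C¹` curves whose projections to the strip are simple
closed curves that parametrize the components of the boundary of `Ω`, each traversed with `Ω` on
its left. (The projected curves are compact and connected, so, being finitely many, disjoint and
with union the boundary, they are its connected components. A curve in the plane need not be
closed: its end points differ by a horizontal integer vector.) -/
structure IsBoundaryParam (Ω : Set Cyl) {J : ℕ} (γ : Fin J → ℝ → ℝ × ℝ) : Prop where
  contDiffOn : ∀ j, ContDiffOn ℝ 1 (γ j) paramI
  closed : ∀ j, toCyl (γ j 0) = toCyl (γ j (2 * Real.pi))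
  simple : ∀ j, Set.InjOn (fun α => toCyl (γ j α)) (Set.Ico 0 (2 * Real.pi))
  disjoint : Pairwise fun i j => Disjoint (trace (γ i)) (trace (γ j))
  cover : ⋃ j, trace (γ j) = frontier Ω
  left : ∀ j, ∀ α ∈ paramI, tangent (γ j) α ≠ 0 →
    ∀ᶠ s in 𝓝[>] (0 : ℝ), toCyl (γ j α + s • perp (tangent (γ j) α)) ∈ Ω

/-! ### The boundary integral -/

theorem periodic_sin_sq : Function.Periodic (fun t : ℝ => Real.sin (Real.pi * t) ^ 2) 1 := by
  intro t
  simp only [mul_add, mul_one, Real.sin_add_pi]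
  ring

/-- `ρ(x) = (sin² (π x₁) + sinh² (π x₂))^{1/2}`, as a function on the strip. -/
def rho (x : Cyl) : ℝ :=
  Real.sqrt (periodic_sin_sq.lift x.1 + Real.sinh (Real.pi * x.2) ^ 2)

theorem rho_toCyl (x : ℝ × ℝ) :
    rho (toCyl x) = Real.sqrt (Real.sin (Real.pi * x.1) ^ 2 + Real.sinh (Real.pi * x.2) ^ 2) := by
  simp only [rho, toCyl, Function.Periodic.lift_coe]

/-- The integrand `log ρ(x - γ(α)) γ'(α)`. -/
def integrand (γ : ℝ → ℝ × ℝ) (x : Cyl) (α : ℝ) : ℝ × ℝ :=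
  Real.log (rho (x - toCyl (γ α))) • tangent γ α

/-- `-(ω₀ / 2π) ∑ⱼ ∫₀^{2π} log ρ(x - γⱼ(α)) γⱼ'(α) dα`. -/
def patchVelocity (ω₀ : ℝ) {J : ℕ} (γ : Fin J → ℝ → ℝ × ℝ) (x : Cyl) : ℝ × ℝ :=
  (-(ω₀ / (2 * Real.pi))) • ∑ j, ∫ α in (0 : ℝ)..(2 * Real.pi), integrand (γ j) x α

/-- `v` is a divergence-free field in the Serfati space with curl `ω₀ 1_Ω`, with `m₂ = 0` and
`m₁(-∞) + m₁(∞) = 0`. -/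
structure IsPatchField (ω₀ : ℝ) (Ω : Set Cyl) (v : Cyl → ℝ × ℝ) : Prop where
  mem : MemSerfati v
  curl : HasWeakCurl v (Ω.indicator fun _ => ω₀)
  m₂_eq : HasM₂ v 0
  m₁_eq : ∃ a b : ℝ, HasM₁AtBot v a ∧ HasM₁AtTop v b ∧ a + b = 0

end PatchLaw

end

noncomputable section

namespace PatchLaw

/-! Existence. The kernel log ρ is harmonic off the origin of the strip and satisfies Δ log ρ = 2π
δ₀. The field sought is therefore the rotated gradient of (ω₀/2π) log ρ ∗ 1_Ω, and moving the
derivative onto 1_Ω turns the area integral into the boundary integral. This is carried out weakly: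
by Fubini, ∫ ψ u = −(ω₀/2π) Σⱼ ∮ (log ρ ∗ ψ) dγⱼ for a test function ψ, and log ρ ∗ ψ is of class
C¹. In the divergence pairing the right side is the circulation of the gradient of log ρ ∗ φ around
closed curves, which is zero. In the curl pairing Green's theorem and Δ(log ρ ∗ φ) = 2πφ give ω₀ ∫_Ω
φ (`weakDivFree_patchVelocity`, `hasWeakCurl_patchVelocity`).

The fundamental solution (`integral_logRho_mul_laplacian`) comes from Green's second identity above
height h, as h → 0. The derivative ∂₂ log ρ at height h is a Poisson kernel of mass π that
concentrates at the origin, so each half of the strip contributes π φ(0).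

Green's theorem (`green_theorem`) is needed for injective C¹ curves whose velocity may vanish.
Cutoffs reduce it to charts in which the boundary is a graph. A shear straightens the graph, and the
change of variables for injective maps, which tolerates zeros of the derivative, passes from the
graph to the curves. That Ω lies on the left fixes the sign.

Bounds. Along a graph over an axis the singularity of log ρ is dominated by a one-dimensional
logarithm, so the integrals converge absolutely, with a bound uniform on bounded heights. Far away
log ρ(x − γ) = π|x₂| + O(1), and the unbounded term drops out because Σⱼ ∮ dγⱼ = 0
(`sum_integral_tangent`). The mean of log ρ over the circle at height h is π|h| − log 2, by Jensen's
formula. Hence m₂ integrates an exact form in the height and vanishes, while m₁ takes opposite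
constant values above and below the boundary.

Uniqueness. The difference w of two solutions is bounded with zero divergence and curl, so every
mollification of w₁ − i w₂ is a bounded entire function, constant by Liouville
(`conv_eq_conv_zero`). Thus w is constant almost everywhere; the condition on m₂ kills its second
component, and the one on m₁(±∞) its first. -/

/-! ### The covering of the strip by the plane. -/

theorem toCyl_add (x y : ℝ × ℝ) : toCyl (x + y) = toCyl x + toCyl y := by
  simp [toCyl]

theorem toCyl_sub (x y : ℝ × ℝ) : toCyl (x - y) = toCyl x - toCyl y := by
  simp [toCyl]

@[simp] theorem toCyl_zero : toCyl 0 = 0 := by simp [toCyl]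

theorem continuous_toCyl : Continuous toCyl :=
  (continuous_quotient_mk'.comp continuous_fst).prodMk continuous_snd

theorem isOpenMap_toCyl : IsOpenMap toCyl :=
  IsOpenMap.prodMap (f := fun t : ℝ => (t : AddCircle (1 : ℝ))) (g := (id : ℝ → ℝ))
    QuotientAddGroup.isOpenMap_coe IsOpenMap.id

theorem toCyl_eq_iff {x y : ℝ × ℝ} : toCyl x = toCyl y ↔ ∃ n : ℤ, y = x + ((n : ℝ), 0) := by
  simp only [toCyl, Prod.ext_iff]
  constructor
  · rintro ⟨h1, h2⟩
    obtain ⟨n, hn⟩ := (AddCircle.coe_eq_zero_iff (1 : ℝ) (x := y.1 - x.1)).1 (by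
      rw [AddCircle.coe_sub, h1, sub_self])
    exact ⟨n, by simp at hn; simp; linarith, by simp [h2]⟩
  · rintro ⟨n, h1, h2⟩
    refine ⟨?_, by simpa using h2.symm⟩
    rw [h1]
    simp

@[simp] theorem toCyl_add_int (x : ℝ × ℝ) (n : ℤ) : toCyl (x + ((n : ℝ), 0)) = toCyl x :=
  (toCyl_eq_iff.2 ⟨n, rfl⟩).symm

@[simp] theorem toCyl_sub_int (x : ℝ × ℝ) (n : ℤ) : toCyl (x - ((n : ℝ), 0)) = toCyl x :=
  toCyl_eq_iff.2 ⟨n, by simp⟩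

theorem exists_toCyl_eq (x : Cyl) (a : ℝ) : ∃ y : ℝ × ℝ, toCyl y = x ∧ a < y.1 ∧ y.1 ≤ a + 1 := by
  obtain ⟨⟨t, ht⟩, h⟩ := (AddCircle.equivIoc (1 : ℝ) a).symm.surjective x.1
  exact ⟨(t, x.2), Prod.ext h rfl, ht.1, ht.2⟩

theorem toCyl_surjective : Function.Surjective toCyl := fun x =>
  let ⟨y, hy, _⟩ := exists_toCyl_eq x 0; ⟨y, hy⟩

theorem isQuotientMap_toCyl : IsQuotientMap toCyl :=
  isOpenMap_toCyl.isQuotientMap continuous_toCyl toCyl_surjective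

theorem continuous_of_comp_toCyl {X : Type*} [TopologicalSpace X] {f : Cyl → X}
    (h : Continuous (f ∘ toCyl)) : Continuous f :=
  isQuotientMap_toCyl.continuous_iff.2 h

/-- The part of the plane that covers the strip exactly once, starting at abscissa `a`. -/
def slab (a : ℝ) : Set (ℝ × ℝ) := Set.Ioc a (a + 1) ×ˢ Set.univ

theorem measurableSet_slab (a : ℝ) : MeasurableSet (slab a) :=
  measurableSet_Ioc.prod MeasurableSet.univ

theorem measurePreserving_toCyl (a : ℝ) :
    MeasurePreserving toCyl (volume.restrict (slab a)) volume := by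
  have h1 := AddCircle.measurePreserving_mk (1 : ℝ) a
  have h := h1.prod (MeasurePreserving.id (volume : Measure ℝ))
  have h2 : (volume : Measure (ℝ × ℝ)).restrict (slab a) =
      (volume.restrict (Set.Ioc a (a + 1))).prod volume := by
    rw [slab, Measure.volume_eq_prod, ← Measure.prod_restrict, Measure.restrict_univ]
  rw [h2]
  exact h

theorem integral_cyl_eq_slab {E : Type*} [NormedAddCommGroup E] [NormedSpace ℝ E] (a : ℝ)
    {f : Cyl → E} (hf : AEStronglyMeasurable f volume) :
    ∫ x, f x = ∫ y in slab a, f (toCyl y) := by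
  rw [← (measurePreserving_toCyl a).map_eq] at hf ⊢
  exact integral_map (measurePreserving_toCyl a).measurable.aemeasurable hf

/-! ### Test functions -/

theorem partial₁_toCyl {φ : Cyl → ℝ} {y : ℝ × ℝ} (h : DifferentiableAt ℝ (φ ∘ toCyl) y) :
    partial₁ φ (toCyl y) = fderiv ℝ (φ ∘ toCyl) y (1, 0) := by
  rw [partial₁]
  have h0 : HasDerivAt (fun s : ℝ => y + (s, 0)) ((1 : ℝ), (0 : ℝ)) 0 :=
    ((hasDerivAt_id (0 : ℝ)).prodMk (hasDerivAt_const (0 : ℝ) (0 : ℝ))).const_add y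
  have h1 : HasFDerivAt (φ ∘ toCyl) (fderiv ℝ (φ ∘ toCyl) y) (y + ((0 : ℝ), (0 : ℝ))) := by
    rw [show ((0 : ℝ), (0 : ℝ)) = 0 from rfl, add_zero]
    exact h.hasFDerivAt
  have := h1.comp_hasDerivAt (0 : ℝ) h0
  rw [← this.deriv]
  simp [Function.comp_def, toCyl_add]

theorem partial₂_toCyl {φ : Cyl → ℝ} {y : ℝ × ℝ} (h : DifferentiableAt ℝ (φ ∘ toCyl) y) :
    partial₂ φ (toCyl y) = fderiv ℝ (φ ∘ toCyl) y (0, 1) := by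
  rw [partial₂]
  have h0 : HasDerivAt (fun s : ℝ => y + (0, s)) ((0 : ℝ), (1 : ℝ)) 0 :=
    ((hasDerivAt_const (0 : ℝ) (0 : ℝ)).prodMk (hasDerivAt_id (0 : ℝ))).const_add y
  have h1 : HasFDerivAt (φ ∘ toCyl) (fderiv ℝ (φ ∘ toCyl) y) (y + ((0 : ℝ), (0 : ℝ))) := by
    rw [show ((0 : ℝ), (0 : ℝ)) = 0 from rfl, add_zero]
    exact h.hasFDerivAt
  have := h1.comp_hasDerivAt (0 : ℝ) h0
  rw [← this.deriv]
  simp [Function.comp_def, toCyl_add]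

theorem partial₁_eq_zero {φ : Cyl → ℝ} {x : Cyl} (h : φ =ᶠ[𝓝 x] 0) : partial₁ φ x = 0 := by
  have h0 : Tendsto (fun s : ℝ => x + toCyl (s, 0)) (𝓝 0) (𝓝 x) := by
    have : Continuous fun s : ℝ => x + toCyl (s, 0) :=
      continuous_const.add (continuous_toCyl.comp (by fun_prop))
    convert this.tendsto 0 using 2
    rw [show ((0 : ℝ), (0 : ℝ)) = 0 from rfl, toCyl_zero, add_zero]
  have h1 := EventuallyEq.deriv_eq (h.comp_tendsto h0)
  exact h1.trans (by simp [Function.comp_def])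

theorem partial₂_eq_zero {φ : Cyl → ℝ} {x : Cyl} (h : φ =ᶠ[𝓝 x] 0) : partial₂ φ x = 0 := by
  have h0 : Tendsto (fun s : ℝ => x + toCyl (0, s)) (𝓝 0) (𝓝 x) := by
    have : Continuous fun s : ℝ => x + toCyl (0, s) :=
      continuous_const.add (continuous_toCyl.comp (by fun_prop))
    convert this.tendsto 0 using 2
    rw [show ((0 : ℝ), (0 : ℝ)) = 0 from rfl, toCyl_zero, add_zero]
  have h1 := EventuallyEq.deriv_eq (h.comp_tendsto h0)
  exact h1.trans (by simp [Function.comp_def])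

theorem continuous_of_contDiff_comp {φ : Cyl → ℝ} (h : ContDiff ℝ 1 (φ ∘ toCyl)) :
    Continuous φ := continuous_of_comp_toCyl h.continuous

theorem partial₁_comp_toCyl {φ : Cyl → ℝ} (h : ContDiff ℝ 1 (φ ∘ toCyl)) :
    partial₁ φ ∘ toCyl = fun y => fderiv ℝ (φ ∘ toCyl) y (1, 0) := by
  ext y; exact partial₁_toCyl (h.differentiable (by simp) y)

theorem partial₂_comp_toCyl {φ : Cyl → ℝ} (h : ContDiff ℝ 1 (φ ∘ toCyl)) :
    partial₂ φ ∘ toCyl = fun y => fderiv ℝ (φ ∘ toCyl) y (0, 1) := by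
  ext y; exact partial₂_toCyl (h.differentiable (by simp) y)

theorem continuous_partial₁ {φ : Cyl → ℝ} (h : ContDiff ℝ 1 (φ ∘ toCyl)) :
    Continuous (partial₁ φ) := by
  apply continuous_of_comp_toCyl
  rw [partial₁_comp_toCyl h]
  exact (h.continuous_fderiv (by simp)).clm_apply continuous_const

theorem continuous_partial₂ {φ : Cyl → ℝ} (h : ContDiff ℝ 1 (φ ∘ toCyl)) :
    Continuous (partial₂ φ) := by
  apply continuous_of_comp_toCyl
  rw [partial₂_comp_toCyl h]
  exact (h.continuous_fderiv (by simp)).clm_apply continuous_const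

theorem hasCompactSupport_partial₁ {φ : Cyl → ℝ} (h : HasCompactSupport φ) :
    HasCompactSupport (partial₁ φ) :=
  h.mono' fun x hx => by
    by_contra hc
    exact hx (partial₁_eq_zero (notMem_tsupport_iff_eventuallyEq.1 hc))

theorem hasCompactSupport_partial₂ {φ : Cyl → ℝ} (h : HasCompactSupport φ) :
    HasCompactSupport (partial₂ φ) :=
  h.mono' fun x hx => by
    by_contra hc
    exact hx (partial₂_eq_zero (notMem_tsupport_iff_eventuallyEq.1 hc))

namespace IsTest

variable {φ : Cyl → ℝ}

theorem contDiff_one (h : IsTest φ) : ContDiff ℝ 1 (φ ∘ toCyl) := h.1.of_le (by simp)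

theorem continuous (h : IsTest φ) : Continuous φ := continuous_of_contDiff_comp h.contDiff_one

theorem partial₁ (h : IsTest φ) : IsTest (partial₁ φ) := by
  refine ⟨?_, hasCompactSupport_partial₁ h.2⟩
  rw [partial₁_comp_toCyl h.contDiff_one]
  exact (h.1.fderiv_right (m := ∞) (by simp)).clm_apply contDiff_const

theorem partial₂ (h : IsTest φ) : IsTest (partial₂ φ) := by
  refine ⟨?_, hasCompactSupport_partial₂ h.2⟩
  rw [partial₂_comp_toCyl h.contDiff_one]
  exact (h.1.fderiv_right (m := ∞) (by simp)).clm_apply contDiff_const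

theorem comp_add (h : IsTest φ) (y : ℝ × ℝ) : IsTest fun x => φ (x + toCyl y) := by
  refine ⟨?_, h.2.comp_homeomorph (Homeomorph.addRight (toCyl y))⟩
  have : (fun x => φ (x + toCyl y)) ∘ toCyl = fun z => (φ ∘ toCyl) (z + y) := by
    ext z; simp [toCyl_add]
  rw [this]
  exact h.1.comp (contDiff_id.add contDiff_const)

end IsTest

theorem partial₁_comp_add (φ : Cyl → ℝ) (y x : Cyl) :
    PatchLaw.partial₁ (fun x => φ (x + y)) x = PatchLaw.partial₁ φ (x + y) := by
  simp only [PatchLaw.partial₁, add_right_comm]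

theorem partial₂_comp_add (φ : Cyl → ℝ) (y x : Cyl) :
    PatchLaw.partial₂ (fun x => φ (x + y)) x = PatchLaw.partial₂ φ (x + y) := by
  simp only [PatchLaw.partial₂, add_right_comm]

theorem exists_height_bound {φ : Cyl → ℝ} (h : HasCompactSupport φ) :
    ∃ R : ℝ, 0 < R ∧ ∀ x : Cyl, φ x ≠ 0 → |x.2| ≤ R := by
  obtain ⟨R, hR⟩ := (h.isCompact.image continuous_snd).isBounded.exists_norm_le
  refine ⟨max R 1, by positivity, fun x hx => le_max_of_le_left ?_⟩
  exact hR _ ⟨x, subset_tsupport _ hx, rfl⟩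

theorem exists_abs_bound {φ : Cyl → ℝ} (hc : Continuous φ) (h : HasCompactSupport φ) :
    ∃ M : ℝ, 0 ≤ M ∧ ∀ x : Cyl, |φ x| ≤ M := by
  obtain ⟨M, hM⟩ := hc.bounded_above_of_compact_support h
  exact ⟨M, (norm_nonneg _).trans (hM 0), hM⟩

/-! ### Green's theorem for the region below the graph of a function -/

theorem HasCompactSupport.slice_left {K : ℝ × ℝ → ℝ} (hK : HasCompactSupport K) (t : ℝ) :
    HasCompactSupport fun s => K (s, t) :=
  HasCompactSupport.of_support_subset_isCompact (hK.isCompact.image continuous_fst)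
    fun s hs => ⟨(s, t), subset_tsupport _ hs, rfl⟩

theorem HasCompactSupport.slice_right {K : ℝ × ℝ → ℝ} (hK : HasCompactSupport K) (s : ℝ) :
    HasCompactSupport fun t => K (s, t) :=
  HasCompactSupport.of_support_subset_isCompact (hK.isCompact.image continuous_snd)
    fun t ht => ⟨(s, t), subset_tsupport _ ht, rfl⟩

theorem HasCompactSupport.fderiv_apply' {K : ℝ × ℝ → ℝ} (hK : HasCompactSupport K) (v : ℝ × ℝ) :
    HasCompactSupport fun y => fderiv ℝ K y v :=
  (hK.fderiv (𝕜 := ℝ)).mono' fun y hy => subset_tsupport _ fun h => hy (by simp [h])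

theorem continuous_fderiv_apply' {K : ℝ × ℝ → ℝ} (hK : ContDiff ℝ 1 K) (v : ℝ × ℝ) :
    Continuous fun y => fderiv ℝ K y v :=
  (hK.continuous_fderiv (by simp)).clm_apply continuous_const

theorem hasDerivAt_slice_left {K : ℝ × ℝ → ℝ} (hK : ContDiff ℝ 1 K) (s t : ℝ) :
    HasDerivAt (fun s => K (s, t)) (fderiv ℝ K (s, t) (1, 0)) s :=
  (hK.differentiable (by simp) (s, t)).hasFDerivAt.comp_hasDerivAt s
    ((hasDerivAt_id s).prodMk (hasDerivAt_const s t))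

theorem hasDerivAt_slice_right {K : ℝ × ℝ → ℝ} (hK : ContDiff ℝ 1 K) (s t : ℝ) :
    HasDerivAt (fun t => K (s, t)) (fderiv ℝ K (s, t) (0, 1)) t :=
  (hK.differentiable (by simp) (s, t)).hasFDerivAt.comp_hasDerivAt t
    ((hasDerivAt_const t s).prodMk (hasDerivAt_id t))

theorem integral_lowerHalf_fderiv_fst {K : ℝ × ℝ → ℝ} (hK : ContDiff ℝ 1 K)
    (hc : HasCompactSupport K) :
    ∫ y in Set.univ ×ˢ Set.Iio (0 : ℝ), fderiv ℝ K y (1, 0) = 0 := by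
  have hi := (continuous_fderiv_apply' hK (1, 0)).integrable_of_hasCompactSupport (μ := volume)
    (HasCompactSupport.fderiv_apply' hc _)
  rw [Measure.volume_eq_prod, ← Measure.prod_restrict, integral_prod_symm]
  · refine (integral_congr_ae (.of_forall fun t => ?_)).trans (integral_zero _ _)
    simp only [Measure.restrict_univ]
    refine integral_eq_zero_of_hasDerivAt_of_integrable (fun s => hasDerivAt_slice_left hK s t)
      ?_ ?_
    · exact ((continuous_fderiv_apply' hK (1, 0)).comp
        (by fun_prop : Continuous fun s : ℝ => (s, t))).integrable_of_hasCompactSupport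
        (HasCompactSupport.slice_left (HasCompactSupport.fderiv_apply' hc _) t)
    · exact (hK.continuous.comp
        (by fun_prop : Continuous fun s : ℝ => (s, t))).integrable_of_hasCompactSupport
        (HasCompactSupport.slice_left hc t)
  · rw [Measure.prod_restrict]; exact hi.integrableOn

/-- The weight depends on the abscissa alone and so leaves the inner integral; it is to be the slope
of a graph that has been straightened to the axis. -/
theorem integral_lowerHalf_fderiv_snd {K : ℝ × ℝ → ℝ} (hK : ContDiff ℝ 1 K)
    (hc : HasCompactSupport K) {w : ℝ → ℝ} (hw : Continuous w) :
    ∫ y in Set.univ ×ˢ Set.Iio (0 : ℝ), w y.1 * fderiv ℝ K y (0, 1) = ∫ s, w s * K (s, 0) := by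
  have hi : Integrable (fun y : ℝ × ℝ => w y.1 * fderiv ℝ K y (0, 1)) :=
    ((hw.comp continuous_fst).mul
      (continuous_fderiv_apply' hK (0, 1))).integrable_of_hasCompactSupport (μ := volume)
      (HasCompactSupport.fderiv_apply' hc _).mul_left
  rw [Measure.volume_eq_prod, setIntegral_prod]
  · rw [Measure.restrict_univ]
    congr 1 with s
    change ∫ t in Set.Iio 0, w s * fderiv ℝ K (s, t) (0, 1) = _
    rw [integral_const_mul, ← integral_Iic_eq_integral_Iio]
    congr 1
    have h1 : ContDiff ℝ 1 fun t => K (s, t) := hK.comp (contDiff_const.prodMk contDiff_id)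
    rw [← HasCompactSupport.integral_Iic_deriv_eq h1 (HasCompactSupport.slice_right hc s) 0]
    congr 1 with t
    exact (hasDerivAt_slice_right hK s t).deriv.symm
  · exact hi.integrableOn

/-- The shear `(s, t) ↦ (s, t + g s)`. -/
def shear {g : ℝ → ℝ} (hg : Continuous g) : ℝ × ℝ ≃ₜ ℝ × ℝ where
  toFun y := (y.1, y.2 + g y.1)
  invFun y := (y.1, y.2 - g y.1)
  left_inv y := by simp
  right_inv y := by simp
  continuous_toFun := by fun_prop
  continuous_invFun := by fun_prop

theorem measurePreserving_shear {g : ℝ → ℝ} (hg : Continuous g) :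
    MeasurePreserving (shear hg) volume volume :=
  (MeasurePreserving.id (volume : Measure ℝ)).skew_product (g := fun s t => t + g s)
    (by fun_prop) (.of_forall fun s => map_add_right_eq_self volume (g s))

theorem setIntegral_subgraph {g : ℝ → ℝ} (hg : Continuous g) (k : ℝ × ℝ → ℝ) :
    ∫ y in {y : ℝ × ℝ | y.2 < g y.1}, k y =
      ∫ y in Set.univ ×ˢ Set.Iio (0 : ℝ), k (shear hg y) := by
  rw [← (measurePreserving_shear hg).setIntegral_preimage_emb
    (shear hg).measurableEmbedding]
  congr 2
  ext y
  simp [shear]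

/-- The shear preserves area and carries the lower half plane to the subgraph. In sheared
coordinates ∂₁ becomes ∂₁ − g′ ∂₂, and the second term produces the factor g′ on the boundary. A
shear of class C¹ is enough, since only first derivatives of the pulled back functions occur. -/
theorem integral_subgraph_curl {g : ℝ → ℝ} (hg : ContDiff ℝ 1 g) {H₁ H₂ : ℝ × ℝ → ℝ}
    (h₁ : ContDiff ℝ 1 H₁) (h₂ : ContDiff ℝ 1 H₂) (c₁ : HasCompactSupport H₁)
    (c₂ : HasCompactSupport H₂) :
    ∫ y in {y : ℝ × ℝ | y.2 < g y.1}, (fderiv ℝ H₂ y (1, 0) - fderiv ℝ H₁ y (0, 1)) =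
      -∫ s, (H₁ (s, g s) + H₂ (s, g s) * deriv g s) := by
  have hg' : Continuous (deriv g) := hg.continuous_deriv (by simp)
  set S := shear hg.continuous with hS
  have hSd : ContDiff ℝ 1 S := by
    change ContDiff ℝ 1 fun y : ℝ × ℝ => (y.1, y.2 + g y.1)
    fun_prop
  have hSf : ∀ y v, fderiv ℝ S y v = (v.1, v.2 + deriv g y.1 * v.1) := by
    intro y v
    have h1 : HasFDerivAt (fun y : ℝ × ℝ => g y.1)
        (deriv g y.1 • ContinuousLinearMap.fst ℝ ℝ ℝ) y :=
      (hg.differentiable (by simp) y.1).hasDerivAt.comp_hasFDerivAt y hasFDerivAt_fst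
    have h2 : HasFDerivAt S ((ContinuousLinearMap.fst ℝ ℝ ℝ).prod
        (ContinuousLinearMap.snd ℝ ℝ ℝ + deriv g y.1 • ContinuousLinearMap.fst ℝ ℝ ℝ)) y :=
      hasFDerivAt_fst.prodMk (hasFDerivAt_snd.add h1)
    rw [h2.fderiv]
    simp
  have hK : ∀ {H : ℝ × ℝ → ℝ}, ContDiff ℝ 1 H → ∀ y v,
      fderiv ℝ (H ∘ S) y v = fderiv ℝ H (S y) (v.1, v.2 + deriv g y.1 * v.1) := by
    intro H hH y v
    rw [fderiv_comp _ (hH.differentiable (by simp) _) (hSd.differentiable (by simp) _)]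
    simp [hSf]
  have k₁ : ContDiff ℝ 1 (H₁ ∘ S) := h₁.comp hSd
  have k₂ : ContDiff ℝ 1 (H₂ ∘ S) := h₂.comp hSd
  have d₁ : HasCompactSupport (H₁ ∘ S) := c₁.comp_homeomorph S
  have d₂ : HasCompactSupport (H₂ ∘ S) := c₂.comp_homeomorph S
  rw [setIntegral_subgraph hg.continuous]
  have e : ∀ y, fderiv ℝ H₂ (S y) (1, 0) - fderiv ℝ H₁ (S y) (0, 1) =
      fderiv ℝ (H₂ ∘ S) y (1, 0) - deriv g y.1 * fderiv ℝ (H₂ ∘ S) y (0, 1)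
        - 1 * fderiv ℝ (H₁ ∘ S) y (0, 1) := by
    intro y
    rw [hK h₂, hK h₂, hK h₁]
    simp only [mul_one, mul_zero, add_zero, zero_add, one_mul]
    have : ((1 : ℝ), deriv g y.1) = (1, 0) + deriv g y.1 • ((0 : ℝ), (1 : ℝ)) := by simp
    rw [this, map_add, map_smul, smul_eq_mul]
    ring
  simp_rw [← hS, e]
  have i₁ : Integrable (fun y : ℝ × ℝ => fderiv ℝ (H₂ ∘ S) y (1, 0)) :=
    (continuous_fderiv_apply' k₂ _).integrable_of_hasCompactSupport
      (HasCompactSupport.fderiv_apply' d₂ _)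
  have i₂ : Integrable (fun y : ℝ × ℝ => deriv g y.1 * fderiv ℝ (H₂ ∘ S) y (0, 1)) :=
    ((hg'.comp continuous_fst).mul
      (continuous_fderiv_apply' k₂ _)).integrable_of_hasCompactSupport
      (HasCompactSupport.fderiv_apply' d₂ _).mul_left
  have i₃ : Integrable (fun y : ℝ × ℝ => 1 * fderiv ℝ (H₁ ∘ S) y (0, 1)) :=
    (continuous_const.mul
      (continuous_fderiv_apply' k₁ _)).integrable_of_hasCompactSupport
      (HasCompactSupport.fderiv_apply' d₁ _).mul_left
  have i₄ : Integrable (fun y : ℝ × ℝ => fderiv ℝ (H₂ ∘ S) y (1, 0) -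
      deriv g y.1 * fderiv ℝ (H₂ ∘ S) y (0, 1)) := i₁.sub i₂
  rw [integral_sub i₄.integrableOn i₃.integrableOn,
    integral_sub i₁.integrableOn i₂.integrableOn, integral_lowerHalf_fderiv_fst k₂ d₂,
    integral_lowerHalf_fderiv_snd k₂ d₂ hg', integral_lowerHalf_fderiv_snd k₁ d₁ continuous_const]
  have hS0 : ∀ s, S (s, 0) = (s, g s) := fun s => by
    change (s, 0 + g s) = _
    rw [zero_add]
  have j₁ : Integrable (fun s : ℝ => H₁ (s, g s)) :=
    (h₁.continuous.comp (continuous_id.prodMk hg.continuous)).integrable_of_hasCompactSupport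
      (by simpa only [Function.comp_def, hS0, id] using HasCompactSupport.slice_left d₁ 0)
  have j₂ : Integrable (fun s : ℝ => H₂ (s, g s) * deriv g s) :=
    ((h₂.continuous.comp (continuous_id.prodMk hg.continuous)).mul
      hg').integrable_of_hasCompactSupport
      (HasCompactSupport.mul_right
        (by simpa only [Function.comp_def, hS0, id] using HasCompactSupport.slice_left d₂ 0))
  rw [integral_add j₁ j₂]
  simp only [Function.comp_apply, hS0, one_mul, mul_comm (deriv g _)]
  ring

/-- Reflection in the horizontal axis turns the supergraph of `g` into the subgraph of `-g`. It
reverses ∂₂, which the sign change of `H₁` compensates. -/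
theorem integral_supergraph_curl {g : ℝ → ℝ} (hg : ContDiff ℝ 1 g) {H₁ H₂ : ℝ × ℝ → ℝ}
    (h₁ : ContDiff ℝ 1 H₁) (h₂ : ContDiff ℝ 1 H₂) (c₁ : HasCompactSupport H₁)
    (c₂ : HasCompactSupport H₂) :
    ∫ y in {y : ℝ × ℝ | g y.1 < y.2}, (fderiv ℝ H₂ y (1, 0) - fderiv ℝ H₁ y (0, 1)) =
      ∫ s, (H₁ (s, g s) + H₂ (s, g s) * deriv g s) := by
  let N : ℝ × ℝ ≃ₜ ℝ × ℝ := (Homeomorph.refl ℝ).prodCongr (Homeomorph.neg ℝ)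
  have hN : ∀ y, N y = (y.1, -y.2) := fun y => rfl
  have hNm : MeasurePreserving N volume volume :=
    (MeasurePreserving.id (volume : Measure ℝ)).prod (Measure.measurePreserving_neg volume)
  let M : ℝ × ℝ →L[ℝ] ℝ × ℝ :=
    (ContinuousLinearMap.fst ℝ ℝ ℝ).prod (-ContinuousLinearMap.snd ℝ ℝ ℝ)
  have hM : ∀ y, M y = (y.1, -y.2) := fun y => rfl
  have hNd : ContDiff ℝ 1 N := M.contDiff
  have hf : ∀ {H : ℝ × ℝ → ℝ}, ContDiff ℝ 1 H → ∀ y v,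
      fderiv ℝ (H ∘ N) y v = fderiv ℝ H (N y) (v.1, -v.2) := by
    intro H hH y v
    rw [fderiv_comp _ (hH.differentiable (by simp) _) (hNd.differentiable (by simp) _)]
    rw [show fderiv ℝ N y = M from M.hasFDerivAt.fderiv]
    simp [hM]
  have key := integral_subgraph_curl hg.neg (h₁.comp hNd).neg (h₂.comp hNd)
    (c₁.comp_homeomorph N).neg (c₂.comp_homeomorph N)
  rw [← hNm.setIntegral_preimage_emb N.measurableEmbedding]
  have hset : (N ⁻¹' {y : ℝ × ℝ | g y.1 < y.2}) = {y : ℝ × ℝ | y.2 < -g y.1} := by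
    ext y; simp only [hN, Set.mem_preimage, Set.mem_ofPred_eq]; constructor <;> intro h <;> linarith
  rw [hset]
  have e : ∀ y, fderiv ℝ H₂ (N y) (1, 0) - fderiv ℝ H₁ (N y) (0, 1) =
     fderiv ℝ (H₂ ∘ N) y (1, 0) - fderiv ℝ (fun y => -(H₁ ∘ N) y) y (0, 1) := by
    intro y
    rw [fderiv_fun_neg, neg_apply, hf h₁, hf h₂]
    simp only [neg_zero, sub_neg_eq_add]
    rw [show ((0 : ℝ), -(1 : ℝ)) = -(0, 1) by simp, map_neg]; ring
  simp_rw [e]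
  rw [key, ← integral_neg]
  congr 1 with s
  simp [hN]
  ring

theorem fderiv_comp_swap {H : ℝ × ℝ → ℝ} (hH : ContDiff ℝ 1 H) (y v : ℝ × ℝ) :
    fderiv ℝ (H ∘ Prod.swap) y v = fderiv ℝ H y.swap v.swap := by
  let M : ℝ × ℝ →L[ℝ] ℝ × ℝ :=
    (ContinuousLinearMap.snd ℝ ℝ ℝ).prod (ContinuousLinearMap.fst ℝ ℝ ℝ)
  have h := (hH.differentiable (by simp) y.swap).hasFDerivAt.comp y
    (show HasFDerivAt Prod.swap M y from M.hasFDerivAt)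
  rw [h.fderiv]
  rfl

theorem setIntegral_preimage_swap (s : Set (ℝ × ℝ)) (k : ℝ × ℝ → ℝ) :
    ∫ y in Prod.swap ⁻¹' s, k y.swap = ∫ y in s, k y :=
  (Measure.measurePreserving_swap (μ := (volume : Measure ℝ)) (ν := (volume : Measure ℝ))
    ).setIntegral_preimage_emb (MeasurableEquiv.prodComm (α := ℝ) (β := ℝ)).measurableEmbedding k s

/-- Swapping the coordinates reduces to a subgraph. The swap reverses orientation, so `H₁` and `H₂`
trade places and the curl changes sign. -/
theorem integral_leftgraph_curl {g : ℝ → ℝ} (hg : ContDiff ℝ 1 g) {H₁ H₂ : ℝ × ℝ → ℝ}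
    (h₁ : ContDiff ℝ 1 H₁) (h₂ : ContDiff ℝ 1 H₂) (c₁ : HasCompactSupport H₁)
    (c₂ : HasCompactSupport H₂) :
    ∫ y in {y : ℝ × ℝ | y.1 < g y.2}, (fderiv ℝ H₂ y (1, 0) - fderiv ℝ H₁ y (0, 1)) =
      ∫ s, (H₁ (g s, s) * deriv g s + H₂ (g s, s)) := by
  have hs : ContDiff ℝ 1 (Prod.swap : ℝ × ℝ → ℝ × ℝ) := contDiff_snd.prodMk contDiff_fst
  have key := integral_subgraph_curl hg (h₂.comp hs) (h₁.comp hs)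
    (c₂.comp_homeomorph (Homeomorph.prodComm ℝ ℝ)) (c₁.comp_homeomorph (Homeomorph.prodComm ℝ ℝ))
  rw [← setIntegral_preimage_swap]
  simp only [fderiv_comp_swap h₁, fderiv_comp_swap h₂, Prod.swap_prod_mk] at key
  have : ∫ y in Prod.swap ⁻¹' {y : ℝ × ℝ | y.1 < g y.2},
      (fderiv ℝ H₂ y.swap (1, 0) - fderiv ℝ H₁ y.swap (0, 1)) =
      -∫ y in {y : ℝ × ℝ | y.2 < g y.1},
      (fderiv ℝ H₁ y.swap (0, 1) - fderiv ℝ H₂ y.swap (1, 0)) := by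
    rw [← integral_neg]; congr 1 with y; ring
  rw [this, key, neg_neg]
  congr 1 with s
  simp; ring

theorem integral_rightgraph_curl {g : ℝ → ℝ} (hg : ContDiff ℝ 1 g) {H₁ H₂ : ℝ × ℝ → ℝ}
    (h₁ : ContDiff ℝ 1 H₁) (h₂ : ContDiff ℝ 1 H₂) (c₁ : HasCompactSupport H₁)
    (c₂ : HasCompactSupport H₂) :
    ∫ y in {y : ℝ × ℝ | g y.2 < y.1}, (fderiv ℝ H₂ y (1, 0) - fderiv ℝ H₁ y (0, 1)) =
      -∫ s, (H₁ (g s, s) * deriv g s + H₂ (g s, s)) := by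
  have hs : ContDiff ℝ 1 (Prod.swap : ℝ × ℝ → ℝ × ℝ) := contDiff_snd.prodMk contDiff_fst
  have key := integral_supergraph_curl hg (h₂.comp hs) (h₁.comp hs)
    (c₂.comp_homeomorph (Homeomorph.prodComm ℝ ℝ)) (c₁.comp_homeomorph (Homeomorph.prodComm ℝ ℝ))
  rw [← setIntegral_preimage_swap]
  simp only [fderiv_comp_swap h₁, fderiv_comp_swap h₂, Prod.swap_prod_mk] at key
  have : ∫ y in Prod.swap ⁻¹' {y : ℝ × ℝ | g y.2 < y.1},
      (fderiv ℝ H₂ y.swap (1, 0) - fderiv ℝ H₁ y.swap (0, 1)) =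
      -∫ y in {y : ℝ × ℝ | g y.1 < y.2},
      (fderiv ℝ H₁ y.swap (0, 1) - fderiv ℝ H₂ y.swap (1, 0)) := by
    rw [← integral_neg]; congr 1 with y; ring
  rw [this, key]
  congr 2 with s
  simp; ring

/-! ### Charts at the boundary -/

/-- Near the point `p` of the plane, the boundary of `Ω` is the graph `c` over one of the
coordinate axes, `Ω` lies to the left of `σ c'`, and Green's theorem holds. -/
structure GraphChart (Ω : Set Cyl) (p : ℝ × ℝ) where
  δ : ℝ
  δ_pos : 0 < δ
  δ_lt : δ < 1 / 2
  c : ℝ → ℝ × ℝ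
  contDiff : ContDiff ℝ 1 c
  π : ℝ × ℝ →L[ℝ] ℝ
  π_eq : π = ContinuousLinearMap.fst ℝ ℝ ℝ ∨ π = ContinuousLinearMap.snd ℝ ℝ ℝ
  π_c : ∀ s, π (c s) = s
  σ : ℝ
  σ_eq : σ = 1 ∨ σ = -1
  frontier_iff : ∀ y ∈ Metric.ball p δ, toCyl y ∈ frontier Ω ↔ c (π y) = y
  left : ∀ y ∈ Metric.ball p δ, c (π y) = y → ∀ r : ℝ, r ≠ 0 →
    (∀ᶠ t in 𝓝[>] (0 : ℝ), toCyl (y + t • perp (r • deriv c (π y))) ∈ Ω) → 0 < σ * r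
  green : ∀ H₁ H₂ : ℝ × ℝ → ℝ, ContDiff ℝ 1 H₁ → ContDiff ℝ 1 H₂ →
    HasCompactSupport H₁ → HasCompactSupport H₂ →
    tsupport H₁ ⊆ Metric.ball p δ → tsupport H₂ ⊆ Metric.ball p δ →
    ∫ y in toCyl ⁻¹' Ω, (fderiv ℝ H₂ y (1, 0) - fderiv ℝ H₁ y (0, 1)) =
      σ * ∫ s, (H₁ (c s) * (deriv c s).1 + H₂ (c s) * (deriv c s).2)

theorem toCyl_mem_frontier_iff {Ω : Set Cyl} {y : ℝ × ℝ} :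
    toCyl y ∈ frontier Ω ↔ y ∈ frontier (toCyl ⁻¹' Ω) := by
  rw [← isOpenMap_toCyl.preimage_frontier_eq_frontier_preimage continuous_toCyl]
  rfl

/-- Along `e` the function `κ` increases at unit speed, so both signs occur arbitrarily close to
each of its zeros. -/
theorem mem_frontier_iff_defining_eq_zero {U : Set (ℝ × ℝ)} {κ : ℝ × ℝ → ℝ} (hκ : Continuous κ)
    {e : ℝ × ℝ} (he : ∀ y (t : ℝ), κ (y + t • e) = κ y + t) {y : ℝ × ℝ}
    (hU : ∀ᶠ z in 𝓝 y, z ∈ U ↔ κ z < 0) : y ∈ frontier U ↔ κ y = 0 := by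
  have hline : ∀ a : ℝ, Tendsto (fun t : ℝ => y + (a * t) • e) (𝓝[>] 0) (𝓝 y) := by
    intro a
    have : Continuous fun t : ℝ => y + (a * t) • e := by fun_prop
    exact (by simpa using this.tendsto 0 : Tendsto _ _ (𝓝 y)).mono_left nhdsWithin_le_nhds
  constructor
  · intro hy
    rcases lt_trichotomy (κ y) 0 with h | h | h
    · refine absurd (mem_interior_iff_mem_nhds.2 ?_) hy.2
      filter_upwards [hU, hκ.continuousAt.eventually_lt continuousAt_const h] with z h1 h2
      exact h1.2 h2
    · exact h
    · refine absurd hy.1 ?_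
      rw [mem_closure_iff_frequently, not_frequently]
      filter_upwards [hU, continuousAt_const.eventually_lt hκ.continuousAt h] with z h1 h2 h3
      exact lt_asymm h2 (h1.1 h3)
  · intro h0
    refine ⟨?_, fun hi => ?_⟩
    · rw [mem_closure_iff_frequently]
      refine (hline (-1)).frequently (Eventually.frequently ?_)
      filter_upwards [(hline (-1)).eventually hU, self_mem_nhdsWithin] with t h1 (h2 : 0 < t)
      rw [h1, he, h0]
      linarith
    · have h1 := (hline 1).eventually (hU.and (mem_interior_iff_mem_nhds.1 hi))
      obtain ⟨t, ⟨h2, h3⟩, h4⟩ := (h1.and self_mem_nhdsWithin).exists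
      have := h2.1 h3
      rw [he, h0] at this
      have h5 : 0 < t := h4
      linarith

theorem le_zero_of_hasDerivAt_of_eventually_lt {f : ℝ → ℝ} {d : ℝ} (hf : HasDerivAt f d 0)
    (h0 : f 0 = 0) (h : ∀ᶠ t in 𝓝[>] (0 : ℝ), f t < 0) : d ≤ 0 := by
  have := (hasDerivWithinAt_iff_tendsto_slope' (s := Set.Ioi (0 : ℝ)) (by simp)).1
    hf.hasDerivWithinAt
  refine le_of_tendsto this ?_
  filter_upwards [h, self_mem_nhdsWithin] with t h1 h2
  rw [slope_def_field, h0]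
  simp only [Set.mem_Ioi] at h2
  exact div_nonpos_of_nonpos_of_nonneg (by linarith) (by linarith)

/-- The four positions of Ω relative to a graph differ only in the defining function `κ`, negative
in Ω, and in the sign `σ`. In `hder` the number `m` is the slope of the graph, so that 1 + m² =
|c′|². If the ray to the left of r c′ enters Ω, then `κ` cannot increase along it, and σ r cannot be
negative. -/
theorem nonempty_graphChart_of_defining {Ω : Set Cyl} (hΩ : IsOpen Ω) {p : ℝ × ℝ}
    {κ : ℝ × ℝ → ℝ} (hκ : Continuous κ)
    {e : ℝ × ℝ} (he : ∀ y (t : ℝ), κ (y + t • e) = κ y + t)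
    {c : ℝ → ℝ × ℝ} (hc : ContDiff ℝ 1 c) {π : ℝ × ℝ →L[ℝ] ℝ}
    (hπ : π = ContinuousLinearMap.fst ℝ ℝ ℝ ∨ π = ContinuousLinearMap.snd ℝ ℝ ℝ)
    (hπc : ∀ s, π (c s) = s) {σ : ℝ} (hσ : σ = 1 ∨ σ = -1)
    (hκc : ∀ y, κ y = 0 ↔ c (π y) = y)
    (hder : ∀ y, ∃ m : ℝ, ∀ r,
      HasDerivAt (fun t : ℝ => κ (y + t • perp (r • deriv c (π y)))) (-(σ * r * (1 + m ^ 2))) 0)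
    (hgreen : ∀ H₁ H₂ : ℝ × ℝ → ℝ, ContDiff ℝ 1 H₁ → ContDiff ℝ 1 H₂ →
      HasCompactSupport H₁ → HasCompactSupport H₂ →
      ∫ y in {y | κ y < 0}, (fderiv ℝ H₂ y (1, 0) - fderiv ℝ H₁ y (0, 1)) =
        σ * ∫ s, (H₁ (c s) * (deriv c s).1 + H₂ (c s) * (deriv c s).2))
    (hev : ∀ᶠ y in 𝓝 p, toCyl y ∈ Ω ↔ κ y < 0) : Nonempty (GraphChart Ω p) := by
  obtain ⟨δ₀, hδ₀, hb⟩ := Metric.eventually_nhds_iff_ball.1 hev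
  have hloc : ∀ y ∈ Metric.ball p (min δ₀ (1 / 4)), ∀ᶠ z in 𝓝 y, toCyl z ∈ Ω ↔ κ z < 0 :=
    fun y hy => by
      filter_upwards [Metric.isOpen_ball.mem_nhds hy] with z hz
      exact hb z (Metric.ball_subset_ball (min_le_left _ _) hz)
  refine ⟨⟨min δ₀ (1 / 4), by positivity, ?_, c, hc, π, hπ, hπc, σ, hσ, ?_, ?_, ?_⟩⟩
  · exact (min_le_right _ _).trans_lt (by norm_num)
  · intro y hy
    rw [toCyl_mem_frontier_iff, ← hκc]
    exact mem_frontier_iff_defining_eq_zero hκ he (hloc y hy)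
  · intro y hy hcy r hr hl
    obtain ⟨m, hm⟩ := hder y
    have h0 : Tendsto (fun t : ℝ => y + t • perp (r • deriv c (π y))) (𝓝[>] 0) (𝓝 y) := by
      have : Continuous fun t : ℝ => y + t • perp (r • deriv c (π y)) := by fun_prop
      exact (by simpa using this.tendsto 0 : Tendsto _ _ (𝓝 y)).mono_left nhdsWithin_le_nhds
    have h1 := le_zero_of_hasDerivAt_of_eventually_lt (hm r) (by simpa using (hκc y).2 hcy) (by
      filter_upwards [hl, h0.eventually (hloc y hy)] with t h2 h3
      exact h3.1 h2)
    have h2 : 0 ≤ σ * r := by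
      by_contra h
      nlinarith [sq_nonneg m]
    have h3 : σ * r ≠ 0 := mul_ne_zero (by rcases hσ with h | h <;> simp [h]) hr
    exact lt_of_le_of_ne h2 h3.symm
  · intro H₁ H₂ h₁ h₂ c₁ c₂ t₁ t₂
    rw [← hgreen H₁ H₂ h₁ h₂ c₁ c₂,
      ← integral_indicator (hΩ.preimage continuous_toCyl).measurableSet,
      ← integral_indicator (isOpen_lt hκ continuous_const).measurableSet]
    congr 1 with y
    by_cases hy : y ∈ Metric.ball p (min δ₀ (1 / 4))
    · have := (hloc y hy).self_of_nhds
      by_cases h : toCyl y ∈ Ω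
      · rw [Set.indicator_of_mem (by exact h), Set.indicator_of_mem (by exact this.1 h)]
      · rw [Set.indicator_of_notMem (by exact h), Set.indicator_of_notMem
          (by exact fun h' => h (this.2 h'))]
    · have z₁ : fderiv ℝ H₁ y = 0 := by
        by_contra h
        exact hy (t₁ (support_fderiv_subset ℝ h))
      have z₂ : fderiv ℝ H₂ y = 0 := by
        by_contra h
        exact hy (t₂ (support_fderiv_subset ℝ h))
      simp [Set.indicator_apply, z₁, z₂]

theorem IsC1HolderRegion.nonempty_graphChart {ε : ℝ≥0} {Ω : Set Cyl} (hΩ : IsC1HolderRegion ε Ω)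
    {p : ℝ × ℝ} (hp : toCyl p ∈ frontier Ω) : Nonempty (GraphChart Ω p) := by
  obtain ⟨g, ⟨hg, -⟩, h⟩ := hΩ.local_graph p hp
  have hgd : ∀ s, HasDerivAt g (deriv g s) s := fun s =>
    (hg.differentiable (by simp) s).hasDerivAt
  have hgc : Continuous g := hg.continuous
  have hfst : ContDiff ℝ 1 fun s => (s, g s) := contDiff_id.prodMk hg
  have hsnd : ContDiff ℝ 1 fun s => (g s, s) := hg.prodMk contDiff_id
  have dfst : ∀ s, deriv (fun s => (s, g s)) s = (1, deriv g s) := fun s =>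
    ((hasDerivAt_id s).prodMk (hgd s)).deriv
  have dsnd : ∀ s, deriv (fun s => (g s, s)) s = (deriv g s, 1) := fun s =>
    ((hgd s).prodMk (hasDerivAt_id s)).deriv
  -- The derivative of the height above the graph along the normal (−g′, 1), scaled by `d`. The four
  -- cases below use it up to a sign and a swap of coordinates.
  have key : ∀ a b d : ℝ, HasDerivAt (fun t : ℝ => b + t * d - g (a + t * (-(d * deriv g a))))
      (d * (1 + deriv g a ^ 2)) 0 := by
    intro a b d
    have h1 : HasDerivAt (fun t : ℝ => a + t * (-(d * deriv g a))) (-(d * deriv g a)) 0 := by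
      simpa using ((hasDerivAt_id (0 : ℝ)).mul_const (-(d * deriv g a))).const_add a
    have h2 : HasDerivAt (fun t : ℝ => b + t * d) d 0 := by
      simpa using ((hasDerivAt_id (0 : ℝ)).mul_const d).const_add b
    have h3 : HasDerivAt g (deriv g a) (a + 0 * (-(d * deriv g a))) := by simpa using hgd a
    exact (h2.sub (h3.comp (0 : ℝ) h1)).congr_deriv (by ring)
  rcases h with h | h | h | h
  · refine nonempty_graphChart_of_defining hΩ.isOpen (κ := fun y => y.2 - g y.1) (by fun_prop)
      (e := (0, 1)) (fun y t => by simp; ring) hfst (.inl rfl) (fun s => rfl) (σ := -1) (.inr rfl)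
      (fun y => by simp [Prod.ext_iff, sub_eq_zero, eq_comm]) (fun y => ⟨deriv g y.1, fun r => ?_⟩)
      (fun H₁ H₂ h₁ h₂ c₁ c₂ => ?_) (by simpa only [sub_neg] using h)
    · simp only [dfst, perp]
      refine ((key y.1 y.2 r).congr_deriv (by ring)).congr_of_eventuallyEq
        (.of_forall fun t => ?_)
      simp
    · simp only [dfst, mul_one, sub_neg]
      rw [integral_subgraph_curl hg h₁ h₂ c₁ c₂]; ring
  · refine nonempty_graphChart_of_defining hΩ.isOpen (κ := fun y => g y.1 - y.2) (by fun_prop)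
      (e := (0, -1)) (fun y t => by simp; ring) hfst (.inl rfl) (fun s => rfl) (σ := 1) (.inl rfl)
      (fun y => by simp [Prod.ext_iff, sub_eq_zero]) (fun y => ⟨deriv g y.1, fun r => ?_⟩)
      (fun H₁ H₂ h₁ h₂ c₁ c₂ => ?_) (by simpa only [sub_neg] using h)
    · simp only [dfst, perp]
      refine (((key y.1 y.2 r).neg).congr_deriv (by ring)).congr_of_eventuallyEq
        (.of_forall fun t => ?_)
      simp
    · simp only [dfst, mul_one, sub_neg]
      rw [integral_supergraph_curl hg h₁ h₂ c₁ c₂]; ring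
  · refine nonempty_graphChart_of_defining hΩ.isOpen (κ := fun y => y.1 - g y.2) (by fun_prop)
      (e := (1, 0)) (fun y t => by simp; ring) hsnd (.inr rfl) (fun s => rfl) (σ := 1) (.inl rfl)
      (fun y => by simp [Prod.ext_iff, sub_eq_zero, eq_comm]) (fun y => ⟨deriv g y.2, fun r => ?_⟩)
      (fun H₁ H₂ h₁ h₂ c₁ c₂ => ?_) (by simpa only [sub_neg] using h)
    · simp only [dsnd, perp]
      refine ((key y.2 y.1 (-r)).congr_deriv (by ring)).congr_of_eventuallyEq
        (.of_forall fun t => ?_)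
      simp
    · simp only [dsnd, mul_one, sub_neg]
      rw [integral_leftgraph_curl hg h₁ h₂ c₁ c₂]; ring
  · refine nonempty_graphChart_of_defining hΩ.isOpen (κ := fun y => g y.2 - y.1) (by fun_prop)
      (e := (-1, 0)) (fun y t => by simp; ring) hsnd (.inr rfl) (fun s => rfl) (σ := -1) (.inr rfl)
      (fun y => by simp [Prod.ext_iff, sub_eq_zero]) (fun y => ⟨deriv g y.2, fun r => ?_⟩)
      (fun H₁ H₂ h₁ h₂ c₁ c₂ => ?_) (by simpa only [sub_neg] using h)
    · simp only [dsnd, perp]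
      refine (((key y.2 y.1 (-r)).neg).congr_deriv (by ring)).congr_of_eventuallyEq
        (.of_forall fun t => ?_)
      simp
    · simp only [dsnd, mul_one, sub_neg]
      rw [integral_rightgraph_curl hg h₁ h₂ c₁ c₂]; ring

/-! ### The boundary parametrization in a chart -/

theorem round_eq_of_abs_sub_lt {x : ℝ} {n : ℤ} (h : |x - n| < 1 / 2) : round x = n := by
  rw [abs_lt] at h
  rw [round_eq, Int.floor_eq_iff]
  constructor <;> linarith [h.1, h.2]

/-- The translate of `y` by a period that is closest to `p`. -/
def nearLift (p y : ℝ × ℝ) : ℝ × ℝ := y - ((round (y.1 - p.1) : ℝ), 0)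

@[simp] theorem toCyl_nearLift (p y : ℝ × ℝ) : toCyl (nearLift p y) = toCyl y :=
  toCyl_sub_int y _

/-- Two lifts of a point of the strip differ by an integer, so at most one of them lies within a
distance `δ < 1/2` of `p`, and rounding finds it. -/
theorem nearLift_eq {p y z : ℝ × ℝ} {δ : ℝ} (hδ : δ < 1 / 2) (hz : z ∈ Metric.ball p δ)
    (h : toCyl y = toCyl z) : nearLift p y = z := by
  obtain ⟨n, rfl⟩ := toCyl_eq_iff.1 h
  have h1 : |y.1 + n - p.1| < 1 / 2 := by
    have := (norm_fst_le (y + ((n : ℝ), (0 : ℝ)) - p)).trans_lt (mem_ball_iff_norm.1 hz)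
    simpa using this.trans hδ
  have h2 : round (y.1 - p.1) = -n := round_eq_of_abs_sub_lt (by
    push_cast; convert h1 using 2; ring)
  simp [nearLift, h2, Prod.ext_iff]

theorem nearLift_mem_ball_iff {p y : ℝ × ℝ} {δ : ℝ} (hδ : δ < 1 / 2) :
    nearLift p y ∈ Metric.ball p δ ↔ toCyl y ∈ toCyl '' Metric.ball p δ := by
  constructor
  · exact fun h => ⟨_, h, by simp⟩
  · rintro ⟨z, hz, h⟩
    rwa [nearLift_eq hδ hz h.symm]

/-- Rounding is locally constant away from the half-integers. Locally `nearLift p` is thus a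
translation and does not affect velocities. -/
theorem nearLift_eventuallyEq {p y : ℝ × ℝ} {δ : ℝ} (hδ : δ < 1 / 2)
    (hy : nearLift p y ∈ Metric.ball p δ) :
    ∀ᶠ z in 𝓝 y, nearLift p z = z - ((round (y.1 - p.1) : ℝ), 0) := by
  have h1 : |y.1 - p.1 - round (y.1 - p.1)| < 1 / 2 := by
    have := (norm_fst_le (nearLift p y - p)).trans_lt (mem_ball_iff_norm.1 hy)
    simp only [nearLift, Prod.fst_sub, Real.norm_eq_abs] at this
    rw [sub_right_comm]
    exact this.trans hδ
  have hc : Continuous fun z : ℝ × ℝ => |z.1 - p.1 - round (y.1 - p.1)| := by fun_prop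
  filter_upwards [hc.continuousAt.eventually_lt continuousAt_const h1] with z hz
  rw [nearLift, round_eq_of_abs_sub_lt hz]

theorem two_pi_pos' : (0 : ℝ) < 2 * Real.pi := by positivity

namespace IsBoundaryParam

variable {Ω : Set Cyl} {J : ℕ} {γ : Fin J → ℝ → ℝ × ℝ}

theorem continuousOn (hγ : IsBoundaryParam Ω γ) (j : Fin J) : ContinuousOn (γ j) paramI :=
  (hγ.contDiffOn j).continuousOn

theorem hasDerivWithinAt (hγ : IsBoundaryParam Ω γ) (j : Fin J) {α : ℝ} (hα : α ∈ paramI) :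
    HasDerivWithinAt (γ j) (tangent (γ j) α) paramI α :=
  ((hγ.contDiffOn j).differentiableOn (by simp) α hα).hasDerivWithinAt

theorem continuousOn_tangent (hγ : IsBoundaryParam Ω γ) (j : Fin J) :
    ContinuousOn (tangent (γ j)) paramI :=
  (hγ.contDiffOn j).continuousOn_derivWithin (uniqueDiffOn_Icc two_pi_pos') le_rfl

theorem mem_frontier (hγ : IsBoundaryParam Ω γ) (j : Fin J) {α : ℝ} (hα : α ∈ paramI) :
    toCyl (γ j α) ∈ frontier Ω := by
  rw [← hγ.cover]
  exact Set.mem_iUnion.2 ⟨j, α, hα, rfl⟩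

theorem exists_param (hγ : IsBoundaryParam Ω γ) {x : Cyl} (hx : x ∈ frontier Ω) :
    ∃ j, ∃ α ∈ Set.Ico 0 (2 * Real.pi), toCyl (γ j α) = x := by
  rw [← hγ.cover] at hx
  obtain ⟨j, α, hα, h⟩ := Set.mem_iUnion.1 hx
  rcases hα.2.lt_or_eq with h1 | rfl
  · exact ⟨j, α, ⟨hα.1, h1⟩, h⟩
  · exact ⟨j, 0, ⟨le_rfl, two_pi_pos'⟩, (hγ.closed j).trans h⟩

theorem eq_of_toCyl_eq (hγ : IsBoundaryParam Ω γ) {i j : Fin J} {α β : ℝ}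
    (hα : α ∈ Set.Ico 0 (2 * Real.pi)) (hβ : β ∈ Set.Ico 0 (2 * Real.pi))
    (h : toCyl (γ i α) = toCyl (γ j β)) : i = j := by
  by_contra hij
  have hd : Disjoint (trace (γ i)) (trace (γ j)) := hγ.disjoint hij
  exact hd.le_bot (show toCyl (γ i α) ∈ trace (γ i) ∩ trace (γ j) from
    ⟨⟨α, Set.Ico_subset_Icc_self hα, rfl⟩, ⟨β, Set.Ico_subset_Icc_self hβ, h.symm⟩⟩)

end IsBoundaryParam

namespace GraphChart

variable {Ω : Set Cyl} {p : ℝ × ℝ} (ch : GraphChart Ω p) {J : ℕ} {γ : Fin J → ℝ → ℝ × ℝ}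

/-- The neighbourhood in the strip on which the chart describes `Ω`. -/
def nbhd : Set Cyl := toCyl '' Metric.ball p ch.δ

theorem isOpen_nbhd : IsOpen ch.nbhd := isOpenMap_toCyl _ Metric.isOpen_ball

theorem mem_nbhd : toCyl p ∈ ch.nbhd := ⟨p, Metric.mem_ball_self ch.δ_pos, rfl⟩

/-- The range of the chart parameter. -/
def base : Set ℝ := {s | ch.c s ∈ Metric.ball p ch.δ}

theorem measurableSet_base : MeasurableSet ch.base :=
  (Metric.isOpen_ball.preimage ch.contDiff.continuous).measurableSet

/-- The parameters that a boundary curve spends in the chart. -/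
def params (g : ℝ → ℝ × ℝ) : Set ℝ :=
  {α | α ∈ Set.Ico 0 (2 * Real.pi) ∧ toCyl (g α) ∈ ch.nbhd}

/-- The chart parameter along a boundary curve. -/
def param (g : ℝ → ℝ × ℝ) (α : ℝ) : ℝ := ch.π (nearLift p (g α))

theorem nearLift_mem {y : ℝ × ℝ} (h : toCyl y ∈ ch.nbhd) : nearLift p y ∈ Metric.ball p ch.δ :=
  (nearLift_mem_ball_iff ch.δ_lt).2 h

theorem measurableSet_params (hγ : IsBoundaryParam Ω γ) (j : Fin J) :
    MeasurableSet (ch.params (γ j)) := by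
  have h : ContinuousOn (fun α => toCyl (γ j α)) (Set.Ico 0 (2 * Real.pi)) :=
    continuous_toCyl.comp_continuousOn ((hγ.continuousOn j).mono Set.Ico_subset_Icc_self)
  obtain ⟨u, hu, h1⟩ := continuousOn_iff'.1 h _ ch.isOpen_nbhd
  have : ch.params (γ j) = u ∩ Set.Ico 0 (2 * Real.pi) := by
    rw [← h1]; ext α; simp [params, and_comm]
  rw [this]
  exact hu.measurableSet.inter measurableSet_Ico

theorem c_param (hγ : IsBoundaryParam Ω γ) (j : Fin J) {α : ℝ} (hα : α ∈ paramI)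
    (h : toCyl (γ j α) ∈ ch.nbhd) : ch.c (ch.param (γ j) α) = nearLift p (γ j α) :=
  (ch.frontier_iff _ (ch.nearLift_mem h)).1 (by simpa using hγ.mem_frontier j hα)

theorem toCyl_c_param (hγ : IsBoundaryParam Ω γ) (j : Fin J) {α : ℝ} (hα : α ∈ paramI)
    (h : toCyl (γ j α) ∈ ch.nbhd) : toCyl (ch.c (ch.param (γ j) α)) = toCyl (γ j α) := by
  rw [ch.c_param hγ j hα h, toCyl_nearLift]

theorem hasDerivWithinAt_nearLift (hγ : IsBoundaryParam Ω γ) (j : Fin J) {α : ℝ}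
    (hα : α ∈ paramI) (h : toCyl (γ j α) ∈ ch.nbhd) :
    HasDerivWithinAt (fun α => nearLift p (γ j α)) (tangent (γ j) α) paramI α := by
  have h1 := nearLift_eventuallyEq ch.δ_lt (ch.nearLift_mem h)
  refine ((hγ.hasDerivWithinAt j hα).sub_const
    ((round ((γ j α).1 - p.1) : ℝ), (0 : ℝ))).congr_of_eventuallyEq ?_ h1.self_of_nhds
  exact (hγ.continuousOn j α hα).eventually h1

theorem hasDerivWithinAt_param (hγ : IsBoundaryParam Ω γ) (j : Fin J) {α : ℝ}
    (hα : α ∈ paramI) (h : toCyl (γ j α) ∈ ch.nbhd) :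
    HasDerivWithinAt (ch.param (γ j)) (ch.π (tangent (γ j) α)) paramI α :=
  ch.π.hasFDerivAt.comp_hasDerivWithinAt α (ch.hasDerivWithinAt_nearLift hγ j hα h)

/-- Near `α`, within the parameter interval, the lifted curve is `ch.c ∘ ch.param (γ j)`. The chain
rule and uniqueness of derivatives within a closed interval give the velocity, end points included.
-/
theorem tangent_eq (hγ : IsBoundaryParam Ω γ) (j : Fin J) {α : ℝ}
    (hα : α ∈ paramI) (h : toCyl (γ j α) ∈ ch.nbhd) :
    tangent (γ j) α = ch.π (tangent (γ j) α) • deriv ch.c (ch.param (γ j) α) := by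
  have h1 : HasDerivWithinAt (fun α => ch.c (ch.param (γ j) α))
      (ch.π (tangent (γ j) α) • deriv ch.c (ch.param (γ j) α)) paramI α :=
    (ch.contDiff.differentiable (by simp) _).hasDerivAt.scomp_hasDerivWithinAt α
      (ch.hasDerivWithinAt_param hγ j hα h)
  have h2 := ch.hasDerivWithinAt_nearLift hγ j hα h
  have h3 : (fun α => ch.c (ch.param (γ j) α)) =ᶠ[𝓝[paramI] α]
      fun α => nearLift p (γ j α) := by
    have h4 : ContinuousWithinAt (fun α => toCyl (γ j α)) paramI α :=
      continuous_toCyl.continuousAt.comp_continuousWithinAt (hγ.continuousOn j α hα)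
    filter_upwards [h4.eventually (ch.isOpen_nbhd.mem_nhds h), self_mem_nhdsWithin] with β h5 h6
    exact ch.c_param hγ j h6 h5
  have h4 := h1.congr_of_eventuallyEq h3.symm (ch.c_param hγ j hα h).symm
  exact (uniqueDiffOn_Icc two_pi_pos' α hα).eq_deriv _ h2 h4

/-- The orientation hypothesis enters Green's theorem here: wherever a curve moves, it moves along
the graph in the direction prescribed by `σ`. Stationary parameters satisfy the inequality
trivially. -/
theorem sign_nonneg (hγ : IsBoundaryParam Ω γ) (j : Fin J) {α : ℝ}
    (hα : α ∈ paramI) (h : toCyl (γ j α) ∈ ch.nbhd) : 0 ≤ ch.σ * ch.π (tangent (γ j) α) := by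
  by_cases h0 : ch.π (tangent (γ j) α) = 0
  · simp [h0]
  have ht := ch.tangent_eq hγ j hα h
  refine (ch.left (nearLift p (γ j α)) (ch.nearLift_mem h) (ch.c_param hγ j hα h) _ h0 ?_).le
  have h1 := hγ.left j α hα (fun h' => h0 (by simp [h']))
  filter_upwards [h1] with s hs
  rw [show ch.π (nearLift p (γ j α)) = ch.param (γ j) α from rfl, ← ht, toCyl_add, toCyl_nearLift,
    ← toCyl_add]
  exact hs

theorem pi_tangent_eq (hγ : IsBoundaryParam Ω γ) (j : Fin J) {α : ℝ}
    (hα : α ∈ paramI) (h : toCyl (γ j α) ∈ ch.nbhd) :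
    ch.π (tangent (γ j) α) = |ch.π (tangent (γ j) α)| * ch.σ := by
  have h1 := ch.sign_nonneg hγ j hα h
  rcases ch.σ_eq with h2 | h2 <;> rw [h2] at h1 ⊢
  · rw [abs_of_nonneg (by linarith)]; ring
  · rw [abs_of_nonpos (by linarith)]; ring

theorem injOn_param (hγ : IsBoundaryParam Ω γ) (j : Fin J) :
    Set.InjOn (ch.param (γ j)) (ch.params (γ j)) := by
  intro α hα β hβ hab
  apply hγ.simple j hα.1 hβ.1
  change toCyl (γ j α) = toCyl (γ j β)
  rw [← ch.toCyl_c_param hγ j (Set.Ico_subset_Icc_self hα.1) hα.2,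
    ← ch.toCyl_c_param hγ j (Set.Ico_subset_Icc_self hβ.1) hβ.2, hab]

/-- Together with `injOn_param` and `disjoint_image_params` this says that the curves jointly
traverse the graph in the chart exactly once. -/
theorem iUnion_image_params (hγ : IsBoundaryParam Ω γ) :
    ⋃ j, ch.param (γ j) '' ch.params (γ j) = ch.base := by
  ext s
  simp only [Set.mem_iUnion, Set.mem_image]
  constructor
  · rintro ⟨j, α, hα, rfl⟩
    rw [base, Set.mem_ofPred_eq, ch.c_param hγ j (Set.Ico_subset_Icc_self hα.1) hα.2]
    exact ch.nearLift_mem hα.2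
  · intro hs
    have hs' : ch.c s ∈ Metric.ball p ch.δ := hs
    have h1 : toCyl (ch.c s) ∈ frontier Ω := (ch.frontier_iff _ hs').2 (by rw [ch.π_c])
    obtain ⟨j, α, hα, h⟩ := hγ.exists_param h1
    refine ⟨j, α, ⟨hα, ⟨_, hs', h.symm⟩⟩, ?_⟩
    rw [param, nearLift_eq ch.δ_lt hs' h, ch.π_c]

theorem disjoint_image_params (hγ : IsBoundaryParam Ω γ) :
    Pairwise fun i j => Disjoint (ch.param (γ i) '' ch.params (γ i))
      (ch.param (γ j) '' ch.params (γ j)) := by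
  intro i j hij
  rw [Set.disjoint_left]
  rintro s ⟨α, hα, rfl⟩ ⟨β, hβ, h⟩
  refine hij (hγ.eq_of_toCyl_eq hα.1 hβ.1 ?_)
  rw [← ch.toCyl_c_param hγ i (Set.Ico_subset_Icc_self hα.1) hα.2,
    ← ch.toCyl_c_param hγ j (Set.Ico_subset_Icc_self hβ.1) hβ.2, h]

theorem hasDerivWithinAt_param_params (hγ : IsBoundaryParam Ω γ) (j : Fin J) :
    ∀ α ∈ ch.params (γ j), HasDerivWithinAt (ch.param (γ j)) (ch.π (tangent (γ j) α))
      (ch.params (γ j)) α := fun _ hα =>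
  (ch.hasDerivWithinAt_param hγ j (Set.Ico_subset_Icc_self hα.1) hα.2).mono
    fun _ hβ => Set.Ico_subset_Icc_self hβ.1

theorem measurableSet_image_params (hγ : IsBoundaryParam Ω γ) (j : Fin J) :
    MeasurableSet (ch.param (γ j) '' ch.params (γ j)) :=
  measurable_image_of_fderivWithin (ch.measurableSet_params hγ j)
    (fun _ hα => (ch.hasDerivWithinAt_param_params hγ j _ hα).hasFDerivWithinAt)
    (ch.injOn_param hγ j)

/-- The change of variables for an injective differentiable map does not require a nonzero
derivative, so the boundary curves may be stationary at some parameters. -/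
theorem sum_lintegral_params (hγ : IsBoundaryParam Ω γ) (f : ℝ → ENNReal) :
    ∑ j, ∫⁻ α in ch.params (γ j), ENNReal.ofReal |ch.π (tangent (γ j) α)| * f (ch.param (γ j) α) =
      ∫⁻ s in ch.base, f s := by
  rw [← ch.iUnion_image_params hγ, lintegral_iUnion (fun j => ch.measurableSet_image_params hγ j)
    (ch.disjoint_image_params hγ), tsum_fintype]
  refine Finset.sum_congr rfl fun j _ => ?_
  exact (lintegral_image_eq_lintegral_abs_deriv_mul (ch.measurableSet_params hγ j)
    (ch.hasDerivWithinAt_param_params hγ j) (ch.injOn_param hγ j) f).symm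

theorem sum_integral_params (hγ : IsBoundaryParam Ω γ) {f : ℝ → ℝ} (hf : IntegrableOn f ch.base) :
    ∑ j, ∫ α in ch.params (γ j), |ch.π (tangent (γ j) α)| * f (ch.param (γ j) α) =
      ∫ s in ch.base, f s := by
  rw [← ch.iUnion_image_params hγ] at hf ⊢
  rw [integral_iUnion_fintype (fun j => ch.measurableSet_image_params hγ j)
    (ch.disjoint_image_params hγ)]
  · refine Finset.sum_congr rfl fun j _ => ?_
    exact (integral_image_eq_integral_abs_deriv_smul (ch.measurableSet_params hγ j)
      (ch.hasDerivWithinAt_param_params hγ j) (ch.injOn_param hγ j) f).symm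
  · exact fun j => hf.mono_set (Set.subset_iUnion (fun j => ch.param (γ j) '' ch.params (γ j)) j)

/-- The boundary integral of a field supported in a chart is an integral over the graph. -/
theorem boundary_integral_eq (hγ : IsBoundaryParam Ω γ) {F₁ F₂ : Cyl → ℝ}
    (h₁ : ∀ x ∉ ch.nbhd, F₁ x = 0) (h₂ : ∀ x ∉ ch.nbhd, F₂ x = 0)
    (hi : IntegrableOn (fun s => F₁ (toCyl (ch.c s)) * (deriv ch.c s).1 +
      F₂ (toCyl (ch.c s)) * (deriv ch.c s).2) ch.base) :
    ∑ j, ∫ α in (0 : ℝ)..(2 * Real.pi), (F₁ (toCyl (γ j α)) * (tangent (γ j) α).1 +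
        F₂ (toCyl (γ j α)) * (tangent (γ j) α).2) =
      ch.σ * ∫ s in ch.base, (F₁ (toCyl (ch.c s)) * (deriv ch.c s).1 +
        F₂ (toCyl (ch.c s)) * (deriv ch.c s).2) := by
  rw [← ch.sum_integral_params hγ hi, Finset.mul_sum]
  refine Finset.sum_congr rfl fun j _ => ?_
  rw [intervalIntegral.integral_of_le two_pi_pos'.le, ← integral_Ico_eq_integral_Ioc,
    ← integral_const_mul]
  rw [setIntegral_eq_of_subset_of_forall_sdiff_eq_zero (s := ch.params (γ j)) measurableSet_Ico
    (fun α hα => hα.1)]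
  · refine setIntegral_congr_fun (ch.measurableSet_params hγ j) fun α hα => ?_
    have hα' : α ∈ paramI := Set.Ico_subset_Icc_self hα.1
    have e := ch.tangent_eq hγ j hα' hα.2
    -- The change of variables supplies the absolute speed; the orientation makes the signed speed
    -- equal to `σ` times it.
    rw [ch.pi_tangent_eq hγ j hα' hα.2] at e
    have e1 := congrArg Prod.fst e
    have e2 := congrArg Prod.snd e
    simp only [Prod.smul_fst, Prod.smul_snd, smul_eq_mul] at e1 e2
    rw [ch.toCyl_c_param hγ j hα' hα.2]
    conv_lhs => rw [e1, e2]
    ring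
  · intro α hα
    have h : toCyl (γ j α) ∉ ch.nbhd := fun h => hα.2 ⟨hα.1, h⟩
    simp [h₁ _ h, h₂ _ h]

end GraphChart

/-! ### Cutoff functions on the strip -/

theorem rho_toCyl_sq (y : ℝ × ℝ) :
    rho (toCyl y) ^ 2 = Real.sin (Real.pi * y.1) ^ 2 + Real.sinh (Real.pi * y.2) ^ 2 := by
  rw [rho_toCyl, Real.sq_sqrt (by positivity)]

theorem two_mul_abs_le_abs_sin {t : ℝ} (ht : |t| ≤ 1 / 2) : 2 * |t| ≤ |Real.sin (Real.pi * t)| := by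
  have hπ := Real.pi_pos
  have h := Real.mul_abs_le_abs_sin (x := Real.pi * t) (by
    rw [abs_mul, abs_of_pos hπ]; nlinarith)
  rw [abs_mul, abs_of_pos hπ] at h
  calc 2 * |t| = 2 / Real.pi * (Real.pi * |t|) := by field_simp
    _ ≤ _ := h

theorem abs_le_abs_sinh (t : ℝ) : |t| ≤ |Real.sinh (Real.pi * t)| := by
  have hπ := Real.pi_gt_three
  have h1 : |t| ≤ Real.sinh |t| := Real.self_le_sinh_iff.2 (abs_nonneg t)
  rw [Real.abs_sinh, abs_mul, abs_of_pos Real.pi_pos]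
  refine h1.trans (Real.sinh_le_sinh.2 ?_)
  nlinarith [abs_nonneg t]

/-- In the fundamental domain |sin πt| ≥ 2|t|, and |sinh πt| ≥ |t| always. Hence small `rho` means
proximity in the strip, which lets `rho` serve both for cutoffs and for bounds on the kernel. -/
theorem sq_norm_le_rho_sq {y : ℝ × ℝ} (hy : |y.1| ≤ 1 / 2) : ‖y‖ ^ 2 ≤ rho (toCyl y) ^ 2 := by
  rw [rho_toCyl_sq]
  have h1 := two_mul_abs_le_abs_sin hy
  have h2 := abs_le_abs_sinh y.2
  have h3 : y.1 ^ 2 ≤ Real.sin (Real.pi * y.1) ^ 2 := sq_le_sq.2 (by linarith [abs_nonneg y.1])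
  have h4 : y.2 ^ 2 ≤ Real.sinh (Real.pi * y.2) ^ 2 := sq_le_sq.2 h2
  rw [Prod.norm_def, Real.norm_eq_abs, Real.norm_eq_abs]
  rcases le_total |y.1| |y.2| with h | h
  · rw [max_eq_right h, sq_abs]; nlinarith [sq_nonneg (Real.sin (Real.pi * y.1))]
  · rw [max_eq_left h, sq_abs]; nlinarith [sq_nonneg (Real.sinh (Real.pi * y.2))]

/-- A smooth function on the strip that is one near `toCyl p` and vanishes away from it. -/
def cutoff (p : ℝ × ℝ) (r : ℝ) (x : Cyl) : ℝ :=
  Real.smoothTransition (2 - rho (x - toCyl p) ^ 2 / r ^ 2)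

/-- The square is smooth at the origin and periodic, unlike `rho` itself in the first respect, so
`cutoff` is built from it. -/
theorem contDiff_rho_sq : ContDiff ℝ ∞ fun y => rho (toCyl y) ^ 2 := by
  simp only [rho_toCyl_sq]
  have h1 : ContDiff ℝ ∞ fun y : ℝ × ℝ => Real.sin (Real.pi * y.1) :=
    Real.contDiff_sin.comp (contDiff_const.mul contDiff_fst)
  have h2 : ContDiff ℝ ∞ fun y : ℝ × ℝ => Real.sinh (Real.pi * y.2) :=
    Real.contDiff_sinh.comp (contDiff_const.mul contDiff_snd)
  exact (h1.pow 2).add (h2.pow 2)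

theorem continuous_rho : Continuous rho := by
  apply continuous_of_comp_toCyl
  have : rho ∘ toCyl = fun y : ℝ × ℝ =>
      Real.sqrt (Real.sin (Real.pi * y.1) ^ 2 + Real.sinh (Real.pi * y.2) ^ 2) := by
    ext y; exact rho_toCyl y
  rw [this]
  fun_prop

theorem contDiff_cutoff (p : ℝ × ℝ) (r : ℝ) : ContDiff ℝ 1 (cutoff p r ∘ toCyl) := by
  have : cutoff p r ∘ toCyl = fun y =>
      Real.smoothTransition (2 - rho (toCyl (y - p)) ^ 2 / r ^ 2) := by
    ext y; simp [cutoff, toCyl_sub]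
  rw [this]
  have h := (contDiff_rho_sq.of_le (show (1 : WithTop ℕ∞) ≤ ∞ by simp)).comp
    ((contDiff_id.sub contDiff_const : ContDiff ℝ 1 fun y : ℝ × ℝ => y - p))
  exact Real.smoothTransition.contDiff.comp (contDiff_const.sub (h.div_const _))

theorem cutoff_eventually_eq_one (p : ℝ × ℝ) {r : ℝ} (hr : 0 < r) :
    ∀ᶠ x in 𝓝 (toCyl p), cutoff p r x = 1 := by
  have hc : Continuous fun x => rho (x - toCyl p) ^ 2 := by
    have := continuous_rho; fun_prop
  have h0 : rho (toCyl p - toCyl p) ^ 2 < r ^ 2 := by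
    rw [sub_self, ← toCyl_zero, rho_toCyl_sq]; simpa using by positivity
  filter_upwards [hc.continuousAt.eventually_lt continuousAt_const h0] with x hx
  apply Real.smoothTransition.one_of_one_le
  have : rho (x - toCyl p) ^ 2 / r ^ 2 ≤ 1 := (div_le_one (by positivity)).2 hx.le
  linarith

theorem cutoff_eq_zero (p : ℝ × ℝ) {r : ℝ} (hr : 0 < r) {x : Cyl}
    (hx : x ∉ toCyl '' Metric.closedBall p (2 * r)) : cutoff p r x = 0 := by
  obtain ⟨y, rfl, h1, h2⟩ := exists_toCyl_eq x (p.1 - 1 / 2)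
  have hy : ¬ ‖y - p‖ ≤ 2 * r := fun h => hx ⟨y, by simpa [dist_eq_norm] using h, rfl⟩
  have h3 := sq_norm_le_rho_sq (y := y - p) (by
    rw [Prod.fst_sub, abs_le]; constructor <;> linarith)
  apply Real.smoothTransition.zero_of_nonpos
  rw [← toCyl_sub]
  have h4 : 2 ≤ rho (toCyl (y - p)) ^ 2 / r ^ 2 := by
    rw [le_div_iff₀ (by positivity)]
    nlinarith [norm_nonneg (y - p)]
  linarith

/-! ### Localizing a function on the strip to the plane -/

/-- A function on the strip restricted to a small disc and carried over to the plane. -/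
def localize (p : ℝ × ℝ) (δ : ℝ) (G : Cyl → ℝ) : ℝ × ℝ → ℝ :=
  (Metric.ball p δ).indicator (G ∘ toCyl)

section localize

variable {p : ℝ × ℝ} {δ δ' : ℝ} {G : Cyl → ℝ}

theorem mem_closedBall_of_mem_image (hδ : δ' < 1 / 2) {y : ℝ × ℝ} (hy : |y.1 - p.1| ≤ 1 / 2)
    (h : toCyl y ∈ toCyl '' Metric.closedBall p δ') : y ∈ Metric.closedBall p δ' := by
  obtain ⟨z, hz, h⟩ := h
  obtain ⟨n, rfl⟩ := toCyl_eq_iff.1 h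
  have h1 : |z.1 - p.1| < 1 / 2 :=
    ((norm_fst_le (z - p)).trans (mem_closedBall_iff_norm.1 hz)).trans_lt hδ
  have h2 : |(n : ℝ)| < 1 := by
    simp only [Prod.fst_add] at hy
    rw [abs_lt] at h1 ⊢
    rw [abs_le] at hy
    constructor <;> linarith [h1.1, h1.2, hy.1, hy.2]
  have h3 : n = 0 := by
    rw [← Int.abs_lt_one_iff]; exact_mod_cast h2
  simpa [h3, Prod.mk_zero_zero] using hz

theorem localize_eq_zero (hδ : δ < 1 / 2) (hδ' : δ' < 1 / 2)
    (hG : ∀ x ∉ toCyl '' Metric.closedBall p δ', G x = 0)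
    {y : ℝ × ℝ} (hy : y ∉ Metric.closedBall p δ') : localize p δ G y = 0 := by
  rw [localize, Set.indicator_apply_eq_zero]
  intro h
  refine hG _ fun h' => hy (mem_closedBall_of_mem_image hδ' ?_ h')
  exact ((norm_fst_le (y - p)).trans_lt ((mem_ball_iff_norm.1 h).trans hδ)).le

theorem localize_eventuallyEq {y : ℝ × ℝ} (hy : y ∈ Metric.ball p δ) :
    localize p δ G =ᶠ[𝓝 y] G ∘ toCyl := by
  filter_upwards [Metric.isOpen_ball.mem_nhds hy] with z hz
  exact Set.indicator_of_mem hz _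

theorem localize_eventuallyEq_zero (hδ : δ < 1 / 2) (hδ' : δ' < 1 / 2)
    (hG : ∀ x ∉ toCyl '' Metric.closedBall p δ', G x = 0)
    {y : ℝ × ℝ} (hy : y ∉ Metric.closedBall p δ') : localize p δ G =ᶠ[𝓝 y] 0 := by
  filter_upwards [Metric.isClosed_closedBall.isOpen_compl.mem_nhds hy] with z hz
  exact localize_eq_zero hδ hδ' hG hz

/-- The indicator creates no singularity on the sphere of radius `δ`, because the function already
vanishes beyond radius `δ'`. -/
theorem contDiff_localize {n : WithTop ℕ∞} (hδ : δ < 1 / 2) (hδδ : δ' < δ)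
    (hG : ContDiff ℝ n (G ∘ toCyl))
    (hG0 : ∀ x ∉ toCyl '' Metric.closedBall p δ', G x = 0) : ContDiff ℝ n (localize p δ G) := by
  rw [contDiff_iff_contDiffAt]
  intro y
  by_cases hy : y ∈ Metric.ball p δ
  · exact hG.contDiffAt.congr_of_eventuallyEq (localize_eventuallyEq hy)
  · exact (contDiffAt_const (c := (0 : ℝ))).congr_of_eventuallyEq
      (localize_eventuallyEq_zero hδ (hδδ.trans hδ) hG0
        fun h => hy (Metric.closedBall_subset_ball hδδ h))

theorem tsupport_localize_subset (hδ : δ < 1 / 2) (hδδ : δ' < δ)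
    (hG0 : ∀ x ∉ toCyl '' Metric.closedBall p δ', G x = 0) :
    tsupport (localize p δ G) ⊆ Metric.closedBall p δ' :=
  closure_minimal (fun y hy => by
    by_contra h
    exact hy (localize_eq_zero hδ (hδδ.trans hδ) hG0 h)) Metric.isClosed_closedBall

theorem hasCompactSupport_localize (hδ : δ < 1 / 2) (hδδ : δ' < δ)
    (hG0 : ∀ x ∉ toCyl '' Metric.closedBall p δ', G x = 0) :
    HasCompactSupport (localize p δ G) :=
  (isCompact_closedBall p δ').of_isClosed_subset (isClosed_tsupport _)
    (tsupport_localize_subset hδ hδδ hG0)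

theorem isClosed_image_closedBall (p : ℝ × ℝ) (r : ℝ) :
    IsClosed (toCyl '' Metric.closedBall p r) :=
  ((isCompact_closedBall p r).image continuous_toCyl).isClosed

theorem fderiv_localize (hδ : δ < 1 / 2) (hδδ : δ' < δ)
    (hG0 : ∀ x ∉ toCyl '' Metric.closedBall p δ', G x = 0) (hG : ContDiff ℝ 1 (G ∘ toCyl))
    {y : ℝ × ℝ} (hy : y ∈ slab (p.1 - 1 / 2)) :
    fderiv ℝ (localize p δ G) y (1, 0) = partial₁ G (toCyl y) ∧
      fderiv ℝ (localize p δ G) y (0, 1) = partial₂ G (toCyl y) := by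
  by_cases h : toCyl y ∈ toCyl '' Metric.closedBall p δ'
  · have h1 := mem_closedBall_of_mem_image (hδδ.trans hδ) (by
      rw [abs_le]; constructor <;> linarith [hy.1.1, hy.1.2]) h
    have h2 := localize_eventuallyEq (G := G) (Metric.closedBall_subset_ball hδδ h1)
    have h3 := hG.differentiable (by simp) y
    rw [h2.fderiv_eq, partial₁_toCyl h3, partial₂_toCyl h3]
    exact ⟨rfl, rfl⟩
  · have h1 : G =ᶠ[𝓝 (toCyl y)] 0 := by
      filter_upwards [(isClosed_image_closedBall p δ').isOpen_compl.mem_nhds h] with x hx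
      exact hG0 x hx
    have h2 := localize_eventuallyEq_zero hδ (hδδ.trans hδ) hG0
      fun h' : y ∈ Metric.closedBall p δ' => h ⟨y, h', rfl⟩
    rw [partial₁_eq_zero h1, partial₂_eq_zero h1, h2.fderiv_eq]
    simp

theorem fderiv_localize_eq_zero (hδ : δ < 1 / 2) (hδδ : δ' < δ)
    (hG0 : ∀ x ∉ toCyl '' Metric.closedBall p δ', G x = 0)
    {y : ℝ × ℝ} (hy : y ∉ Metric.closedBall p δ') : fderiv ℝ (localize p δ G) y = 0 := by
  rw [(localize_eventuallyEq_zero hδ (hδδ.trans hδ) hG0 hy).fderiv_eq]; simp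

end localize

/-- The slab centred at the abscissa of `p` covers the strip once and contains the whole disc, so no
other copy of the disc contributes. -/
theorem setIntegral_curl_localize {Ω : Set Cyl} (hΩ : IsOpen Ω) {p : ℝ × ℝ} {δ δ' : ℝ}
    (hδ : δ < 1 / 2) (hδδ : δ' < δ) {G₁ G₂ : Cyl → ℝ}
    (h₁ : ContDiff ℝ 1 (G₁ ∘ toCyl)) (h₂ : ContDiff ℝ 1 (G₂ ∘ toCyl))
    (z₁ : ∀ x ∉ toCyl '' Metric.closedBall p δ', G₁ x = 0)
    (z₂ : ∀ x ∉ toCyl '' Metric.closedBall p δ', G₂ x = 0) :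
    ∫ x in Ω, (partial₁ G₂ x - partial₂ G₁ x) =
      ∫ y in toCyl ⁻¹' Ω, (fderiv ℝ (localize p δ G₂) y (1, 0) -
        fderiv ℝ (localize p δ G₁) y (0, 1)) := by
  have hm := (hΩ.preimage continuous_toCyl).measurableSet
  rw [← integral_indicator hΩ.measurableSet, integral_cyl_eq_slab (p.1 - 1 / 2),
    ← integral_indicator (measurableSet_slab _), ← integral_indicator hm]
  · congr 1 with y
    by_cases hy : y ∈ slab (p.1 - 1 / 2)
    · rw [Set.indicator_of_mem hy]
      by_cases hm' : toCyl y ∈ Ω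
      · rw [Set.indicator_of_mem hm', Set.indicator_of_mem (Set.mem_preimage.2 hm'),
          (fderiv_localize hδ hδδ z₁ h₁ hy).2, (fderiv_localize hδ hδδ z₂ h₂ hy).1]
      · rw [Set.indicator_of_notMem hm', Set.indicator_of_notMem (by exact hm')]
    · rw [Set.indicator_of_notMem hy]
      have : y ∉ Metric.closedBall p δ' := fun h => hy ⟨by
        have := (norm_fst_le (y - p)).trans (mem_closedBall_iff_norm.1 h)
        rw [Prod.fst_sub, Real.norm_eq_abs, abs_le] at this
        constructor <;> linarith [this.1, this.2], trivial⟩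
      refine (Set.indicator_apply_eq_zero.2 fun _ => ?_).symm
      simp [fderiv_localize_eq_zero hδ hδδ z₁ this, fderiv_localize_eq_zero hδ hδδ z₂ this]
  · exact ((continuous_partial₁ h₂).sub (continuous_partial₂ h₁)).aestronglyMeasurable.indicator
      hΩ.measurableSet

/-! ### Green's theorem -/

/-- The difference of the two sides in Green's theorem. -/
def greenDefect (Ω : Set Cyl) {J : ℕ} (γ : Fin J → ℝ → ℝ × ℝ) (F₁ F₂ : Cyl → ℝ) : ℝ :=
  ∑ j, (∫ α in (0 : ℝ)..(2 * Real.pi), (F₁ (toCyl (γ j α)) * (tangent (γ j) α).1 +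
    F₂ (toCyl (γ j α)) * (tangent (γ j) α).2)) - ∫ x in Ω, (partial₁ F₂ x - partial₂ F₁ x)

section green

variable {Ω : Set Cyl} {J : ℕ} {γ : Fin J → ℝ → ℝ × ℝ}

theorem IsBoundaryParam.intervalIntegrable (hγ : IsBoundaryParam Ω γ) (j : Fin J)
    {F₁ F₂ : Cyl → ℝ} (h₁ : Continuous F₁) (h₂ : Continuous F₂) :
    IntervalIntegrable (fun α => F₁ (toCyl (γ j α)) * (tangent (γ j) α).1 +
      F₂ (toCyl (γ j α)) * (tangent (γ j) α).2) volume 0 (2 * Real.pi) := by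
  apply ContinuousOn.intervalIntegrable
  rw [Set.uIcc_of_le two_pi_pos'.le]
  have hc := hγ.continuousOn j
  have ht := hγ.continuousOn_tangent j
  exact (((h₁.comp continuous_toCyl).comp_continuousOn hc).mul
    (continuous_fst.comp_continuousOn ht)).add
    (((h₂.comp continuous_toCyl).comp_continuousOn hc).mul (continuous_snd.comp_continuousOn ht))

theorem isCompact_closure_of_isBounded (hb : Bornology.IsBounded Ω) : IsCompact (closure Ω) :=
  hb.isCompact_closure

theorem integrableOn_of_isBounded (hb : Bornology.IsBounded Ω) {f : Cyl → ℝ} (hf : Continuous f) :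
    IntegrableOn f Ω :=
  (hf.continuousOn.integrableOn_compact (isCompact_closure_of_isBounded hb)).mono_set
    subset_closure

theorem greenDefect_add (hb : Bornology.IsBounded Ω) (hγ : IsBoundaryParam Ω γ)
    {F₁ F₂ G₁ G₂ : Cyl → ℝ}
    (f₁ : ContDiff ℝ 1 (F₁ ∘ toCyl)) (f₂ : ContDiff ℝ 1 (F₂ ∘ toCyl))
    (g₁ : ContDiff ℝ 1 (G₁ ∘ toCyl)) (g₂ : ContDiff ℝ 1 (G₂ ∘ toCyl)) :
    greenDefect Ω γ (fun x => F₁ x + G₁ x) (fun x => F₂ x + G₂ x) =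
      greenDefect Ω γ F₁ F₂ + greenDefect Ω γ G₁ G₂ := by
  have a₁ : ∀ x, partial₁ (fun x => F₂ x + G₂ x) x = partial₁ F₂ x + partial₁ G₂ x := by
    intro x
    obtain ⟨y, rfl⟩ := toCyl_surjective x
    have hf := f₂.differentiable (by simp) y
    have hg := g₂.differentiable (by simp) y
    rw [partial₁_toCyl hf, partial₁_toCyl hg, partial₁_toCyl (by exact hf.add hg)]
    rw [show ((fun x => F₂ x + G₂ x) ∘ toCyl) = F₂ ∘ toCyl + G₂ ∘ toCyl from rfl, fderiv_add hf hg]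
    rfl
  have a₂ : ∀ x, partial₂ (fun x => F₁ x + G₁ x) x = partial₂ F₁ x + partial₂ G₁ x := by
    intro x
    obtain ⟨y, rfl⟩ := toCyl_surjective x
    have hf := f₁.differentiable (by simp) y
    have hg := g₁.differentiable (by simp) y
    rw [partial₂_toCyl hf, partial₂_toCyl hg, partial₂_toCyl (by exact hf.add hg)]
    rw [show ((fun x => F₁ x + G₁ x) ∘ toCyl) = F₁ ∘ toCyl + G₁ ∘ toCyl from rfl, fderiv_add hf hg]
    rfl
  have i₁ := integrableOn_of_isBounded hb ((continuous_partial₁ f₂).sub (continuous_partial₂ f₁))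
  have i₂ := integrableOn_of_isBounded hb ((continuous_partial₁ g₂).sub (continuous_partial₂ g₁))
  have b₁ : ∫ x in Ω, (partial₁ (fun x => F₂ x + G₂ x) x - partial₂ (fun x => F₁ x + G₁ x) x) =
      (∫ x in Ω, (partial₁ F₂ x - partial₂ F₁ x)) +
        ∫ x in Ω, (partial₁ G₂ x - partial₂ G₁ x) := by
    refine Eq.trans ?_ (integral_add i₁ i₂)
    congr 1 with x
    rw [a₁, a₂]; ring
  rw [greenDefect, greenDefect, greenDefect, b₁, sub_add_sub_comm, ← Finset.sum_add_distrib]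
  congr 1
  refine Finset.sum_congr rfl fun j _ => ?_
  rw [← intervalIntegral.integral_add
    (hγ.intervalIntegrable j (continuous_of_contDiff_comp f₁) (continuous_of_contDiff_comp f₂))
    (hγ.intervalIntegrable j (continuous_of_contDiff_comp g₁) (continuous_of_contDiff_comp g₂))]
  congr 1 with α
  ring

theorem greenDefect_eq_zero_of_eventuallyEq (hγ : IsBoundaryParam Ω γ) (hΩ : IsOpen Ω)
    {F₁ F₂ : Cyl → ℝ}
    (h₁ : ∀ x ∈ closure Ω, F₁ =ᶠ[𝓝 x] 0) (h₂ : ∀ x ∈ closure Ω, F₂ =ᶠ[𝓝 x] 0) :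
    greenDefect Ω γ F₁ F₂ = 0 := by
  rw [greenDefect, Finset.sum_eq_zero, setIntegral_congr_fun (g := fun _ => (0 : ℝ))
    hΩ.measurableSet, integral_zero, sub_zero]
  · intro x hx
    have hx' := subset_closure hx
    simp [partial₁_eq_zero (h₂ x hx'), partial₂_eq_zero (h₁ x hx')]
  · intro j _
    rw [intervalIntegral.integral_congr (g := fun _ => (0 : ℝ)), intervalIntegral.integral_zero]
    intro α hα
    rw [Set.uIcc_of_le two_pi_pos'.le] at hα
    have hx := frontier_subset_closure (hγ.mem_frontier j hα)
    simp [(h₁ _ hx).self_of_nhds, (h₂ _ hx).self_of_nhds]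

/-- The field vanishes on the boundary, and the integral of the curl of a compactly supported field
is zero. The latter is read off from `integral_subgraph_curl` for a horizontal line above the
support. -/
theorem greenDefect_eq_zero_of_support_interior (hγ : IsBoundaryParam Ω γ) (hΩ : IsOpen Ω)
    {p : ℝ × ℝ} {δ δ' : ℝ} (hδ : δ < 1 / 2) (hδδ : δ' < δ) (hsub : toCyl '' Metric.ball p δ ⊆ Ω)
    {G₁ G₂ : Cyl → ℝ} (h₁ : ContDiff ℝ 1 (G₁ ∘ toCyl)) (h₂ : ContDiff ℝ 1 (G₂ ∘ toCyl))
    (z₁ : ∀ x ∉ toCyl '' Metric.closedBall p δ', G₁ x = 0)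
    (z₂ : ∀ x ∉ toCyl '' Metric.closedBall p δ', G₂ x = 0) : greenDefect Ω γ G₁ G₂ = 0 := by
  have hcb : Metric.closedBall p δ' ⊆ Metric.ball p δ := Metric.closedBall_subset_ball hδδ
  have hin : ∀ x ∈ frontier Ω, x ∉ toCyl '' Metric.closedBall p δ' := fun x hx h =>
    hx.2 (by rw [hΩ.interior_eq]; exact hsub (Set.image_mono hcb h))
  rw [greenDefect, Finset.sum_eq_zero, zero_sub, neg_eq_zero,
    setIntegral_curl_localize hΩ hδ hδδ h₁ h₂ z₁ z₂]
  · have key := integral_subgraph_curl (g := fun _ => p.2 + 1) contDiff_const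
      (contDiff_localize hδ hδδ h₁ z₁) (contDiff_localize hδ hδδ h₂ z₂)
      (hasCompactSupport_localize hδ hδδ z₁) (hasCompactSupport_localize hδ hδδ z₂)
    have hout : ∀ s : ℝ, (s, p.2 + 1) ∉ Metric.closedBall p δ' := fun s h => by
      have := (norm_snd_le ((s, p.2 + 1) - p)).trans (mem_closedBall_iff_norm.1 h)
      simp at this
      linarith
    simp only [localize_eq_zero hδ (hδδ.trans hδ) z₁ (hout _),
      localize_eq_zero hδ (hδδ.trans hδ) z₂ (hout _)] at key
    simp only [zero_mul, add_zero, integral_zero, neg_zero] at key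
    refine Eq.trans ?_ key
    rw [← integral_indicator (hΩ.preimage continuous_toCyl).measurableSet,
      ← integral_indicator (isOpen_lt continuous_snd continuous_const).measurableSet]
    congr 1 with y
    by_cases hy : y ∈ Metric.closedBall p δ'
    · have := (norm_snd_le (y - p)).trans (mem_closedBall_iff_norm.1 hy)
      rw [Prod.snd_sub, Real.norm_eq_abs, abs_le] at this
      have hy2 : y ∈ {y : ℝ × ℝ | y.2 < p.2 + 1} := by
        change y.2 < p.2 + 1
        linarith [this.2]
      have hy1 : y ∈ toCyl ⁻¹' Ω := hsub ⟨y, hcb hy, rfl⟩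
      rw [Set.indicator_of_mem hy1, Set.indicator_of_mem hy2]
    · simp [Set.indicator_apply, fderiv_localize_eq_zero hδ hδδ z₁ hy,
        fderiv_localize_eq_zero hδ hδδ z₂ hy]
  · intro j _
    rw [intervalIntegral.integral_congr (g := fun _ => (0 : ℝ)), intervalIntegral.integral_zero]
    intro α hα
    rw [Set.uIcc_of_le two_pi_pos'.le] at hα
    have hx := hin _ (hγ.mem_frontier j hα)
    simp [z₁ _ hx, z₂ _ hx]

theorem GraphChart.isBounded_base {p : ℝ × ℝ} (ch : GraphChart Ω p) :
    Bornology.IsBounded ch.base := by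
  refine (ch.π.lipschitz.isBounded_image (Metric.isBounded_ball (x := p) (r := ch.δ))).subset ?_
  exact fun s hs => ⟨ch.c s, hs, ch.π_c s⟩

theorem GraphChart.greenDefect_eq_zero {p : ℝ × ℝ} (ch : GraphChart Ω p)
    (hγ : IsBoundaryParam Ω γ) (hΩ : IsOpen Ω) {δ' : ℝ} (hδδ : δ' < ch.δ)
    {G₁ G₂ : Cyl → ℝ} (h₁ : ContDiff ℝ 1 (G₁ ∘ toCyl)) (h₂ : ContDiff ℝ 1 (G₂ ∘ toCyl))
    (z₁ : ∀ x ∉ toCyl '' Metric.closedBall p δ', G₁ x = 0)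
    (z₂ : ∀ x ∉ toCyl '' Metric.closedBall p δ', G₂ x = 0) : greenDefect Ω γ G₁ G₂ = 0 := by
  have hcb : Metric.closedBall p δ' ⊆ Metric.ball p ch.δ := Metric.closedBall_subset_ball hδδ
  have out : ∀ x ∉ ch.nbhd, x ∉ toCyl '' Metric.closedBall p δ' := fun x hx h =>
    hx (Set.image_mono hcb h)
  have l₁ := contDiff_localize ch.δ_lt hδδ h₁ z₁
  have l₂ := contDiff_localize ch.δ_lt hδδ h₂ z₂
  have e : ∀ {G : Cyl → ℝ} {s : ℝ}, s ∈ ch.base → G (toCyl (ch.c s)) =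
      localize p ch.δ G (ch.c s) := fun {G s} hs =>
    (Set.indicator_of_mem (show ch.c s ∈ Metric.ball p ch.δ from hs) (G ∘ toCyl)).symm
  have cd := ch.contDiff.continuous_deriv (by simp)
  have cc := ch.contDiff.continuous
  have hcont : Continuous fun s => localize p ch.δ G₁ (ch.c s) * (deriv ch.c s).1 +
      localize p ch.δ G₂ (ch.c s) * (deriv ch.c s).2 :=
    ((l₁.continuous.comp cc).mul (continuous_fst.comp cd)).add
      ((l₂.continuous.comp cc).mul (continuous_snd.comp cd))
  have hi : IntegrableOn (fun s => localize p ch.δ G₁ (ch.c s) * (deriv ch.c s).1 +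
      localize p ch.δ G₂ (ch.c s) * (deriv ch.c s).2) ch.base :=
    (hcont.continuousOn.integrableOn_compact ch.isBounded_base.isCompact_closure).mono_set
      subset_closure
  have hi' : IntegrableOn (fun s => G₁ (toCyl (ch.c s)) * (deriv ch.c s).1 +
      G₂ (toCyl (ch.c s)) * (deriv ch.c s).2) ch.base :=
    hi.congr_fun (fun s hs => by simp only [e hs]) ch.measurableSet_base
  rw [greenDefect, ch.boundary_integral_eq hγ (fun x hx => z₁ x (out x hx))
    (fun x hx => z₂ x (out x hx)) hi', setIntegral_curl_localize hΩ ch.δ_lt hδδ h₁ h₂ z₁ z₂,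
    ch.green _ _ l₁ l₂ (hasCompactSupport_localize ch.δ_lt hδδ z₁)
      (hasCompactSupport_localize ch.δ_lt hδδ z₂)
      ((tsupport_localize_subset ch.δ_lt hδδ z₁).trans hcb)
      ((tsupport_localize_subset ch.δ_lt hδδ z₂).trans hcb), sub_eq_zero]
  congr 1
  rw [setIntegral_congr_fun ch.measurableSet_base
    (fun s hs => by rw [e (G := G₁) hs, e (G := G₂) hs])]
  refine setIntegral_eq_integral_of_forall_compl_eq_zero fun s hs => ?_
  have : ch.c s ∉ Metric.closedBall p δ' := fun h => hs (hcb h)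
  rw [localize_eq_zero ch.δ_lt (hδδ.trans ch.δ_lt) z₁ this,
    localize_eq_zero ch.δ_lt (hδδ.trans ch.δ_lt) z₂ this]
  simp

theorem exists_local_cutoff {ε : ℝ≥0} (hΩ : IsC1HolderRegion ε Ω) (hγ : IsBoundaryParam Ω γ)
    {x : Cyl} (hx : x ∈ closure Ω) :
    ∃ χ : Cyl → ℝ, ContDiff ℝ 1 (χ ∘ toCyl) ∧ (∀ᶠ z in 𝓝 x, χ z = 1) ∧
      ∀ F₁ F₂ : Cyl → ℝ, ContDiff ℝ 1 (F₁ ∘ toCyl) → ContDiff ℝ 1 (F₂ ∘ toCyl) →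
        greenDefect Ω γ (fun z => χ z * F₁ z) (fun z => χ z * F₂ z) = 0 := by
  obtain ⟨p, rfl⟩ := toCyl_surjective x
  by_cases hp : toCyl p ∈ Ω
  · obtain ⟨δ₀, hδ₀, hb⟩ := Metric.isOpen_iff.1 (hΩ.isOpen.preimage continuous_toCyl) p hp
    have hpos : 0 < min δ₀ (1 / 4) := by positivity
    set δ := min δ₀ (1 / 4)
    have hδ : δ < 1 / 2 := (min_le_right _ _).trans_lt (by norm_num)
    have hr : 0 < δ / 4 := by positivity
    refine ⟨cutoff p (δ / 4), contDiff_cutoff _ _, cutoff_eventually_eq_one _ hr,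
      fun F₁ F₂ h₁ h₂ => ?_⟩
    refine greenDefect_eq_zero_of_support_interior hγ hΩ.isOpen hδ
      (show 2 * (δ / 4) < δ by linarith) ?_ ((contDiff_cutoff _ _).mul h₁)
      ((contDiff_cutoff _ _).mul h₂) (fun x hx => by rw [cutoff_eq_zero p hr hx, zero_mul])
      (fun x hx => by rw [cutoff_eq_zero p hr hx, zero_mul])
    exact Set.image_subset_iff.2 ((Metric.ball_subset_ball (min_le_left _ _)).trans hb)
  · have hf : toCyl p ∈ frontier Ω := ⟨hx, by rwa [hΩ.isOpen.interior_eq]⟩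
    obtain ⟨ch⟩ := hΩ.nonempty_graphChart hf
    have hr : 0 < ch.δ / 4 := by linarith [ch.δ_pos]
    refine ⟨cutoff p (ch.δ / 4), contDiff_cutoff _ _, cutoff_eventually_eq_one _ hr,
      fun F₁ F₂ h₁ h₂ => ?_⟩
    exact ch.greenDefect_eq_zero hγ hΩ.isOpen
      (show 2 * (ch.δ / 4) < ch.δ by linarith) ((contDiff_cutoff _ _).mul h₁)
      ((contDiff_cutoff _ _).mul h₂) (fun x hx => by rw [cutoff_eq_zero p hr hx, zero_mul])
      (fun x hx => by rw [cutoff_eq_zero p hr hx, zero_mul])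

/-- Induction on compact sets replaces a partition of unity. From `χ` and `ψ` the function χ + ψ(1 −
χ) is formed, which is one wherever either is. Its defect is that of χF plus that of ψ(1 − χ)F, and
both vanish because the property is demanded for all C¹ fields. -/
theorem exists_global_cutoff {ε : ℝ≥0} (hΩ : IsC1HolderRegion ε Ω) (hγ : IsBoundaryParam Ω γ) :
    ∃ χ : Cyl → ℝ, ContDiff ℝ 1 (χ ∘ toCyl) ∧ (∀ x ∈ closure Ω, ∀ᶠ z in 𝓝 x, χ z = 1) ∧
      ∀ F₁ F₂ : Cyl → ℝ, ContDiff ℝ 1 (F₁ ∘ toCyl) → ContDiff ℝ 1 (F₂ ∘ toCyl) →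
        greenDefect Ω γ (fun z => χ z * F₁ z) (fun z => χ z * F₂ z) = 0 := by
  refine (isCompact_closure_of_isBounded hΩ.isBounded).induction_on
    (p := fun S => ∃ χ : Cyl → ℝ, ContDiff ℝ 1 (χ ∘ toCyl) ∧
      (∀ x ∈ S, ∀ᶠ z in 𝓝 x, χ z = 1) ∧
      ∀ F₁ F₂ : Cyl → ℝ, ContDiff ℝ 1 (F₁ ∘ toCyl) → ContDiff ℝ 1 (F₂ ∘ toCyl) →
        greenDefect Ω γ (fun z => χ z * F₁ z) (fun z => χ z * F₂ z) = 0) ?_ ?_ ?_ ?_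
  · refine ⟨fun _ => 0, contDiff_const, by simp, fun F₁ F₂ _ _ => ?_⟩
    exact greenDefect_eq_zero_of_eventuallyEq hγ hΩ.isOpen
      (fun x _ => .of_forall fun z => by simp) (fun x _ => .of_forall fun z => by simp)
  · rintro s t hst ⟨χ, h1, h2, h3⟩
    exact ⟨χ, h1, fun x hx => h2 x (hst hx), h3⟩
  · rintro s t ⟨χ, h1, h2, h3⟩ ⟨ψ, k1, k2, k3⟩
    refine ⟨fun z => χ z + ψ z * (1 - χ z), h1.add (k1.mul (contDiff_const.sub h1)), ?_, ?_⟩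
    · rintro x (hx | hx)
      · filter_upwards [h2 x hx] with z hz
        rw [hz]; ring
      · filter_upwards [k2 x hx] with z hz
        rw [hz]; ring
    · intro F₁ F₂ f₁ f₂
      have g₁ : ContDiff ℝ 1 ((fun z => (1 - χ z) * F₁ z) ∘ toCyl) := (contDiff_const.sub h1).mul f₁
      have g₂ : ContDiff ℝ 1 ((fun z => (1 - χ z) * F₂ z) ∘ toCyl) := (contDiff_const.sub h1).mul f₂
      have := greenDefect_add (Ω := Ω) hΩ.isBounded hγ
        (F₁ := fun z => χ z * F₁ z) (F₂ := fun z => χ z * F₂ z)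
        (G₁ := fun z => ψ z * ((1 - χ z) * F₁ z)) (G₂ := fun z => ψ z * ((1 - χ z) * F₂ z))
        (h1.mul f₁) (h1.mul f₂) (k1.mul g₁) (k1.mul g₂)
      rw [h3 F₁ F₂ f₁ f₂, k3 _ _ g₁ g₂, add_zero] at this
      rw [← this]
      congr 1 <;> (ext z; ring)
  · intro x hx
    obtain ⟨χ, h1, h2, h3⟩ := exists_local_cutoff hΩ hγ hx
    exact ⟨{x | ∀ᶠ z in 𝓝 x, χ z = 1}, mem_nhdsWithin_of_mem_nhds h2.eventually_nhds,
      χ, h1, fun x hx => hx, h3⟩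

/-- Green's theorem for a region with `C¹` boundary, parametrized by injective `C¹` curves. -/
theorem green_theorem {ε : ℝ≥0} (hΩ : IsC1HolderRegion ε Ω) (hγ : IsBoundaryParam Ω γ)
    {F₁ F₂ : Cyl → ℝ} (f₁ : ContDiff ℝ 1 (F₁ ∘ toCyl)) (f₂ : ContDiff ℝ 1 (F₂ ∘ toCyl)) :
    ∑ j, (∫ α in (0 : ℝ)..(2 * Real.pi), (F₁ (toCyl (γ j α)) * (tangent (γ j) α).1 +
      F₂ (toCyl (γ j α)) * (tangent (γ j) α).2)) = ∫ x in Ω, (partial₁ F₂ x - partial₂ F₁ x) := by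
  obtain ⟨χ, h1, h2, h3⟩ := exists_global_cutoff hΩ hγ
  have := greenDefect_add (Ω := Ω) hΩ.isBounded hγ
    (F₁ := fun z => χ z * F₁ z) (F₂ := fun z => χ z * F₂ z)
    (G₁ := fun z => (1 - χ z) * F₁ z) (G₂ := fun z => (1 - χ z) * F₂ z)
    (h1.mul f₁) (h1.mul f₂) ((contDiff_const.sub h1).mul f₁) ((contDiff_const.sub h1).mul f₂)
  rw [h3 F₁ F₂ f₁ f₂, greenDefect_eq_zero_of_eventuallyEq (F₁ := fun z => (1 - χ z) * F₁ z)
    (F₂ := fun z => (1 - χ z) * F₂ z) hγ hΩ.isOpen (fun x hx => ?_)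
    (fun x hx => ?_), add_zero, greenDefect, sub_eq_zero] at this
  · convert this using 4 <;> ring_nf
  · filter_upwards [h2 x hx] with z hz
    simp [hz]
  · filter_upwards [h2 x hx] with z hz
    simp [hz]

end green

/-! ### Bounds and means of the logarithmic kernel -/

/-- The kernel `log ρ`. -/
def logRho (z : Cyl) : ℝ := Real.log (rho z)

theorem measurable_logRho : Measurable logRho := continuous_rho.measurable.log

theorem rho_nonneg (z : Cyl) : 0 ≤ rho z := Real.sqrt_nonneg _

theorem rho_le_exp (z : Cyl) : rho z ≤ Real.exp (Real.pi * |z.2|) := by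
  obtain ⟨y, rfl⟩ := toCyl_surjective z
  have h1 : rho (toCyl y) ≤ Real.cosh (Real.pi * y.2) := by
    refine (sq_le_sq₀ (rho_nonneg _) (Real.cosh_pos _).le).1 ?_
    rw [rho_toCyl_sq, Real.cosh_sq]
    nlinarith [Real.sin_sq_le_one (Real.pi * y.1)]
  refine h1.trans ?_
  rw [← Real.cosh_abs, abs_mul, abs_of_pos Real.pi_pos]
  change _ ≤ Real.exp (Real.pi * |y.2|)
  rw [Real.cosh_eq]
  have h2 : Real.exp (-(Real.pi * |y.2|)) ≤ Real.exp (Real.pi * |y.2|) :=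
    Real.exp_le_exp.2 (by nlinarith [Real.pi_pos, abs_nonneg y.2])
  linarith

theorem norm_le_rho (z : Cyl) : ‖z.1‖ ≤ rho z := by
  obtain ⟨y, rfl, h1, h2⟩ := exists_toCyl_eq z (-1 / 2)
  have h3 : |y.1| ≤ 1 / 2 := by rw [abs_le]; constructor <;> linarith
  have h4 : ‖((toCyl y).1 : AddCircle (1 : ℝ))‖ = |y.1| :=
    (AddCircle.norm_coe_eq_abs_iff (1 : ℝ) one_ne_zero).2 (by simpa using h3)
  rw [h4]
  refine (sq_le_sq₀ (abs_nonneg _) (rho_nonneg _)).1 (le_trans ?_ (sq_norm_le_rho_sq h3))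
  gcongr
  exact norm_fst_le y

theorem abs_le_rho (z : Cyl) : |z.2| ≤ rho z := by
  obtain ⟨y, rfl⟩ := toCyl_surjective z
  refine (sq_le_sq₀ (abs_nonneg _) (rho_nonneg _)).1 ?_
  rw [rho_toCyl_sq, sq_abs]
  have : y.2 ^ 2 ≤ Real.sinh (Real.pi * y.2) ^ 2 := sq_le_sq.2 (abs_le_abs_sinh y.2)
  change y.2 ^ 2 ≤ _
  nlinarith [sq_nonneg (Real.sin (Real.pi * y.1))]

theorem abs_log_le_of_mem {m r B : ℝ} (hm : 0 < m) (hr : m ≤ r) (hB : r ≤ Real.exp B)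
    (hB0 : 0 ≤ B) : |Real.log r| ≤ B + |Real.log m| := by
  have h1 := Real.log_le_log hm hr
  have h2 := (Real.log_le_iff_le_exp (hm.trans_le hr)).2 hB
  rw [abs_le]
  constructor
  · linarith [neg_abs_le (Real.log m)]
  · linarith [abs_nonneg (Real.log m)]

/-- Bounding ρ below by the horizontal distance suits circles and graphs over the horizontal axis;
`abs_logRho_le_snd` does the same for graphs over the vertical axis. Either way the singularity is
at most a one-dimensional logarithm. -/
theorem abs_logRho_le_fst {z : Cyl} (hz : z.1 ≠ 0) :
    |logRho z| ≤ Real.pi * |z.2| + |Real.log ‖z.1‖| :=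
  abs_log_le_of_mem (norm_pos_iff.2 hz) (norm_le_rho z) (rho_le_exp z)
    (mul_nonneg Real.pi_pos.le (abs_nonneg _))

theorem abs_logRho_le_snd {z : Cyl} (hz : z.2 ≠ 0) :
    |logRho z| ≤ Real.pi * |z.2| + |Real.log z.2| := by
  rw [← Real.log_abs z.2]
  exact abs_log_le_of_mem (abs_pos.2 hz) (abs_le_rho z) (rho_le_exp z)
    (mul_nonneg Real.pi_pos.le (abs_nonneg _))

/-- With B = π|z₂| ≥ 3, ρ lies between sinh B and exp B, and sinh B ≥ exp(B − 2). This far-field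
asymptotics is what bounds the velocity at large heights; the constant 2 is not sharp. -/
theorem abs_logRho_sub_le {z : Cyl} (hz : 1 ≤ |z.2|) : |logRho z - Real.pi * (|z.2|)| ≤ 2 := by
  have hπ := Real.pi_gt_three
  set B := Real.pi * |z.2| with hB
  have hB3 : 3 ≤ B := by nlinarith
  have h1 : Real.exp (B - 2) ≤ rho z := by
    have h2 : Real.sinh B ≤ rho z := by
      obtain ⟨y, rfl⟩ := toCyl_surjective z
      refine (sq_le_sq₀ (Real.sinh_nonneg_iff.2 (by linarith)) (rho_nonneg _)).1 ?_
      rw [rho_toCyl_sq, hB, ← abs_of_pos Real.pi_pos, ← abs_mul, ← Real.abs_sinh, sq_abs,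
        abs_of_pos Real.pi_pos]
      change Real.sinh (Real.pi * y.2) ^ 2 ≤ _
      nlinarith [sq_nonneg (Real.sin (Real.pi * y.1))]
    refine le_trans ?_ h2
    rw [Real.sinh_eq]
    -- This is e² ≥ 4, from e ≥ 1 + 1.
    have h3 : Real.exp (B - 2) * 4 ≤ Real.exp B := by
      have : Real.exp B = Real.exp (B - 2) * (Real.exp 1 * Real.exp 1) := by
        rw [← Real.exp_add, ← Real.exp_add]; congr 1; ring
      rw [this]
      have := Real.add_one_le_exp (1 : ℝ)
      gcongr
      nlinarith
    have h4 : Real.exp (-B) ≤ Real.exp (B - 2) := Real.exp_le_exp.2 (by linarith)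
    linarith [Real.exp_pos (B - 2)]
  have h5 := (Real.le_log_iff_exp_le ((Real.exp_pos _).trans_le h1)).2 h1
  have h6 := (Real.log_le_iff_le_exp ((Real.exp_pos _).trans_le h1)).2 (rho_le_exp z)
  rw [abs_le]
  constructor
  · rw [logRho]; linarith
  · rw [logRho]; linarith

/-! ### Means of the kernel over horizontal circles. -/

theorem lintegral_log_norm_lt_top :
    ∫⁻ t : AddCircle (1 : ℝ), ‖Real.log ‖t‖‖ₑ < ⊤ := by
  rw [← AddCircle.lintegral_preimage (1 : ℝ) (-1 / 2)]
  have h : IntegrableOn Real.log (Set.Ioc (-1 / 2) (-1 / 2 + 1)) :=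
    (intervalIntegrable_iff_integrableOn_Ioc_of_le (by norm_num)).1
      intervalIntegral.intervalIntegrable_log'
  refine lt_of_eq_of_lt (setLIntegral_congr_fun measurableSet_Ioc fun s hs => ?_)
    h.hasFiniteIntegral
  have h3 : |s| ≤ 1 / 2 := by rw [abs_le]; constructor <;> linarith [hs.1, hs.2]
  have h4 : ‖(s : AddCircle (1 : ℝ))‖ = |s| :=
    (AddCircle.norm_coe_eq_abs_iff (1 : ℝ) one_ne_zero).2 (by simpa using h3)
  simp only [h4, Real.log_abs]

theorem ae_circle_ne (c : AddCircle (1 : ℝ)) : ∀ᵐ t : AddCircle (1 : ℝ), t ≠ c := by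
  have h : volume ({c} : Set (AddCircle (1 : ℝ))) = 0 := by
    have := AddCircle.volume_closedBall (1 : ℝ) (x := c) 0
    simpa using this
  exact measure_eq_zero_iff_ae_notMem.1 h

/-- A bound for the integral of `|log ρ|` over horizontal circles. -/
def circleBound : ENNReal := ∫⁻ t : AddCircle (1 : ℝ), ‖Real.log ‖t‖‖ₑ

theorem lintegral_circle_logRho_le (c : AddCircle (1 : ℝ)) (h : ℝ) :
    ∫⁻ t : AddCircle (1 : ℝ), ‖logRho (t - c, h)‖ₑ ≤
      ENNReal.ofReal (Real.pi * |h|) + circleBound := by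
  have e : ∫⁻ t : AddCircle (1 : ℝ), ‖logRho (t - c, h)‖ₑ =
      ∫⁻ t : AddCircle (1 : ℝ), ‖logRho (t, h)‖ₑ :=
    lintegral_sub_right_eq_self (fun t => ‖logRho (t, h)‖ₑ) c
  rw [e]
  calc ∫⁻ t : AddCircle (1 : ℝ), ‖logRho (t, h)‖ₑ
      ≤ ∫⁻ t : AddCircle (1 : ℝ), (ENNReal.ofReal (Real.pi * |h|) + ‖Real.log ‖t‖‖ₑ) := by
        refine lintegral_mono_ae ?_
        filter_upwards [ae_circle_ne 0] with t ht
        have := abs_logRho_le_fst (z := (t, h)) ht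
        rw [← ofReal_norm, ← ofReal_norm,
          ← ENNReal.ofReal_add (mul_nonneg Real.pi_pos.le (abs_nonneg _)) (norm_nonneg _)]
        exact ENNReal.ofReal_le_ofReal this
    _ = _ := by
        rw [lintegral_add_left measurable_const, lintegral_const]
        simp [circleBound]

theorem integrable_circle_logRho (c : AddCircle (1 : ℝ)) (h : ℝ) :
    Integrable fun t : AddCircle (1 : ℝ) => logRho (t - c, h) := by
  refine ⟨(measurable_logRho.comp (by fun_prop)).aestronglyMeasurable, ?_⟩
  exact (lintegral_circle_logRho_le c h).trans_lt
    (ENNReal.add_lt_top.2 ⟨ENNReal.ofReal_lt_top, lintegral_log_norm_lt_top⟩)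

theorem integrableOn_logRho (R : ℝ) : IntegrableOn logRho {z : Cyl | |z.2| ≤ R} := by
  have hset : {z : Cyl | |z.2| ≤ R} = Set.univ ×ˢ Set.Icc (-R) R := by
    ext z; simp [abs_le]
  refine ⟨measurable_logRho.aestronglyMeasurable, ?_⟩
  rw [hset, HasFiniteIntegral, Measure.volume_eq_prod, ← Measure.prod_restrict,
    Measure.restrict_univ, lintegral_prod_symm _ (measurable_logRho.enorm.aemeasurable)]
  have h1 : ∫⁻ b in Set.Icc (-R) R, ∫⁻ t : AddCircle (1 : ℝ), ‖logRho (t, b)‖ₑ ≤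
      ∫⁻ b in Set.Icc (-R) R, (ENNReal.ofReal (Real.pi * R) + circleBound) := by
    refine setLIntegral_mono measurable_const fun b hb => ?_
    have := lintegral_circle_logRho_le 0 b
    simp only [sub_zero] at this
    refine this.trans ?_
    gcongr
    exact abs_le.2 hb
  refine h1.trans_lt ?_
  rw [lintegral_const]
  refine ENNReal.mul_lt_top (ENNReal.add_lt_top.2
    ⟨ENNReal.ofReal_lt_top, lintegral_log_norm_lt_top⟩) ?_
  simp

/-- Indeed ρ is (e^{π|h|}/2) |e^{2πis} − e^{−2π|h|}|: up to a factor, the distance from a point of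
the unit circle to a fixed point of the closed disc. The condition on the sine keeps the distance
positive, which matters only for h = 0. -/
theorem logRho_toCyl_eq {s h : ℝ} (hs : Real.sin (Real.pi * s) ≠ 0) :
    logRho (toCyl (s, h)) = Real.pi * |h| - Real.log 2 +
      Real.log ‖circleMap 0 1 (2 * Real.pi * s) - (Real.exp (-(2 * Real.pi * |h|)) : ℂ)‖ := by
  set r := Real.exp (-(2 * Real.pi * |h|)) with hr
  set N := ‖circleMap 0 1 (2 * Real.pi * s) - (r : ℂ)‖ with hN
  have hN2 : N ^ 2 = (1 - r) ^ 2 + 4 * r * Real.sin (Real.pi * s) ^ 2 := by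
    have e1 : circleMap 0 1 (2 * Real.pi * s) =
        (Real.cos (2 * (Real.pi * s)) : ℂ) + (Real.sin (2 * (Real.pi * s)) : ℂ) * Complex.I := by
      rw [circleMap, Complex.exp_mul_I]
      push_cast
      simp only [zero_add, one_mul, mul_assoc]
    have e2 : N ^ 2 = (Real.cos (2 * (Real.pi * s)) - r) ^ 2 + Real.sin (2 * (Real.pi * s)) ^ 2 := by
      rw [hN, e1, ← Complex.normSq_eq_norm_sq, Complex.normSq_apply]
      simp [-Complex.ofReal_cos, -Complex.ofReal_sin]
      ring
    rw [e2, Real.cos_two_mul, Real.sin_two_mul]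
    have := Real.sin_sq_add_cos_sq (Real.pi * s)
    have h3 : Real.cos (Real.pi * s) ^ 2 = 1 - Real.sin (Real.pi * s) ^ 2 := by linarith
    rw [mul_pow, mul_pow, h3]
    ring
  have hpos : 0 < N ^ 2 := by
    rw [hN2]
    have := Real.exp_pos (-(2 * Real.pi * |h|))
    positivity
  have hNpos : 0 < N := by
    rcases (norm_nonneg (circleMap 0 1 (2 * Real.pi * s) - (r : ℂ))).eq_or_lt with h0 | h0
    · rw [hN, ← h0] at hpos; simp at hpos
    · exact h0
  have key : rho (toCyl (s, h)) ^ 2 = (Real.exp (Real.pi * |h|) / 2 * N) ^ 2 := by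
    rw [rho_toCyl_sq, mul_pow, hN2]
    have e3 : Real.sinh (Real.pi * h) ^ 2 = Real.sinh (Real.pi * |h|) ^ 2 := by
      rw [← sq_abs, Real.abs_sinh, abs_mul, abs_of_pos Real.pi_pos]
    have e4 : r = Real.exp (-(Real.pi * |h|)) ^ 2 := by
      rw [hr, ← Real.exp_nat_mul]; congr 1; push_cast; ring
    have e5 : Real.exp (Real.pi * |h|) * Real.exp (-(Real.pi * |h|)) = 1 := by
      rw [← Real.exp_add]; simp
    rw [e3, e4, Real.sinh_eq]
    simp only
    set E := Real.exp (Real.pi * |h|)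
    set F := Real.exp (-(Real.pi * |h|))
    have e6 : F = E⁻¹ := eq_inv_of_mul_eq_one_right e5
    have hE : E ≠ 0 := (Real.exp_pos _).ne'
    rw [e6]
    field_simp
    ring
  have key2 : rho (toCyl (s, h)) = Real.exp (Real.pi * |h|) / 2 * N :=
    (pow_left_inj₀ (rho_nonneg _) (by positivity) two_ne_zero).1 key
  rw [logRho, key2, Real.log_mul (by positivity) hNpos.ne', Real.log_div (by positivity) two_ne_zero,
    Real.log_exp]

theorem integral_circle_logRho (c : AddCircle (1 : ℝ)) (h : ℝ) :
    ∫ t : AddCircle (1 : ℝ), logRho (t - c, h) = Real.pi * |h| - Real.log 2 := by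
  have e : ∫ t : AddCircle (1 : ℝ), logRho (t - c, h) = ∫ t : AddCircle (1 : ℝ), logRho (t, h) :=
    integral_sub_right_eq_self (fun t => logRho (t, h)) c
  have hint : Integrable fun t : AddCircle (1 : ℝ) => logRho (t, h) := by
    simpa using integrable_circle_logRho 0 h
  rw [e, ← AddCircle.integral_preimage (1 : ℝ) 0, zero_add]
  have hint' : IntegrableOn (fun s : ℝ => logRho (toCyl (s, h))) (Set.Ioc 0 1) := by
    have := (AddCircle.measurePreserving_mk (1 : ℝ) 0).integrable_comp hint.aestronglyMeasurable
    rw [zero_add] at this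
    exact this.2 hint
  set G : ℝ → ℝ := fun s =>
    Real.log ‖circleMap 0 1 (2 * Real.pi * s) - (Real.exp (-(2 * Real.pi * |h|)) : ℂ)‖
  have hae : ∀ᵐ s ∂(volume.restrict (Set.Ioc (0 : ℝ) 1)),
      logRho (toCyl (s, h)) = (Real.pi * |h| - Real.log 2) + G s := by
    have h1 : ∀ᵐ s : ℝ, s ≠ 1 := by simp [ae_iff]
    filter_upwards [ae_restrict_mem measurableSet_Ioc, ae_restrict_of_ae h1] with s hs hs1
    refine logRho_toCyl_eq (Real.sin_pos_of_pos_of_lt_pi ?_ ?_).ne'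
    · exact mul_pos Real.pi_pos hs.1
    · have : s < 1 := lt_of_le_of_ne hs.2 hs1
      nlinarith [Real.pi_pos]
  have hG : IntegrableOn G (Set.Ioc 0 1) := by
    have h2 := hint'.sub (integrableOn_const (C := Real.pi * |h| - Real.log 2) (by simp))
    refine h2.congr ?_
    filter_upwards [hae] with s hs
    simp only [Pi.sub_apply]
    rw [hs]; ring
  have hGz : ∫ s in Set.Ioc (0 : ℝ) 1, G s = 0 := by
    rw [← intervalIntegral.integral_of_le zero_le_one]
    -- Jensen: the mean of log |e^{iθ} − a| is log⁺ |a|, zero here because |a| = e^{−2π|h|} ≤ 1. The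
    -- case |a| = 1, that is h = 0, is included.
    have h3 := circleAverage_log_norm_sub_const_eq_posLog
      (a := (Real.exp (-(2 * Real.pi * |h|)) : ℂ))
    have h4 := intervalIntegral.integral_comp_mul_left (a := 0) (b := 1) (c := 2 * Real.pi)
      (fun θ => Real.log ‖circleMap 0 1 θ - (Real.exp (-(2 * Real.pi * |h|)) : ℂ)‖)
      two_pi_pos'.ne'
    rw [mul_zero, mul_one] at h4
    refine h4.trans (h3.trans ?_)
    rw [Real.posLog_eq_zero_iff, Complex.norm_real, Real.norm_eq_abs, abs_abs,
      abs_of_pos (Real.exp_pos _), Real.exp_le_one_iff]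
    have : 0 ≤ 2 * Real.pi * |h| := by positivity
    linarith
  refine (integral_congr_ae hae).trans ?_
  rw [integral_add (integrable_const _) hG, hGz, integral_const]
  simp

/-! ### The kernel is a fundamental solution of the Laplacian -/

/-- `ρ²` in the plane. -/
def rhoSq (y : ℝ × ℝ) : ℝ := Real.sin (Real.pi * y.1) ^ 2 + Real.sinh (Real.pi * y.2) ^ 2

/-- `log ρ` in the plane. -/
def ell (y : ℝ × ℝ) : ℝ := Real.log (rhoSq y) / 2

/-- `∂₁ log ρ`. -/
def ell₁ (y : ℝ × ℝ) : ℝ := Real.pi * (Real.sin (Real.pi * y.1) * Real.cos (Real.pi * y.1)) / rhoSq y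

/-- `∂₂ log ρ`. -/
def ell₂ (y : ℝ × ℝ) : ℝ :=
  Real.pi * (Real.sinh (Real.pi * y.2) * Real.cosh (Real.pi * y.2)) / rhoSq y

theorem logRho_toCyl (y : ℝ × ℝ) : logRho (toCyl y) = ell y := by
  rw [logRho, rho_toCyl, Real.log_sqrt (by positivity)]; rfl

/-- The open upper half plane. -/
def upper : Set (ℝ × ℝ) := {y | 0 < y.2}

theorem isOpen_upper : IsOpen upper := isOpen_lt continuous_const continuous_snd

theorem sinh_pos_of_pos {b : ℝ} (hb : 0 < b) : 0 < Real.sinh (Real.pi * b) :=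
  Real.sinh_pos_iff.2 (mul_pos Real.pi_pos hb)

theorem rhoSq_pos_of_upper {y : ℝ × ℝ} (hy : y ∈ upper) : 0 < rhoSq y := by
  have := sinh_pos_of_pos hy
  unfold rhoSq; positivity

theorem contDiff_rhoSq : ContDiff ℝ 1 rhoSq := by
  have h1 : ContDiff ℝ 1 fun y : ℝ × ℝ => Real.sin (Real.pi * y.1) :=
    Real.contDiff_sin.comp (contDiff_const.mul contDiff_fst)
  have h2 : ContDiff ℝ 1 fun y : ℝ × ℝ => Real.sinh (Real.pi * y.2) :=
    Real.contDiff_sinh.comp (contDiff_const.mul contDiff_snd)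
  exact (h1.pow 2).add (h2.pow 2)

theorem contDiffOn_ell : ContDiffOn ℝ 1 ell upper :=
  (contDiff_rhoSq.contDiffOn.log fun _ hy => (rhoSq_pos_of_upper hy).ne').div_const 2

theorem contDiffOn_ell₁ : ContDiffOn ℝ 1 ell₁ upper := by
  have h1 : ContDiff ℝ 1 fun y : ℝ × ℝ => Real.sin (Real.pi * y.1) :=
    Real.contDiff_sin.comp (contDiff_const.mul contDiff_fst)
  have h2 : ContDiff ℝ 1 fun y : ℝ × ℝ => Real.cos (Real.pi * y.1) :=
    Real.contDiff_cos.comp (contDiff_const.mul contDiff_fst)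
  exact (contDiff_const.mul (h1.mul h2)).contDiffOn.div contDiff_rhoSq.contDiffOn
    fun _ hy => (rhoSq_pos_of_upper hy).ne'

theorem contDiffOn_ell₂ : ContDiffOn ℝ 1 ell₂ upper := by
  have h1 : ContDiff ℝ 1 fun y : ℝ × ℝ => Real.sinh (Real.pi * y.2) :=
    Real.contDiff_sinh.comp (contDiff_const.mul contDiff_snd)
  have h2 : ContDiff ℝ 1 fun y : ℝ × ℝ => Real.cosh (Real.pi * y.2) :=
    Real.contDiff_cosh.comp (contDiff_const.mul contDiff_snd)
  exact (contDiff_const.mul (h1.mul h2)).contDiffOn.div contDiff_rhoSq.contDiffOn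
    fun _ hy => (rhoSq_pos_of_upper hy).ne'

theorem fderiv_apply_fst_eq {V : ℝ × ℝ → ℝ} {y : ℝ × ℝ} {d : ℝ} (hV : DifferentiableAt ℝ V y)
    (h : HasDerivAt (fun s => V (s, y.2)) d y.1) : fderiv ℝ V y (1, 0) = d :=
  (hV.hasFDerivAt.comp_hasDerivAt y.1
    ((hasDerivAt_id y.1).prodMk (hasDerivAt_const y.1 y.2))).unique h

theorem fderiv_apply_snd_eq {V : ℝ × ℝ → ℝ} {y : ℝ × ℝ} {d : ℝ} (hV : DifferentiableAt ℝ V y)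
    (h : HasDerivAt (fun t => V (y.1, t)) d y.2) : fderiv ℝ V y (0, 1) = d :=
  (hV.hasFDerivAt.comp_hasDerivAt y.2
    ((hasDerivAt_const y.2 y.1).prodMk (hasDerivAt_id y.2))).unique h

theorem differentiableAt_of_upper {V : ℝ × ℝ → ℝ} (hV : ContDiffOn ℝ 1 V upper) {y : ℝ × ℝ}
    (hy : y ∈ upper) : DifferentiableAt ℝ V y :=
  (hV.differentiableOn (by simp)).differentiableAt (isOpen_upper.mem_nhds hy)

section derivatives

theorem hasDerivAt_sin_pi (s : ℝ) :
    HasDerivAt (fun s => Real.sin (Real.pi * s)) (Real.cos (Real.pi * s) * Real.pi) s := by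
  simpa using ((hasDerivAt_id s).const_mul Real.pi).sin

theorem hasDerivAt_cos_pi (s : ℝ) :
    HasDerivAt (fun s => Real.cos (Real.pi * s)) (-Real.sin (Real.pi * s) * Real.pi) s := by
  simpa using ((hasDerivAt_id s).const_mul Real.pi).cos

theorem hasDerivAt_sinh_pi (s : ℝ) :
    HasDerivAt (fun s => Real.sinh (Real.pi * s)) (Real.cosh (Real.pi * s) * Real.pi) s := by
  simpa using ((hasDerivAt_id s).const_mul Real.pi).sinh

theorem hasDerivAt_cosh_pi (s : ℝ) :
    HasDerivAt (fun s => Real.cosh (Real.pi * s)) (Real.sinh (Real.pi * s) * Real.pi) s := by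
  simpa using ((hasDerivAt_id s).const_mul Real.pi).cosh

theorem fderiv_ell_fst {y : ℝ × ℝ} (hy : y ∈ upper) : fderiv ℝ ell y (1, 0) = ell₁ y := by
  refine fderiv_apply_fst_eq (differentiableAt_of_upper contDiffOn_ell hy) ?_
  have h := ((((hasDerivAt_sin_pi y.1).pow 2).add_const
    (Real.sinh (Real.pi * y.2) ^ 2)).log (rhoSq_pos_of_upper hy).ne').div_const 2
  refine h.congr_deriv ?_
  simp only [ell₁, rhoSq, Pi.pow_apply]
  push_cast
  ring

theorem fderiv_ell_snd {y : ℝ × ℝ} (hy : y ∈ upper) : fderiv ℝ ell y (0, 1) = ell₂ y := by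
  refine fderiv_apply_snd_eq (differentiableAt_of_upper contDiffOn_ell hy) ?_
  have h := ((((hasDerivAt_sinh_pi y.2).pow 2).const_add
    (Real.sin (Real.pi * y.1) ^ 2)).log (rhoSq_pos_of_upper hy).ne').div_const 2
  refine h.congr_deriv ?_
  simp only [ell₂, rhoSq, Pi.pow_apply]
  push_cast
  ring

/-- Over the common denominator ρ⁴ the numerators cancel by cos² = 1 − sin² and cosh² = 1 + sinh².
Hence `ell` is harmonic in the upper half plane. -/
theorem fderiv_ell₁_add_fderiv_ell₂ {y : ℝ × ℝ} (hy : y ∈ upper) :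
    fderiv ℝ ell₁ y (1, 0) + fderiv ℝ ell₂ y (0, 1) = 0 := by
  have hD := rhoSq_pos_of_upper hy
  have h1 := (((hasDerivAt_sin_pi y.1).mul (hasDerivAt_cos_pi y.1)).const_mul Real.pi).div
    (((hasDerivAt_sin_pi y.1).pow 2).add_const (Real.sinh (Real.pi * y.2) ^ 2)) hD.ne'
  have h2 := (((hasDerivAt_sinh_pi y.2).mul (hasDerivAt_cosh_pi y.2)).const_mul Real.pi).div
    (((hasDerivAt_sinh_pi y.2).pow 2).const_add (Real.sin (Real.pi * y.1) ^ 2)) hD.ne'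
  rw [fderiv_apply_fst_eq (differentiableAt_of_upper contDiffOn_ell₁ hy) h1,
    fderiv_apply_snd_eq (differentiableAt_of_upper contDiffOn_ell₂ hy) h2]
  have hc : Real.cos (Real.pi * y.1) ^ 2 = 1 - Real.sin (Real.pi * y.1) ^ 2 := by
    linarith [Real.sin_sq_add_cos_sq (Real.pi * y.1)]
  have hch : Real.cosh (Real.pi * y.2) ^ 2 = 1 + Real.sinh (Real.pi * y.2) ^ 2 := by
    linarith [Real.cosh_sq (Real.pi * y.2)]
  unfold rhoSq at hD
  simp only [Pi.pow_apply, Pi.mul_apply]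
  rw [← add_div, div_eq_zero_iff]
  left
  push_cast
  linear_combination (Real.pi ^ 2 * (Real.sinh (Real.pi * y.2) ^ 2
    - Real.sin (Real.pi * y.1) ^ 2)) * hc + (Real.pi ^ 2 * (Real.sin (Real.pi * y.1) ^ 2
    - Real.sinh (Real.pi * y.2) ^ 2)) * hch

end derivatives

/-! ### The flux of the kernel's gradient through horizontal circles. -/

theorem rhoSq_periodic (b : ℝ) : rhoSq (1 / 2, b) = rhoSq (-1 / 2, b) := by
  have : Real.pi * (-1 / 2) = -(Real.pi * (1 / 2)) := by ring
  simp only [rhoSq, this, Real.sin_neg, neg_sq]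

theorem ell_side (b : ℝ) : ell (1 / 2, b) = ell (-1 / 2, b) := by rw [ell, ell, rhoSq_periodic]

theorem ell₁_side (b : ℝ) : ell₁ (1 / 2, b) = ell₁ (-1 / 2, b) := by
  have h1 : Real.pi * (-1 / 2) = -(Real.pi / 2) := by ring
  have h2 : Real.pi * (1 / 2) = Real.pi / 2 := by ring
  simp only [ell₁, h1, h2, Real.cos_neg, Real.cos_pi_div_two, mul_zero, zero_div]

/-- The divergence theorem on a rectangle of width one, for fields with equal normal components
on the vertical sides. -/
theorem integral_divergence_rectangle {V₁ V₂ : ℝ × ℝ → ℝ} (h₁ : ContDiffOn ℝ 1 V₁ upper)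
    (h₂ : ContDiffOn ℝ 1 V₂ upper) (hs : ∀ b, V₁ (1 / 2, b) = V₁ (-1 / 2, b)) {h R : ℝ}
    (hh : 0 < h) (hR : h ≤ R) :
    ∫ s in (-1 / 2 : ℝ)..(1 / 2), ∫ b in h..R,
      (fderiv ℝ V₁ (s, b) (1, 0) + fderiv ℝ V₂ (s, b) (0, 1)) =
      (∫ s in (-1 / 2 : ℝ)..(1 / 2), V₂ (s, R)) - ∫ s in (-1 / 2 : ℝ)..(1 / 2), V₂ (s, h) := by
  have hsub : Set.uIcc (-1 / 2 : ℝ) (1 / 2) ×ˢ Set.uIcc h R ⊆ upper := by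
    rintro y ⟨-, hy⟩
    rw [Set.uIcc_of_le hR] at hy
    exact hh.trans_le hy.1
  have hsub' : Set.Ioo (min (-1 / 2 : ℝ) (1 / 2)) (max (-1 / 2) (1 / 2)) ×ˢ
      Set.Ioo (min h R) (max h R) ⊆ upper := by
    rintro y ⟨-, hy⟩
    rw [min_eq_left hR] at hy
    exact hh.trans hy.1
  have c₁ : ContinuousOn (fun y => fderiv ℝ V₁ y (1, 0)) upper :=
    (h₁.continuousOn_fderiv_of_isOpen isOpen_upper (by simp)).clm_apply continuousOn_const
  have c₂ : ContinuousOn (fun y => fderiv ℝ V₂ y (0, 1)) upper :=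
    (h₂.continuousOn_fderiv_of_isOpen isOpen_upper (by simp)).clm_apply continuousOn_const
  rw [integral2_divergence_prod_of_hasFDerivAt V₁ V₂ (fderiv ℝ V₁) (fderiv ℝ V₂) (-1 / 2) h
    (1 / 2) R (h₁.continuousOn.mono hsub) (h₂.continuousOn.mono hsub)
    (fun y hy => (differentiableAt_of_upper h₁ (hsub' hy)).hasFDerivAt)
    (fun y hy => (differentiableAt_of_upper h₂ (hsub' hy)).hasFDerivAt)
    (((c₁.add c₂).mono hsub).integrableOn_compact (isCompact_uIcc.prod isCompact_uIcc))]
  simp only [hs]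
  ring

/-- The gradient of `ell` is divergence-free and the contributions of the vertical sides cancel, so
its flux is the same at every height. -/
theorem integral_ell₂_eq_of_le {h R : ℝ} (hh : 0 < h) (hR : h ≤ R) :
    ∫ s in (-1 / 2 : ℝ)..(1 / 2), ell₂ (s, h) = ∫ s in (-1 / 2 : ℝ)..(1 / 2), ell₂ (s, R) := by
  have key := integral_divergence_rectangle contDiffOn_ell₁ contDiffOn_ell₂ ell₁_side hh hR
  rw [intervalIntegral.integral_congr (g := fun _ => 0), intervalIntegral.integral_zero] at key
  · linarith
  · intro s _
    simp only
    rw [intervalIntegral.integral_congr (g := fun _ => 0), intervalIntegral.integral_zero]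
    intro b hb
    rw [Set.uIcc_of_le hR] at hb
    exact fderiv_ell₁_add_fderiv_ell₂ (y := (s, b)) (hh.trans_le hb.1)

theorem continuous_ell₂_slice {h : ℝ} (hh : 0 < h) : Continuous fun s => ell₂ (s, h) :=
  contDiffOn_ell₂.continuousOn.comp_continuous (by fun_prop) fun _ => hh

/-- From sinh² ≤ ρ² ≤ cosh². Both bounds tend to π as the height grows, uniformly in `s`, and this
identifies the constant flux. -/
theorem ell₂_bounds {s h : ℝ} (hh : 0 < h) :
    Real.pi * Real.tanh (Real.pi * h) ≤ ell₂ (s, h) ∧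
      ell₂ (s, h) ≤ Real.pi / Real.tanh (Real.pi * h) := by
  have hS := sinh_pos_of_pos hh
  have hC := Real.cosh_pos (Real.pi * h)
  have hD := rhoSq_pos_of_upper (y := (s, h)) hh
  have hD1 : rhoSq (s, h) ≤ Real.cosh (Real.pi * h) ^ 2 := by
    rw [Real.cosh_sq, rhoSq]
    nlinarith [Real.sin_sq_le_one (Real.pi * s)]
  have hD2 : Real.sinh (Real.pi * h) ^ 2 ≤ rhoSq (s, h) := by
    rw [rhoSq]
    nlinarith [sq_nonneg (Real.sin (Real.pi * s))]
  rw [Real.tanh_eq_sinh_div_cosh]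
  constructor
  · rw [ell₂, le_div_iff₀ hD]
    calc _ ≤ Real.pi * (Real.sinh (Real.pi * h) / Real.cosh (Real.pi * h)) *
          Real.cosh (Real.pi * h) ^ 2 := by gcongr
      _ = _ := by field_simp
  · rw [ell₂, div_le_iff₀ hD]
    calc _ = Real.pi / (Real.sinh (Real.pi * h) / Real.cosh (Real.pi * h)) *
          Real.sinh (Real.pi * h) ^ 2 := by field_simp
      _ ≤ _ := by gcongr

theorem tendsto_tanh_atTop : Tendsto Real.tanh atTop (𝓝 1) := by
  have h : ∀ x : ℝ, Real.tanh x = 1 - 2 * (Real.exp (2 * x) + 1)⁻¹ := by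
    intro x
    rw [Real.tanh_eq_sinh_div_cosh, Real.sinh_eq, Real.cosh_eq]
    have h1 : Real.exp (2 * x) = Real.exp x * Real.exp x := by rw [← Real.exp_add]; ring_nf
    have h2 : Real.exp (-x) = (Real.exp x)⁻¹ := Real.exp_neg x
    have h3 := Real.exp_pos x
    rw [h1, h2]
    field_simp
    ring
  have h4 : Tendsto (fun x : ℝ => Real.exp (2 * x) + 1) atTop atTop :=
    tendsto_atTop_add_const_right _ _
      (Real.tendsto_exp_atTop.comp (tendsto_id.const_mul_atTop two_pos))
  have h5 := (tendsto_const_nhds (x := (1 : ℝ))).sub (h4.inv_tendsto_atTop.const_mul 2)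
  simp only [mul_zero, sub_zero] at h5
  exact h5.congr fun x => (h x).symm

/-- The Poisson kernel of the half cylinder has mass `π`. -/
theorem integral_ell₂ {h : ℝ} (hh : 0 < h) : ∫ s in (-1 / 2 : ℝ)..(1 / 2), ell₂ (s, h) = Real.pi := by
  have ht : Tendsto (fun R => Real.tanh (Real.pi * R)) atTop (𝓝 1) :=
    tendsto_tanh_atTop.comp (tendsto_id.const_mul_atTop Real.pi_pos)
  have h1 : Tendsto (fun R => Real.pi * Real.tanh (Real.pi * R)) atTop (𝓝 Real.pi) := by
    simpa using ht.const_mul Real.pi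
  have h2 : Tendsto (fun R => Real.pi / Real.tanh (Real.pi * R)) atTop (𝓝 Real.pi) := by
    have : Tendsto (fun R => Real.pi / Real.tanh (Real.pi * R)) atTop (𝓝 (Real.pi / 1)) :=
      (tendsto_const_nhds (x := Real.pi)).div ht one_ne_zero
    simpa only [div_one] using this
  have hI : ∀ c : ℝ, ∫ _ in (-1 / 2 : ℝ)..(1 / 2), c = c := fun c => by
    rw [intervalIntegral.integral_const]; norm_num
  have h3 : ∀ᶠ R in atTop, Real.pi * Real.tanh (Real.pi * R) ≤
      ∫ s in (-1 / 2 : ℝ)..(1 / 2), ell₂ (s, h) := by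
    filter_upwards [eventually_ge_atTop h] with R hR
    rw [integral_ell₂_eq_of_le hh hR, ← hI (Real.pi * Real.tanh (Real.pi * R))]
    exact intervalIntegral.integral_mono_on (by norm_num) (by simp)
      ((continuous_ell₂_slice (hh.trans_le hR)).intervalIntegrable _ _)
      fun s _ => (ell₂_bounds (hh.trans_le hR)).1
  have h4 : ∀ᶠ R in atTop, ∫ s in (-1 / 2 : ℝ)..(1 / 2), ell₂ (s, h) ≤
      Real.pi / Real.tanh (Real.pi * R) := by
    filter_upwards [eventually_ge_atTop h] with R hR
    rw [integral_ell₂_eq_of_le hh hR, ← hI (Real.pi / Real.tanh (Real.pi * R))]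
    exact intervalIntegral.integral_mono_on (by norm_num)
      ((continuous_ell₂_slice (hh.trans_le hR)).intervalIntegrable _ _) (by simp)
      fun s _ => (ell₂_bounds (hh.trans_le hR)).2
  exact le_antisymm (ge_of_tendsto h2 h4) (le_of_tendsto h1 h3)

/-! ### Limits of the boundary terms at height zero. -/

theorem abs_ell_le {s h : ℝ} (hs : |s| ≤ 1 / 2) (hs0 : s ≠ 0) :
    |ell (s, h)| ≤ Real.pi * |h| + |Real.log s| := by
  have h4 : ‖((s : ℝ) : AddCircle (1 : ℝ))‖ = |s| :=
    (AddCircle.norm_coe_eq_abs_iff (1 : ℝ) one_ne_zero).2 (by simpa using hs)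
  have h5 : (toCyl (s, h)).1 ≠ 0 := by
    rw [← norm_ne_zero_iff]
    change ‖((s : ℝ) : AddCircle (1 : ℝ))‖ ≠ 0
    rw [h4]; simpa using hs0
  have h6 := abs_logRho_le_fst h5
  rw [logRho_toCyl] at h6
  refine h6.trans (le_of_eq ?_)
  change Real.pi * |h| + |Real.log ‖((s : ℝ) : AddCircle (1 : ℝ))‖| = _
  rw [h4, Real.log_abs]

/-- Since sinh(πh) (|s| + h) ≤ 2ρ², the kernel `ell₂` is O(1/(|s| + h)). A Lipschitz function that
vanishes at the origin compensates exactly this growth. -/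
theorem ell₂_mul_le {s h : ℝ} (hs : |s| ≤ 1 / 2) (hh : 0 < h) (h1 : h ≤ 1) :
    |ell₂ (s, h)| * (|s| + h) ≤ 2 * Real.pi * Real.cosh Real.pi := by
  have hS := sinh_pos_of_pos hh
  have hC := Real.cosh_pos (Real.pi * h)
  have hD := rhoSq_pos_of_upper (y := (s, h)) hh
  have hc : Real.cosh (Real.pi * h) ≤ Real.cosh Real.pi := by
    rw [Real.cosh_le_cosh, abs_of_pos (mul_pos Real.pi_pos hh), abs_of_pos Real.pi_pos]
    nlinarith [Real.pi_pos]
  have hsin := two_mul_abs_le_abs_sin hs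
  have hsinh : h ≤ Real.sinh (Real.pi * h) := by
    have := abs_le_abs_sinh h
    rwa [abs_of_pos hh, abs_of_pos hS] at this
  have e : |ell₂ (s, h)| = Real.pi * (Real.sinh (Real.pi * h) * Real.cosh (Real.pi * h)) /
      rhoSq (s, h) := by
    rw [ell₂, abs_of_nonneg]; positivity
  rw [e, div_mul_eq_mul_div, div_le_iff₀ hD]
  have h2 : Real.sinh (Real.pi * h) * (|s| + h) ≤ 2 * rhoSq (s, h) := by
    have h3 : (2 * |s|) ^ 2 ≤ Real.sin (Real.pi * s) ^ 2 := by
      rw [← sq_abs (Real.sin _)]; gcongr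
    simp only [rhoSq]
    nlinarith [abs_nonneg s, sq_nonneg (2 * |s| - Real.sinh (Real.pi * h))]
  have h5 : 0 ≤ rhoSq (s, h) := hD.le
  calc _ = Real.pi * Real.cosh (Real.pi * h) * (Real.sinh (Real.pi * h) * (|s| + h)) := by ring
    _ ≤ Real.pi * Real.cosh Real.pi * (2 * rhoSq (s, h)) := by
      have := Real.pi_pos
      gcongr
    _ = _ := by ring

theorem rhoSq_ne_zero {s h : ℝ} (hs : |s| ≤ 1 / 2) (hs0 : s ≠ 0) : rhoSq (s, h) ≠ 0 := by
  have h1 := two_mul_abs_le_abs_sin hs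
  have h2 : 0 < |s| := abs_pos.2 hs0
  have h3 : 0 < Real.sin (Real.pi * s) ^ 2 := by
    rw [← sq_abs]
    have : 0 < |Real.sin (Real.pi * s)| := by linarith
    positivity
  unfold rhoSq
  positivity

theorem continuousAt_ell {s h : ℝ} (hs : |s| ≤ 1 / 2) (hs0 : s ≠ 0) : ContinuousAt ell (s, h) :=
  (contDiff_rhoSq.continuous.continuousAt.log (rhoSq_ne_zero hs hs0)).div_const 2

theorem continuousAt_ell₂ {s h : ℝ} (hs : |s| ≤ 1 / 2) (hs0 : s ≠ 0) : ContinuousAt ell₂ (s, h) :=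
  ContinuousAt.div (by fun_prop) contDiff_rhoSq.continuous.continuousAt (rhoSq_ne_zero hs hs0)

theorem tendsto_line (s : ℝ) : Tendsto (fun h : ℝ => (s, h)) (𝓝[>] 0) (𝓝 (s, 0)) :=
  ((by fun_prop : Continuous fun h : ℝ => (s, h)).tendsto 0).mono_left nhdsWithin_le_nhds

theorem ae_half_interval : ∀ᵐ s : ℝ, s ∈ Set.uIoc (-1 / 2 : ℝ) (1 / 2) → |s| ≤ 1 / 2 ∧ s ≠ 0 := by
  have h1 : ∀ᵐ s : ℝ, s ≠ 0 := by simp [ae_iff]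
  filter_upwards [h1] with s hs hs'
  rw [Set.uIoc_of_le (by norm_num)] at hs'
  exact ⟨by rw [abs_le]; constructor <;> linarith [hs'.1, hs'.2], hs⟩

theorem measurable_ell : Measurable ell := contDiff_rhoSq.continuous.measurable.log.div_const 2

theorem measurable_ell₂ : Measurable ell₂ :=
  Measurable.div (Continuous.measurable (by fun_prop)) contDiff_rhoSq.continuous.measurable

theorem exists_bound_on_box {k : ℝ × ℝ → ℝ} (hk : Continuous k) :
    ∃ M : ℝ, 0 ≤ M ∧ ∀ s h, |s| ≤ 1 / 2 → 0 ≤ h → h ≤ 1 → |k (s, h)| ≤ M := by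
  obtain ⟨M, hM⟩ := (isCompact_Icc.prod isCompact_Icc :
    IsCompact (Set.Icc (-1 / 2 : ℝ) (1 / 2) ×ˢ Set.Icc (0 : ℝ) 1)).exists_bound_of_continuousOn
    hk.continuousOn
  refine ⟨max M 0, le_max_right _ _, fun s h h1 h2 h3 => (hM (s, h) ⟨?_, h2, h3⟩).trans
    (le_max_left _ _)⟩
  rw [abs_le] at h1
  exact ⟨by linarith [h1.1], h1.2⟩

theorem eventually_small : ∀ᶠ h : ℝ in 𝓝[>] 0, 0 < h ∧ h ≤ 1 := by
  filter_upwards [self_mem_nhdsWithin, mem_nhdsWithin_of_mem_nhds (Iic_mem_nhds zero_lt_one)]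
    with h h1 h2
  exact ⟨h1, h2⟩

theorem tendsto_integral_ell_mul {k : ℝ × ℝ → ℝ} (hk : Continuous k) :
    Tendsto (fun h => ∫ s in (-1 / 2 : ℝ)..(1 / 2), ell (s, h) * k (s, h)) (𝓝[>] 0)
      (𝓝 (∫ s in (-1 / 2 : ℝ)..(1 / 2), ell (s, 0) * k (s, 0))) := by
  obtain ⟨M, hM0, hM⟩ := exists_bound_on_box hk
  apply intervalIntegral.tendsto_integral_filter_of_dominated_convergence
    (fun s => (Real.pi + |Real.log s|) * M)
  · refine .of_forall fun h => ?_
    exact ((measurable_ell.comp (by fun_prop)).mul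
      (hk.measurable.comp (by fun_prop))).aestronglyMeasurable
  · filter_upwards [eventually_small] with h ⟨h0, h1⟩
    filter_upwards [ae_half_interval] with s hs hs'
    obtain ⟨h2, h3⟩ := hs hs'
    rw [norm_mul]
    refine mul_le_mul ((abs_ell_le h2 h3).trans ?_) (hM s h h2 h0.le h1) (abs_nonneg _)
      (add_nonneg Real.pi_pos.le (abs_nonneg _))
    rw [abs_of_pos h0]
    nlinarith [Real.pi_pos]
  · exact ((intervalIntegrable_const).add
      intervalIntegral.intervalIntegrable_log'.abs).mul_const M
  · filter_upwards [ae_half_interval] with s hs hs'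
    obtain ⟨h2, h3⟩ := hs hs'
    exact ((continuousAt_ell h2 h3).tendsto.comp (tendsto_line s)).mul
      ((hk.tendsto _).comp (tendsto_line s))

/-- `ell₂` at height `h` has mass π and tends to zero away from the origin. After subtraction of `f
0` the integrand is bounded by `ell₂_mul_le` and the Lipschitz estimate, so dominated convergence
applies. -/
theorem tendsto_integral_ell₂_mul {f : ℝ × ℝ → ℝ} (hf : ContDiff ℝ 1 f) :
    Tendsto (fun h => ∫ s in (-1 / 2 : ℝ)..(1 / 2), f (s, h) * ell₂ (s, h)) (𝓝[>] 0)
      (𝓝 (Real.pi * f 0)) := by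
  set B : Set (ℝ × ℝ) := Set.Icc (-1 / 2 : ℝ) (1 / 2) ×ˢ Set.Icc (0 : ℝ) 1 with hB
  have hBc : Convex ℝ B := (convex_Icc _ _).prod (convex_Icc _ _)
  obtain ⟨M, hM⟩ := (isCompact_Icc.prod isCompact_Icc : IsCompact B).exists_bound_of_continuousOn
    (hf.continuous_fderiv (by simp)).continuousOn
  have hlip : ∀ s h, |s| ≤ 1 / 2 → 0 < h → h ≤ 1 → |f (s, h) - f 0| ≤ M * (|s| + h) := by
    intro s h h1 h2 h3
    rw [abs_le] at h1
    have := hBc.norm_image_sub_le_of_norm_fderiv_le (𝕜 := ℝ) (f := f) (C := M)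
      (fun x _ => hf.differentiable (by simp) x) (fun x hx => hM x hx)
      (x := 0) (y := (s, h)) (by constructor <;> constructor <;> norm_num)
      ⟨⟨by linarith [h1.1], h1.2⟩, h2.le, h3⟩
    refine this.trans ?_
    have hM0 : 0 ≤ M := (norm_nonneg _).trans
      (hM 0 (by constructor <;> constructor <;> norm_num))
    gcongr
    rw [sub_zero, Prod.norm_def]
    refine max_le ?_ ?_
    · change |s| ≤ _; linarith
    · change |h| ≤ _; rw [abs_of_pos h2]; linarith [abs_nonneg s]
  have hM0 : 0 ≤ M := (norm_nonneg _).trans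
      (hM 0 (by constructor <;> constructor <;> norm_num))
  have key : Tendsto (fun h => ∫ s in (-1 / 2 : ℝ)..(1 / 2), (f (s, h) - f 0) * ell₂ (s, h))
      (𝓝[>] 0) (𝓝 (∫ s in (-1 / 2 : ℝ)..(1 / 2), (f (s, 0) - f 0) * ell₂ (s, 0))) := by
    apply intervalIntegral.tendsto_integral_filter_of_dominated_convergence
      (fun _ => M * (2 * Real.pi * Real.cosh Real.pi))
    · refine .of_forall fun h => ?_
      exact (((hf.continuous.measurable.comp (by fun_prop)).sub_const _).mul
        (measurable_ell₂.comp (by fun_prop))).aestronglyMeasurable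
    · filter_upwards [eventually_small] with h ⟨h0, h1⟩
      filter_upwards [ae_half_interval] with s hs hs'
      obtain ⟨h2, h3⟩ := hs hs'
      rw [norm_mul, Real.norm_eq_abs, Real.norm_eq_abs]
      calc _ ≤ M * (|s| + h) * |ell₂ (s, h)| := by
            gcongr; exact hlip s h h2 h0 h1
        _ = M * (|ell₂ (s, h)| * (|s| + h)) := by ring
        _ ≤ _ := mul_le_mul_of_nonneg_left (ell₂_mul_le h2 h0 h1) hM0
    · exact intervalIntegrable_const
    · filter_upwards [ae_half_interval] with s hs hs'
      obtain ⟨h2, h3⟩ := hs hs'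
      exact (((hf.continuous.tendsto _).comp (tendsto_line s)).sub_const _).mul
        ((continuousAt_ell₂ h2 h3).tendsto.comp (tendsto_line s))
  have hz : ∀ s, ell₂ (s, 0) = 0 := fun s => by simp [ell₂]
  simp only [hz, mul_zero, intervalIntegral.integral_zero] at key
  have key2 := key.add_const (Real.pi * f 0)
  rw [zero_add] at key2
  refine key2.congr' ?_
  filter_upwards [self_mem_nhdsWithin] with h (hh : 0 < h)
  have c1 := continuous_ell₂_slice hh
  have c2 : Continuous fun s => f (s, h) := hf.continuous.comp (by fun_prop)
  have : ∫ s in (-1 / 2 : ℝ)..(1 / 2), f (s, h) * ell₂ (s, h) =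
      (∫ s in (-1 / 2 : ℝ)..(1 / 2), (f (s, h) - f 0) * ell₂ (s, h)) +
        ∫ s in (-1 / 2 : ℝ)..(1 / 2), f 0 * ell₂ (s, h) := by
    rw [← intervalIntegral.integral_add]
    · congr 1 with s; ring
    · exact ((c2.sub continuous_const).mul c1).intervalIntegrable _ _
    · exact (continuous_const.mul c1).intervalIntegrable _ _
  rw [this, intervalIntegral.integral_const_mul, integral_ell₂ hh]
  ring

/-! ### Green's representation formula in the upper half of the strip. -/

/-- The Laplacian of a function on the plane. -/
def laplace (f : ℝ × ℝ → ℝ) (y : ℝ × ℝ) : ℝ :=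
  fderiv ℝ (fun y => fderiv ℝ f y (1, 0)) y (1, 0) + fderiv ℝ (fun y => fderiv ℝ f y (0, 1)) y (0, 1)

theorem contDiff_fderiv_apply {f : ℝ × ℝ → ℝ} (hf : ContDiff ℝ ∞ f) (v : ℝ × ℝ) :
    ContDiff ℝ ∞ fun y => fderiv ℝ f y v :=
  (hf.fderiv_right (m := ∞) (by simp)).clm_apply contDiff_const

/-- Green's second identity: the field `ell` ∇f − f ∇`ell` has divergence `ell` Δf. Its fluxes
through the vertical sides cancel by periodicity. The top edge at height R + 1 lies strictly beyond
R, so that f vanishes near it together with its derivative, and only the bottom remains. -/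
theorem integral_ell_mul_laplace_rectangle {f : ℝ × ℝ → ℝ} (hf : ContDiff ℝ ∞ f)
    (hper : ∀ y, f (y + (1, 0)) = f y) {R : ℝ} (hv : ∀ y : ℝ × ℝ, R ≤ y.2 → f y = 0) {h : ℝ}
    (hh : 0 < h) (hR : h ≤ R + 1) :
    ∫ s in (-1 / 2 : ℝ)..(1 / 2), ∫ b in h..(R + 1), ell (s, b) * laplace f (s, b) =
      (∫ s in (-1 / 2 : ℝ)..(1 / 2), f (s, h) * ell₂ (s, h)) -
        ∫ s in (-1 / 2 : ℝ)..(1 / 2), ell (s, h) * fderiv ℝ f (s, h) (0, 1) := by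
  have hf1 : ContDiff ℝ 1 f := hf.of_le (by simp)
  have g₁ : ContDiff ℝ 1 fun y => fderiv ℝ f y (1, 0) := (contDiff_fderiv_apply hf _).of_le (by simp)
  have g₂ : ContDiff ℝ 1 fun y => fderiv ℝ f y (0, 1) := (contDiff_fderiv_apply hf _).of_le (by simp)
  set V₁ : ℝ × ℝ → ℝ := fun y => ell y * fderiv ℝ f y (1, 0) - f y * ell₁ y with hV₁
  set V₂ : ℝ × ℝ → ℝ := fun y => ell y * fderiv ℝ f y (0, 1) - f y * ell₂ y with hV₂
  have v₁ : ContDiffOn ℝ 1 V₁ upper :=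
    (contDiffOn_ell.mul g₁.contDiffOn).sub (hf1.contDiffOn.mul contDiffOn_ell₁)
  have v₂ : ContDiffOn ℝ 1 V₂ upper :=
    (contDiffOn_ell.mul g₂.contDiffOn).sub (hf1.contDiffOn.mul contDiffOn_ell₂)
  have hp : ∀ b : ℝ, ((1 / 2 : ℝ), b) = (-1 / 2, b) + (1, 0) := fun b => by
    simp only [Prod.mk_add_mk, add_zero, Prod.mk.injEq, and_true]; norm_num
  have hper' : ∀ y, fderiv ℝ f (y + (1, 0)) = fderiv ℝ f y := by
    intro y
    rw [← fderiv_comp_add_right]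
    congr 1
    ext z
    exact hper z
  have side : ∀ b, V₁ (1 / 2, b) = V₁ (-1 / 2, b) := by
    intro b
    simp only [hV₁]
    rw [ell_side, ell₁_side, hp, hper, hper']
  have top0 : ∀ s : ℝ, V₂ (s, R + 1) = 0 := by
    intro s
    have e1 : f =ᶠ[𝓝 (s, R + 1)] fun _ => 0 := by
      have : ∀ᶠ y : ℝ × ℝ in 𝓝 (s, R + 1), R < y.2 :=
        continuous_snd.continuousAt.eventually_const_lt (by simp)
      filter_upwards [this] with y hy
      exact hv y hy.le
    simp only [hV₂]
    rw [e1.fderiv_eq, e1.self_of_nhds]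
    simp
  have div : ∀ y ∈ upper, fderiv ℝ V₁ y (1, 0) + fderiv ℝ V₂ y (0, 1) = ell y * laplace f y := by
    intro y hy
    have d0 := differentiableAt_of_upper contDiffOn_ell hy
    have d1 := differentiableAt_of_upper contDiffOn_ell₁ hy
    have d2 := differentiableAt_of_upper contDiffOn_ell₂ hy
    have df := hf1.differentiable (by simp) y
    have dg₁ := g₁.differentiable (by simp) y
    have dg₂ := g₂.differentiable (by simp) y
    have e := fderiv_ell₁_add_fderiv_ell₂ hy
    have e₁ : HasFDerivAt V₁ _ y :=
      (d0.hasFDerivAt.mul dg₁.hasFDerivAt).sub (df.hasFDerivAt.mul d1.hasFDerivAt)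
    have e₂ : HasFDerivAt V₂ _ y :=
      (d0.hasFDerivAt.mul dg₂.hasFDerivAt).sub (df.hasFDerivAt.mul d2.hasFDerivAt)
    rw [e₁.fderiv, e₂.fderiv]
    simp only [sub_apply, add_apply, smul_apply, smul_eq_mul, fderiv_ell_fst hy, fderiv_ell_snd hy,
      laplace]
    linear_combination (-f y) * e
  have key := integral_divergence_rectangle v₁ v₂ side hh hR
  simp only [top0, intervalIntegral.integral_zero] at key
  have key1 : ∫ s in (-1 / 2 : ℝ)..(1 / 2), ∫ b in h..(R + 1), ell (s, b) * laplace f (s, b) =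
      ∫ s in (-1 / 2 : ℝ)..(1 / 2), ∫ b in h..(R + 1),
        (fderiv ℝ V₁ (s, b) (1, 0) + fderiv ℝ V₂ (s, b) (0, 1)) := by
    refine intervalIntegral.integral_congr fun s _ => ?_
    refine intervalIntegral.integral_congr fun b hb => ?_
    rw [Set.uIcc_of_le hR] at hb
    exact (div (s, b) (hh.trans_le hb.1)).symm
  have i₁ : IntervalIntegrable (fun s => ell (s, h) * fderiv ℝ f (s, h) (0, 1)) volume
      (-1 / 2) (1 / 2) := Continuous.intervalIntegrable
    ((contDiffOn_ell.continuousOn.comp_continuous (by fun_prop) fun _ => hh).mul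
      (g₂.continuous.comp (by fun_prop))) _ _
  have i₂ : IntervalIntegrable (fun s => f (s, h) * ell₂ (s, h)) volume
      (-1 / 2) (1 / 2) := Continuous.intervalIntegrable
    ((hf.continuous.comp (by fun_prop)).mul (continuous_ell₂_slice hh)) _ _
  rw [key1, key, hV₂]
  simp only
  rw [intervalIntegral.integral_sub i₁ i₂]
  ring

/-- The upper half of the slab over `(-1/2, 1/2]`. -/
def upperSlab : Set (ℝ × ℝ) := Set.Ioc (-1 / 2) (1 / 2) ×ˢ Set.Ioi 0

theorem measurableSet_upperSlab : MeasurableSet upperSlab := measurableSet_Ioc.prod measurableSet_Ioi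

/-- Green's representation formula on the upper half of the strip. -/
theorem integral_upperSlab_ell_mul_laplace {f : ℝ × ℝ → ℝ} (hf : ContDiff ℝ ∞ f)
    (hper : ∀ y, f (y + (1, 0)) = f y) {R : ℝ} (hR : 0 < R) (hv : ∀ y : ℝ × ℝ, R ≤ y.2 → f y = 0)
    (hK : IntegrableOn (fun y => ell y * laplace f y) upperSlab) :
    ∫ y in upperSlab, ell y * laplace f y =
      Real.pi * f 0 - ∫ s in (-1 / 2 : ℝ)..(1 / 2), ell (s, 0) * fderiv ℝ f (s, 0) (0, 1) := by
  have hl : ∀ y : ℝ × ℝ, R < y.2 → laplace f y = 0 := by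
    intro y hy
    have e : ∀ z : ℝ × ℝ, R < z.2 → f =ᶠ[𝓝 z] fun _ => 0 := fun z hz => by
      have : ∀ᶠ y : ℝ × ℝ in 𝓝 z, R < y.2 := continuous_snd.continuousAt.eventually_const_lt hz
      filter_upwards [this] with y hy
      exact hv y hy.le
    have e' : ∀ v, (fun z => fderiv ℝ f z v) =ᶠ[𝓝 y] fun _ => 0 := fun v => by
      have : ∀ᶠ z : ℝ × ℝ in 𝓝 y, R < z.2 := continuous_snd.continuousAt.eventually_const_lt hy
      filter_upwards [this] with z hz
      rw [(e z hz).fderiv_eq]; simp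
    rw [laplace, (e' _).fderiv_eq, (e' _).fderiv_eq]; simp
  have lim1 := (tendsto_integral_ell₂_mul (hf.of_le (by simp))).sub
    (tendsto_integral_ell_mul (contDiff_fderiv_apply hf (0, 1)).continuous)
  have lim2 : Tendsto (fun h => ∫ y in upperSlab,
      {y : ℝ × ℝ | h < y.2}.indicator (fun y => ell y * laplace f y) y) (𝓝[>] 0)
      (𝓝 (∫ y in upperSlab, ell y * laplace f y)) := by
    apply tendsto_integral_filter_of_dominated_convergence (fun y => ‖ell y * laplace f y‖)
    · refine .of_forall fun h => ?_
      exact hK.aestronglyMeasurable.indicator (measurableSet_lt measurable_const measurable_snd)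
    · exact .of_forall fun h => .of_forall fun y => norm_indicator_le_norm_self _ _
    · exact hK.norm
    · filter_upwards [ae_restrict_mem measurableSet_upperSlab] with y hy
      refine tendsto_const_nhds.congr' ?_
      filter_upwards [mem_nhdsWithin_of_mem_nhds (Iio_mem_nhds (show (0 : ℝ) < y.2 from hy.2))]
        with h hh
      exact (Set.indicator_of_mem (show y ∈ {y : ℝ × ℝ | h < y.2} from hh)
        (fun y => ell y * laplace f y)).symm
  refine tendsto_nhds_unique lim2 (lim1.congr' ?_)
  filter_upwards [eventually_small] with h ⟨hh, h1⟩
  have hset : upperSlab ∩ {y : ℝ × ℝ | h < y.2} = Set.Ioc (-1 / 2) (1 / 2) ×ˢ Set.Ioi h := by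
    ext y
    simp only [upperSlab, Set.mem_inter_iff, Set.mem_prod, Set.mem_Ioi, Set.mem_ofPred_eq]
    constructor
    · rintro ⟨⟨a, -⟩, b⟩; exact ⟨a, b⟩
    · rintro ⟨a, b⟩; exact ⟨⟨a, hh.trans b⟩, b⟩
  rw [← integral_ell_mul_laplace_rectangle hf hper hv hh (by linarith),
    setIntegral_indicator (measurableSet_lt measurable_const measurable_snd), hset]
  have hsub : Set.Ioc (-1 / 2 : ℝ) (1 / 2) ×ˢ Set.Ioc h (R + 1) ⊆
      Set.Ioc (-1 / 2 : ℝ) (1 / 2) ×ˢ Set.Ioi h :=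
    Set.prod_mono le_rfl Set.Ioc_subset_Ioi_self
  rw [setIntegral_eq_of_subset_of_forall_sdiff_eq_zero
    (measurableSet_Ioc.prod measurableSet_Ioi) hsub]
  · rw [Measure.volume_eq_prod, setIntegral_prod, intervalIntegral.integral_of_le (by norm_num)]
    · congr 1 with s
      rw [intervalIntegral.integral_of_le (by linarith)]
    · refine hK.mono_set (hsub.trans ?_)
      exact Set.prod_mono le_rfl fun b hb => hh.trans hb
  · rintro y ⟨⟨h2, h3⟩, h4⟩
    rw [hl y ?_, mul_zero]
    by_contra h5
    exact h4 ⟨h2, h3, by linarith⟩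

/-! ### Convolution of kernels with test functions -/

/-- Integrability over bounded pieces of the strip. -/
def LocInt (K : Cyl → ℝ) : Prop := ∀ R : ℝ, IntegrableOn K {z : Cyl | |z.2| ≤ R}

theorem locInt_logRho : LocInt logRho := integrableOn_logRho

theorem measurableSet_band (R : ℝ) : MeasurableSet {z : Cyl | |z.2| ≤ R} :=
  measurableSet_le (by fun_prop) measurable_const

theorem volume_band_lt_top (R : ℝ) : volume {z : Cyl | |z.2| ≤ R} < ⊤ := by
  have hset : {z : Cyl | |z.2| ≤ R} = Set.univ ×ˢ Set.Icc (-R) R := by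
    ext z; simp [abs_le]
  rw [hset, Measure.volume_eq_prod, Measure.prod_prod, AddCircle.measure_univ]
  simp

theorem LocInt.integrable_mul {K ψ : Cyl → ℝ} (hK : LocInt K) (hψ : Continuous ψ)
    (hc : HasCompactSupport ψ) : Integrable fun z => K z * ψ z := by
  obtain ⟨R, -, hR⟩ := exists_height_bound hc
  obtain ⟨M, -, hM⟩ := exists_abs_bound hψ hc
  rw [← integrableOn_iff_integrable_of_support_subset (s := {z : Cyl | |z.2| ≤ R})]
  · exact (hK R).mul_bdd (c := M) hψ.aestronglyMeasurable (.of_forall hM)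
  · intro z hz
    exact hR z fun h => hz (by simp [h])

/-- The convolution of a kernel with a test function. -/
def conv (K ψ : Cyl → ℝ) (x : Cyl) : ℝ := ∫ z, K z * ψ (z + x)

/-- The shift acts on `ψ` only, so differentiation under the integral falls on `ψ`, and local
integrability of `K` suffices. -/
theorem hasFDerivAt_conv {K ψ : Cyl → ℝ} (hK : LocInt K) (hψ : IsTest ψ) (y : ℝ × ℝ) :
    HasFDerivAt (conv K ψ ∘ toCyl)
      (conv K (partial₁ ψ) (toCyl y) • ContinuousLinearMap.fst ℝ ℝ ℝ +
        conv K (partial₂ ψ) (toCyl y) • ContinuousLinearMap.snd ℝ ℝ ℝ) y := by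
  obtain ⟨R, hR0, hR⟩ := exists_height_bound hψ.2
  obtain ⟨R₁, -, hR₁⟩ := exists_height_bound hψ.partial₁.2
  obtain ⟨R₂, -, hR₂⟩ := exists_height_bound hψ.partial₂.2
  obtain ⟨M₁, hM₁0, hM₁⟩ := exists_abs_bound hψ.partial₁.continuous hψ.partial₁.2
  obtain ⟨M₂, hM₂0, hM₂⟩ := exists_abs_bound hψ.partial₂.continuous hψ.partial₂.2
  let F' : ℝ × ℝ → Cyl → (ℝ × ℝ →L[ℝ] ℝ) := fun y z =>
    (K z * partial₁ ψ (z + toCyl y)) • ContinuousLinearMap.fst ℝ ℝ ℝ +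
      (K z * partial₂ ψ (z + toCyl y)) • ContinuousLinearMap.snd ℝ ℝ ℝ
  have i₁ := hK.integrable_mul (hψ.partial₁.comp_add y).continuous (hψ.partial₁.comp_add y).2
  have i₂ := hK.integrable_mul (hψ.partial₂.comp_add y).continuous (hψ.partial₂.comp_add y).2
  have i₀ := hK.integrable_mul (hψ.comp_add y).continuous (hψ.comp_add y).2
  have key : HasFDerivAt (fun y => ∫ z, K z * ψ (z + toCyl y)) (∫ z, F' y z) y := by
    refine hasFDerivAt_integral_of_dominated_of_fderiv_le
      (F := fun y z => K z * ψ (z + toCyl y)) (F' := F') (s := Metric.ball y 1)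
      -- For shifts within distance 1 of `y` the shifted derivatives of `ψ` all vanish outside this
      -- band.
      (bound := {z : Cyl | |z.2| ≤ max R₁ R₂ + |y.2| + 1}.indicator
        fun z => |K z| * (M₁ + M₂)) (Metric.ball_mem_nhds y one_pos) ?_ i₀ ?_ ?_ ?_ ?_
    · exact .of_forall fun x => (hK.integrable_mul (hψ.comp_add x).continuous
        (hψ.comp_add x).2).aestronglyMeasurable
    · exact (i₁.aestronglyMeasurable.smul_const _).add (i₂.aestronglyMeasurable.smul_const _)
    · refine .of_forall fun z x hx => ?_
      have hx2 : |x.2 - y.2| < 1 := (norm_snd_le (x - y)).trans_lt (mem_ball_iff_norm.1 hx)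
      have n₁ : ‖ContinuousLinearMap.fst ℝ ℝ ℝ‖ ≤ 1 := ContinuousLinearMap.norm_fst_le ℝ ℝ ℝ
      have n₂ : ‖ContinuousLinearMap.snd ℝ ℝ ℝ‖ ≤ 1 := ContinuousLinearMap.norm_snd_le ℝ ℝ ℝ
      by_cases hz : z ∈ {z : Cyl | |z.2| ≤ max R₁ R₂ + |y.2| + 1}
      · rw [Set.indicator_of_mem hz]
        calc ‖F' x z‖ ≤ |K z| * M₁ * 1 + |K z| * M₂ * 1 := by
              refine (norm_add_le _ _).trans (add_le_add ?_ ?_)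
              · rw [norm_smul, norm_mul]
                exact mul_le_mul (mul_le_mul_of_nonneg_left (hM₁ _) (abs_nonneg _)) n₁
                  (norm_nonneg _) (mul_nonneg (abs_nonneg _) hM₁0)
              · rw [norm_smul, norm_mul]
                exact mul_le_mul (mul_le_mul_of_nonneg_left (hM₂ _) (abs_nonneg _)) n₂
                  (norm_nonneg _) (mul_nonneg (abs_nonneg _) hM₂0)
          _ = _ := by ring
      · rw [Set.indicator_of_notMem hz]
        have hz' : max R₁ R₂ + |y.2| + 1 < |z.2| := not_le.1 hz
        have hbig : max R₁ R₂ < |(z + toCyl x).2| := by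
          have e : (z + toCyl x).2 = z.2 + x.2 := rfl
          have h1 : |z.2| ≤ |z.2 + x.2| + |x.2| := by
            have := abs_sub (z.2 + x.2) x.2
            rwa [add_sub_cancel_right] at this
          have h2 : |x.2| ≤ |x.2 - y.2| + |y.2| := by
            have := abs_add_le (x.2 - y.2) y.2
            rwa [sub_add_cancel] at this
          rw [e]; linarith
        have z₁ : partial₁ ψ (z + toCyl x) = 0 := by
          by_contra h
          exact (hR₁ _ h).not_gt ((le_max_left _ _).trans_lt hbig)
        have z₂ : partial₂ ψ (z + toCyl x) = 0 := by
          by_contra h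
          exact (hR₂ _ h).not_gt ((le_max_right _ _).trans_lt hbig)
        simp [F', z₁, z₂]
    · rw [integrable_indicator_iff (measurableSet_band _)]
      exact (hK _).abs.mul_const _
    · refine .of_forall fun z x _ => ?_
      obtain ⟨w, rfl⟩ := toCyl_surjective z
      have hd : HasFDerivAt (fun x => (ψ ∘ toCyl) (w + x)) (fderiv ℝ (ψ ∘ toCyl) (w + x)) x := by
        have := (hψ.contDiff_one.differentiable (by simp) (w + x)).hasFDerivAt
        have h2 := this.comp x ((hasFDerivAt_id x).const_add w)
        rw [ContinuousLinearMap.comp_id] at h2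
        exact h2
      have e : (fun x => K (toCyl w) * ψ (toCyl w + toCyl x)) =
          fun x => K (toCyl w) * (ψ ∘ toCyl) (w + x) := by
        ext x; simp [toCyl_add]
      rw [e]
      have h1 := hd.const_mul (K (toCyl w))
      have hdx := hψ.contDiff_one.differentiable (by simp) (w + x)
      have hF : F' x (toCyl w) = K (toCyl w) • fderiv ℝ (ψ ∘ toCyl) (w + x) := by
        ext
        · simp [F', ← toCyl_add, partial₁_toCyl hdx]
        · simp [F', ← toCyl_add, partial₂_toCyl hdx]
      rw [hF]
      exact h1
  have e : ∫ z, F' y z = conv K (partial₁ ψ) (toCyl y) • ContinuousLinearMap.fst ℝ ℝ ℝ +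
        conv K (partial₂ ψ) (toCyl y) • ContinuousLinearMap.snd ℝ ℝ ℝ := by
    rw [integral_add (i₁.smul_const _) (i₂.smul_const _), integral_smul_const, integral_smul_const]
    rfl
  rw [← e]
  exact key

theorem continuous_conv {K ψ : Cyl → ℝ} (hK : LocInt K) (hψ : IsTest ψ) : Continuous (conv K ψ) :=
  continuous_of_comp_toCyl
    (continuous_iff_continuousAt.2 fun y => (hasFDerivAt_conv hK hψ y).continuousAt)

theorem contDiff_conv {K ψ : Cyl → ℝ} (hK : LocInt K) (hψ : IsTest ψ) :
    ContDiff ℝ 1 (conv K ψ ∘ toCyl) := by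
  rw [contDiff_one_iff_hasFDerivAt]
  refine ⟨_, ?_, hasFDerivAt_conv hK hψ⟩
  exact (((continuous_conv hK hψ.partial₁).comp continuous_toCyl).smul continuous_const).add
    (((continuous_conv hK hψ.partial₂).comp continuous_toCyl).smul continuous_const)

theorem partial₁_conv {K ψ : Cyl → ℝ} (hK : LocInt K) (hψ : IsTest ψ) (x : Cyl) :
    partial₁ (conv K ψ) x = conv K (partial₁ ψ) x := by
  obtain ⟨y, rfl⟩ := toCyl_surjective x
  have h := hasFDerivAt_conv hK hψ y
  rw [partial₁_toCyl h.differentiableAt, h.fderiv]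
  simp

theorem partial₂_conv {K ψ : Cyl → ℝ} (hK : LocInt K) (hψ : IsTest ψ) (x : Cyl) :
    partial₂ (conv K ψ) x = conv K (partial₂ ψ) x := by
  obtain ⟨y, rfl⟩ := toCyl_surjective x
  have h := hasFDerivAt_conv hK hψ y
  rw [partial₂_toCyl h.differentiableAt, h.fderiv]
  simp

/-! ### The fundamental solution -/

theorem laplace_comp_toCyl {φ : Cyl → ℝ} (hφ : IsTest φ) (y : ℝ × ℝ) :
    partial₁ (partial₁ φ) (toCyl y) + partial₂ (partial₂ φ) (toCyl y) =
      laplace (φ ∘ toCyl) y := by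
  rw [laplace, ← partial₁_comp_toCyl hφ.contDiff_one, ← partial₂_comp_toCyl hφ.contDiff_one,
    partial₁_toCyl (hφ.partial₁.contDiff_one.differentiable (by simp) y),
    partial₂_toCyl (hφ.partial₂.contDiff_one.differentiable (by simp) y)]

/-- Reflection of the plane in the horizontal axis. -/
def reflect : ℝ × ℝ ≃ₜ ℝ × ℝ := (Homeomorph.refl ℝ).prodCongr (Homeomorph.neg ℝ)

theorem reflect_apply (y : ℝ × ℝ) : reflect y = (y.1, -y.2) := rfl

theorem measurePreserving_reflect : MeasurePreserving reflect volume volume :=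
  (MeasurePreserving.id (volume : Measure ℝ)).prod (Measure.measurePreserving_neg volume)

theorem contDiff_reflect {n : WithTop ℕ∞} : ContDiff ℝ n reflect :=
  contDiff_fst.prodMk contDiff_snd.neg

theorem fderiv_comp_reflect {f : ℝ × ℝ → ℝ} (hf : Differentiable ℝ f) (y v : ℝ × ℝ) :
    fderiv ℝ (f ∘ reflect) y v = fderiv ℝ f (reflect y) (v.1, -v.2) := by
  have h : HasFDerivAt reflect
      ((ContinuousLinearMap.fst ℝ ℝ ℝ).prod (-ContinuousLinearMap.snd ℝ ℝ ℝ)) y :=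
    hasFDerivAt_fst.prodMk hasFDerivAt_snd.neg
  rw [((hf _).hasFDerivAt.comp y h).fderiv]
  rfl

theorem laplace_comp_reflect {f : ℝ × ℝ → ℝ} (hf : ContDiff ℝ ∞ f) (y : ℝ × ℝ) :
    laplace (f ∘ reflect) y = laplace f (reflect y) := by
  have d0 : Differentiable ℝ f := hf.differentiable (by simp)
  have d1 : ∀ v, Differentiable ℝ fun y => fderiv ℝ f y v := fun v =>
    (contDiff_fderiv_apply hf v).differentiable (by simp)
  have e1 : (fun y => fderiv ℝ (f ∘ reflect) y (1, 0)) =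
      (fun y => fderiv ℝ f y (1, 0)) ∘ reflect := by
    ext y; rw [fderiv_comp_reflect d0]; simp
  have e2 : (fun y => fderiv ℝ (f ∘ reflect) y (0, 1)) =
      (fun y => fderiv ℝ f y (0, -1)) ∘ reflect := by
    ext y; rw [fderiv_comp_reflect d0]; simp
  have e3 : (fun y => fderiv ℝ f y (0, -1)) = fun y => -fderiv ℝ f y (0, 1) := by
    ext y
    have : ((0, -1) : ℝ × ℝ) = -(0, 1) := by simp
    rw [this, map_neg]
  have this : ((0, -1) : ℝ × ℝ) = -(0, 1) := by simp
  have e4 : fderiv ℝ (fun y => fderiv ℝ f y (0, -1)) (reflect y) (0, -1) =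
      fderiv ℝ (fun y => fderiv ℝ f y (0, 1)) (reflect y) (0, 1) := by
    have e5 : fderiv ℝ (fun y => -fderiv ℝ f y (0, 1)) (reflect y) =
        -fderiv ℝ (fun y => fderiv ℝ f y (0, 1)) (reflect y) := fderiv_fun_neg
    rw [e3, e5, this, map_neg]
    exact neg_neg _
  rw [laplace, e1, e2, fderiv_comp_reflect (d1 _), fderiv_comp_reflect (d1 _), laplace, ← e4]
  simp

theorem ell_reflect (y : ℝ × ℝ) : ell (reflect y) = ell y := by
  simp [ell, rhoSq, reflect_apply, Real.sinh_neg]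

theorem setIntegral_slab_eq {k : ℝ × ℝ → ℝ} (hk : IntegrableOn k (slab (-1 / 2))) :
    ∫ y in slab (-1 / 2), k y =
      (∫ y in upperSlab, k y) + ∫ y in upperSlab, k (reflect y) := by
  have hs : slab (-1 / 2) = Set.Ioc (-1 / 2 : ℝ) (1 / 2) ×ˢ Set.Iic 0 ∪ upperSlab := by
    rw [upperSlab, ← Set.prod_union, Set.Iic_union_Ioi, slab]; norm_num
  have hd : Disjoint (Set.Ioc (-1 / 2 : ℝ) (1 / 2) ×ˢ Set.Iic (0 : ℝ)) upperSlab :=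
    Set.disjoint_prod.2 (.inr (Set.Iic_disjoint_Ioi le_rfl))
  rw [hs] at hk ⊢
  rw [setIntegral_union hd measurableSet_upperSlab (hk.mono_set Set.subset_union_left)
    (hk.mono_set Set.subset_union_right), add_comm,
    ← measurePreserving_reflect.setIntegral_preimage_emb reflect.measurableEmbedding k
      (Set.Ioc (-1 / 2 : ℝ) (1 / 2) ×ˢ Set.Iic (0 : ℝ))]
  have : reflect ⁻¹' (Set.Ioc (-1 / 2 : ℝ) (1 / 2) ×ˢ Set.Iic 0) =
      Set.Ioc (-1 / 2 : ℝ) (1 / 2) ×ˢ Set.Ici 0 := by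
    ext y; simp [reflect_apply]
  have hae : (Set.Ioc (-1 / 2 : ℝ) (1 / 2) ×ˢ Set.Ici (0 : ℝ)) =ᵐ[volume] upperSlab :=
    Measure.set_prod_ae_eq (ae_eq_refl _) Ioi_ae_eq_Ici.symm
  rw [this, Measure.restrict_congr_set hae]

/-- The upper half contributes π φ(0), and so does the lower half after reflection. The remaining
boundary terms contain ∂₂φ on the axis, whose sign the reflection reverses, and they cancel. -/
theorem integral_logRho_mul_laplacian {φ : Cyl → ℝ} (hφ : IsTest φ) :
    ∫ z, logRho z * (partial₁ (partial₁ φ) z + partial₂ (partial₂ φ) z) =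
      2 * Real.pi * φ 0 := by
  set f := φ ∘ toCyl with hf
  have hfs : ContDiff ℝ ∞ f := hφ.1
  have hcont : Continuous fun z => partial₁ (partial₁ φ) z + partial₂ (partial₂ φ) z :=
    hφ.partial₁.partial₁.continuous.add hφ.partial₂.partial₂.continuous
  have hint := locInt_logRho.integrable_mul hcont
    (hφ.partial₁.partial₁.2.add hφ.partial₂.partial₂.2)
  have e : ∀ y, logRho (toCyl y) * (partial₁ (partial₁ φ) (toCyl y) +
      partial₂ (partial₂ φ) (toCyl y)) = ell y * laplace f y := fun y => by
    rw [laplace_comp_toCyl hφ, logRho_toCyl]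
  have hk : IntegrableOn (fun y => ell y * laplace f y) (slab (-1 / 2)) := by
    have := (measurePreserving_toCyl (-1 / 2)).integrable_comp hint.aestronglyMeasurable
    simp only [Function.comp_def, e] at this
    exact this.2 hint
  rw [integral_cyl_eq_slab (-1 / 2) hint.aestronglyMeasurable]
  simp only [e]
  rw [setIntegral_slab_eq hk]
  obtain ⟨R, hR0, hR⟩ := exists_height_bound hφ.2
  have hv : ∀ y : ℝ × ℝ, R + 1 ≤ |y.2| → f y = 0 := fun y hy => by
    by_contra h
    have : |y.2| ≤ R := hR (toCyl y) h
    linarith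
  have hper : ∀ y, f (y + (1, 0)) = f y := fun y => by
    have := toCyl_add_int y 1
    rw [Int.cast_one] at this
    simp only [hf, Function.comp_apply, this]
  have hsub : upperSlab ⊆ slab (-1 / 2) := by
    rintro y ⟨h1, -⟩
    exact ⟨by convert h1 using 1; norm_num, trivial⟩
  have u := integral_upperSlab_ell_mul_laplace hfs hper (R := R + 1) (by linarith)
    (fun y hy => hv y (hy.trans (le_abs_self _))) (hk.mono_set hsub)
  have hfr : ContDiff ℝ ∞ (f ∘ reflect) := hfs.comp contDiff_reflect
  have er : ∀ y, ell (reflect y) * laplace f (reflect y) = ell y * laplace (f ∘ reflect) y :=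
    fun y => by rw [ell_reflect, laplace_comp_reflect hfs]
  have hkr : IntegrableOn (fun y => ell y * laplace (f ∘ reflect) y) (slab (-1 / 2)) := by
    simp only [← er]
    have h := (measurePreserving_reflect.integrableOn_comp_preimage reflect.measurableEmbedding
      (f := fun y => ell y * laplace f y) (s := slab (-1 / 2))).2 hk
    have hs : reflect ⁻¹' slab (-1 / 2) = slab (-1 / 2) := by
      ext y; simp [slab, reflect_apply]
    rw [hs] at h
    exact h
  have l := integral_upperSlab_ell_mul_laplace hfr (fun y => by
      have := hper (reflect y)
      simp only [Function.comp_apply, reflect_apply, Prod.fst_add, Prod.snd_add, Prod.mk_add_mk,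
        add_zero] at this ⊢
      exact this) (R := R + 1) (by linarith)
    (fun y hy => hv (reflect y) (by
      rw [reflect_apply, abs_neg]; exact hy.trans (le_abs_self _))) (hkr.mono_set hsub)
  simp only [er]
  rw [u, l]
  have h0 : (f ∘ reflect) 0 = f 0 := by simp [reflect_apply, ← Prod.mk_zero_zero]
  have h1 : ∀ s : ℝ, fderiv ℝ (f ∘ reflect) (s, 0) (0, 1) = -fderiv ℝ f (s, 0) (0, 1) := by
    intro s
    have : ((0, -1) : ℝ × ℝ) = -(0, 1) := by simp
    rw [fderiv_comp_reflect (hfs.differentiable (by simp)), this, map_neg]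
    simp [reflect_apply]
  have h2 : f 0 = φ 0 := by simp [hf]
  simp only [h1, mul_neg, intervalIntegral.integral_neg]
  rw [h0, h2]
  ring

/-- `log ρ * Δ φ = 2 π φ` on the strip. -/
theorem conv_logRho_laplacian {φ : Cyl → ℝ} (hφ : IsTest φ) (x : Cyl) :
    conv logRho (partial₁ (partial₁ φ)) x + conv logRho (partial₂ (partial₂ φ)) x =
      2 * Real.pi * φ x := by
  obtain ⟨y, rfl⟩ := toCyl_surjective x
  have h := integral_logRho_mul_laplacian (hφ.comp_add y)
  have i₁ := locInt_logRho.integrable_mul (hφ.partial₁.partial₁.comp_add y).continuous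
    (hφ.partial₁.partial₁.comp_add y).2
  have i₂ := locInt_logRho.integrable_mul (hφ.partial₂.partial₂.comp_add y).continuous
    (hφ.partial₂.partial₂.comp_add y).2
  rw [zero_add] at h
  rw [conv, conv, ← integral_add i₁ i₂, ← h]
  congr 1 with z
  have e1 : partial₁ (fun x => φ (x + toCyl y)) = fun x => partial₁ φ (x + toCyl y) :=
    funext fun x => partial₁_comp_add φ _ x
  have e2 : partial₂ (fun x => φ (x + toCyl y)) = fun x => partial₂ φ (x + toCyl y) :=
    funext fun x => partial₂_comp_add φ _ x
  rw [e1, e2, partial₁_comp_add, partial₂_comp_add]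
  ring

/-! ### Integrability of the kernel along the boundary -/

theorem lintegral_Icc_log_lt_top (H : ℝ) : ∫⁻ u in Set.Icc (-H) H, ‖Real.log u‖ₑ < ⊤ := by
  rcases le_total 0 H with hH | hH
  · have h : IntegrableOn Real.log (Set.Ioc (-H) H) :=
      (intervalIntegrable_iff_integrableOn_Ioc_of_le (by linarith)).1
        intervalIntegral.intervalIntegrable_log'
    rw [← restrict_Ioc_eq_restrict_Icc]
    exact h.2
  · have : volume (Set.Icc (-H) H) = 0 := by simp [hH]
    rw [Measure.restrict_eq_zero.2 this]
    simp

theorem enorm_le_add_of_abs_le {a b c : ℝ} (hb : 0 ≤ b) (h : |a| ≤ b + |c|) :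
    ‖a‖ₑ ≤ ENNReal.ofReal b + ‖c‖ₑ := by
  rw [← ofReal_norm, ← ofReal_norm, ← ENNReal.ofReal_add hb (norm_nonneg _)]
  exact ENNReal.ofReal_le_ofReal h

section boundary

variable {Ω : Set Cyl} {J : ℕ} {γ : Fin J → ℝ → ℝ × ℝ}

namespace GraphChart

variable {p : ℝ × ℝ} (ch : GraphChart Ω p)

/-- Over either axis the kernel is at most a constant plus the logarithm of a one-dimensional
distance. Translation invariance on the circle or the line makes the bound independent of the
position of `x`, even when `x` lies on the boundary. -/
theorem exists_lintegral_base_le (R : ℝ) : ∃ C : ENNReal, C ≠ ⊤ ∧ ∀ x : Cyl, |x.2| ≤ R →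
    ∫⁻ s in ch.base, ‖logRho (x - toCyl (ch.c s))‖ₑ ≤ C := by
  -- A bound for the height difference between `x` and the graph, which stays within `δ < 1` of the
  -- height of `p`.
  set H := |R| + |p.2| + 1 with hH
  have hH0 : 0 ≤ Real.pi * H := by positivity
  have hbase1 : ∀ s ∈ ch.base, |(ch.c s).1 - p.1| < ch.δ := fun s hs =>
    (norm_fst_le (ch.c s - p)).trans_lt (mem_ball_iff_norm.1 hs)
  have hbase2 : ∀ s ∈ ch.base, |(ch.c s).2 - p.2| < ch.δ := fun s hs =>
    (norm_snd_le (ch.c s - p)).trans_lt (mem_ball_iff_norm.1 hs)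
  have hδ := ch.δ_lt
  have hheight : ∀ x : Cyl, |x.2| ≤ R → ∀ s ∈ ch.base, |x.2 - (ch.c s).2| ≤ H := by
    intro x hx s hs
    have h1 := hbase2 s hs
    have h2 := abs_le.1 (hx.trans (le_abs_self R))
    have h3 := abs_le.1 (le_refl |p.2|)
    rw [abs_lt] at h1
    rw [abs_le]
    constructor <;> linarith
  have hbound : ∀ x : Cyl, |x.2| ≤ R → ∀ s ∈ ch.base,
      Real.pi * |x.2 - (ch.c s).2| ≤ Real.pi * H := fun x hx s hs =>
    mul_le_mul_of_nonneg_left (hheight x hx s hs) Real.pi_pos.le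
  rcases ch.π_eq with hπ | hπ
  · have hc : ∀ s, (ch.c s).1 = s := fun s => by simpa [hπ] using ch.π_c s
    have hsub : ch.base ⊆ Set.Ioc (p.1 - 1 / 2) (p.1 - 1 / 2 + 1) := by
      intro s hs
      have := abs_lt.1 (hbase1 s hs)
      rw [hc] at this
      constructor <;> linarith
    refine ⟨ENNReal.ofReal (Real.pi * H) + ∫⁻ t : AddCircle (1 : ℝ), ‖Real.log ‖t‖‖ₑ,
      (ENNReal.add_lt_top.2 ⟨ENNReal.ofReal_lt_top, lintegral_log_norm_lt_top⟩).ne,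
      fun x hx => ?_⟩
    have hne : ∀ᵐ s : ℝ ∂(volume.restrict (Set.Ioc (p.1 - 1 / 2) (p.1 - 1 / 2 + 1))),
        (s : AddCircle (1 : ℝ)) ≠ x.1 :=
      (AddCircle.measurePreserving_mk (1 : ℝ) (p.1 - 1 / 2)).quasiMeasurePreserving.ae
        (ae_circle_ne x.1)
    calc ∫⁻ s in ch.base, ‖logRho (x - toCyl (ch.c s))‖ₑ
        ≤ ∫⁻ s in ch.base, (ENNReal.ofReal (Real.pi * H) +
            ‖Real.log ‖x.1 - (s : AddCircle (1 : ℝ))‖‖ₑ) := by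
          refine lintegral_mono_ae ?_
          filter_upwards [ae_restrict_of_ae_restrict_of_subset hsub hne,
            ae_restrict_mem ch.measurableSet_base] with s h1 h2
          refine enorm_le_add_of_abs_le hH0 ?_
          have h3 : (x - toCyl (ch.c s)).1 = x.1 - (s : AddCircle (1 : ℝ)) := by
            simp [toCyl, hc]
          have := abs_logRho_le_fst (z := x - toCyl (ch.c s)) (by
            rw [h3]; exact sub_ne_zero.2 h1.symm)
          rw [h3] at this
          exact this.trans (add_le_add (hbound x hx s h2) le_rfl)
      _ ≤ ∫⁻ s in Set.Ioc (p.1 - 1 / 2) (p.1 - 1 / 2 + 1), (ENNReal.ofReal (Real.pi * H) +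
            ‖Real.log ‖x.1 - (s : AddCircle (1 : ℝ))‖‖ₑ) := lintegral_mono_set hsub
      _ = ∫⁻ t : AddCircle (1 : ℝ), (ENNReal.ofReal (Real.pi * H) + ‖Real.log ‖x.1 - t‖‖ₑ) :=
          AddCircle.lintegral_preimage (1 : ℝ) (p.1 - 1 / 2) fun t : AddCircle (1 : ℝ) =>
            ENNReal.ofReal (Real.pi * H) + ‖Real.log ‖x.1 - t‖‖ₑ
      _ = ∫⁻ t : AddCircle (1 : ℝ), (ENNReal.ofReal (Real.pi * H) + ‖Real.log ‖t‖‖ₑ) :=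
          lintegral_sub_left_eq_self
            (fun t : AddCircle (1 : ℝ) => ENNReal.ofReal (Real.pi * H) + ‖Real.log ‖t‖‖ₑ) x.1
      _ = _ := by
          rw [lintegral_add_left measurable_const, lintegral_const, AddCircle.measure_univ]
          simp
  · have hc : ∀ s, (ch.c s).2 = s := fun s => by simpa [hπ] using ch.π_c s
    let g : ℝ → ENNReal := (Set.Icc (-H) H).indicator fun u =>
      ENNReal.ofReal (Real.pi * H) + ‖Real.log u‖ₑ
    refine ⟨∫⁻ u, g u, ?_, fun x hx => ?_⟩
    · rw [lintegral_indicator measurableSet_Icc, lintegral_add_left measurable_const,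
        lintegral_const]
      exact (ENNReal.add_lt_top.2 ⟨ENNReal.mul_lt_top ENNReal.ofReal_lt_top
        (by simp), lintegral_Icc_log_lt_top H⟩).ne
    · rw [← lintegral_sub_left_eq_self g x.2, ← lintegral_indicator ch.measurableSet_base]
      refine lintegral_mono_ae ?_
      have hne : ∀ᵐ s : ℝ, s ≠ x.2 := by simp [ae_iff, measure_singleton]
      filter_upwards [hne] with s h1
      by_cases hs : s ∈ ch.base
      · have h4 := hheight x hx s hs
        have h5 := hbound x hx s hs
        rw [hc] at h4 h5
        have hmem : x.2 - s ∈ Set.Icc (-H) H := abs_le.1 h4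
        simp only [g]
        rw [Set.indicator_of_mem hs, Set.indicator_of_mem hmem]
        refine enorm_le_add_of_abs_le hH0 ?_
        have h3 : (x - toCyl (ch.c s)).2 = x.2 - s := by simp [toCyl, hc]
        have := abs_logRho_le_snd (z := x - toCyl (ch.c s)) (by
          rw [h3]; exact sub_ne_zero.2 h1.symm)
        rw [h3] at this
        exact this.trans (add_le_add h5 le_rfl)
      · rw [Set.indicator_of_notMem hs]
        exact zero_le

theorem exists_sum_lintegral_params_le (hγ : IsBoundaryParam Ω γ) (R : ℝ) :
    ∃ C : ENNReal, C ≠ ⊤ ∧ ∀ x : Cyl, |x.2| ≤ R →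
      ∑ j, ∫⁻ α in ch.params (γ j), ‖logRho (x - toCyl (γ j α))‖ₑ * ‖tangent (γ j) α‖ₑ ≤ C := by
  obtain ⟨C, hC, hCx⟩ := ch.exists_lintegral_base_le R
  have cd := ch.contDiff.continuous_deriv (by simp)
  obtain ⟨M, hM⟩ := ch.isBounded_base.isCompact_closure.exists_bound_of_continuousOn
    cd.continuousOn
  refine ⟨ENNReal.ofReal M * C, ENNReal.mul_ne_top ENNReal.ofReal_ne_top hC, fun x hx => ?_⟩
  have e : ∀ j, ∫⁻ α in ch.params (γ j),
      ‖logRho (x - toCyl (γ j α))‖ₑ * ‖tangent (γ j) α‖ₑ =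
      ∫⁻ α in ch.params (γ j), ENNReal.ofReal |ch.π (tangent (γ j) α)| *
        (‖deriv ch.c (ch.param (γ j) α)‖ₑ *
          ‖logRho (x - toCyl (ch.c (ch.param (γ j) α)))‖ₑ) := fun j => by
    refine setLIntegral_congr_fun (ch.measurableSet_params hγ j) fun α hα => ?_
    have hα' : α ∈ paramI := Set.Ico_subset_Icc_self hα.1
    rw [ch.toCyl_c_param hγ j hα' hα.2]
    conv_lhs => rw [ch.tangent_eq hγ j hα' hα.2, enorm_smul, ← ofReal_norm (ch.π _)]
    rw [Real.norm_eq_abs]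
    ring
  rw [Finset.sum_congr rfl fun j _ => e j, ch.sum_lintegral_params hγ fun s =>
    ‖deriv ch.c s‖ₑ * ‖logRho (x - toCyl (ch.c s))‖ₑ]
  calc ∫⁻ s in ch.base, ‖deriv ch.c s‖ₑ * ‖logRho (x - toCyl (ch.c s))‖ₑ
      ≤ ∫⁻ s in ch.base, ENNReal.ofReal M * ‖logRho (x - toCyl (ch.c s))‖ₑ := by
        refine setLIntegral_mono_ae' ch.measurableSet_base (.of_forall fun s hs => ?_)
        refine mul_le_mul_left ?_ _
        rw [← ofReal_norm]
        exact ENNReal.ofReal_le_ofReal (hM s (subset_closure hs))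
    _ = ENNReal.ofReal M * ∫⁻ s in ch.base, ‖logRho (x - toCyl (ch.c s))‖ₑ :=
        lintegral_const_mul' _ _ ENNReal.ofReal_ne_top
    _ ≤ _ := mul_le_mul_right (hCx x hx) _

end GraphChart

/-- The kernel is integrable along the boundary, locally uniformly. -/
theorem exists_sum_lintegral_le {ε : ℝ≥0} (hΩ : IsC1HolderRegion ε Ω) (hγ : IsBoundaryParam Ω γ)
    (R : ℝ) : ∃ C : ENNReal, C ≠ ⊤ ∧ ∀ x : Cyl, |x.2| ≤ R →
      ∑ j, ∫⁻ α in Set.Ico 0 (2 * Real.pi),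
        ‖logRho (x - toCyl (γ j α))‖ₑ * ‖tangent (γ j) α‖ₑ ≤ C := by
  have hcomp : IsCompact (frontier Ω) :=
    (isCompact_closure_of_isBounded hΩ.isBounded).of_isClosed_subset isClosed_frontier
      frontier_subset_closure
  -- The lower integral is monotone and subadditive in its domain, so the induction over pieces `S`
  -- of the boundary needs no measurability of `S`.
  obtain ⟨C, hC, hCx⟩ := hcomp.induction_on
    (p := fun S => ∃ C : ENNReal, C ≠ ⊤ ∧ ∀ x : Cyl, |x.2| ≤ R →
      ∑ j, ∫⁻ α in {α | α ∈ Set.Ico 0 (2 * Real.pi) ∧ toCyl (γ j α) ∈ S},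
        ‖logRho (x - toCyl (γ j α))‖ₑ * ‖tangent (γ j) α‖ₑ ≤ C)
    ⟨0, by simp, fun x _ => by simp⟩
    (fun s t hst ⟨C, hC, h⟩ => ⟨C, hC, fun x hx => (Finset.sum_le_sum fun j _ =>
      lintegral_mono_set (Set.ofPred_subset_ofPred.2 fun α hα => ⟨hα.1, hst hα.2⟩)).trans (h x hx)⟩)
    (fun s t ⟨C, hC, h⟩ ⟨D, hD, k⟩ => ⟨C + D, ENNReal.add_ne_top.2 ⟨hC, hD⟩, fun x hx => by
      refine le_trans ?_ (add_le_add (h x hx) (k x hx))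
      rw [← Finset.sum_add_distrib]
      refine Finset.sum_le_sum fun j _ => ?_
      refine le_trans (lintegral_mono_set ?_) (lintegral_union_le _ _ _)
      rintro α ⟨h1, h2 | h2⟩
      exacts [.inl ⟨h1, h2⟩, .inr ⟨h1, h2⟩]⟩)
    (fun y hy => by
      obtain ⟨p, rfl⟩ := toCyl_surjective y
      obtain ⟨ch⟩ := hΩ.nonempty_graphChart hy
      exact ⟨ch.nbhd, mem_nhdsWithin_of_mem_nhds (ch.isOpen_nbhd.mem_nhds ch.mem_nbhd),
        ch.exists_sum_lintegral_params_le hγ R⟩)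
  refine ⟨C, hC, fun x hx => le_trans (Finset.sum_le_sum fun j _ => lintegral_mono_set ?_)
    (hCx x hx)⟩
  exact fun α hα => ⟨hα, hγ.mem_frontier j (Set.Ico_subset_Icc_self hα)⟩

/-- A continuous extension of a function on the parameter interval. -/
def extend {E : Type*} (g : ℝ → E) (α : ℝ) : E :=
  g (Set.projIcc 0 (2 * Real.pi) two_pi_pos'.le α)

theorem extend_eq {E : Type*} (g : ℝ → E) {α : ℝ} (hα : α ∈ paramI) : extend g α = g α := by
  have hα' : α ∈ Set.Icc 0 (2 * Real.pi) := hα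
  rw [extend, Set.projIcc_of_mem two_pi_pos'.le hα']

theorem continuous_extend {E : Type*} [TopologicalSpace E] {g : ℝ → E}
    (hg : ContinuousOn g paramI) : Continuous (extend g) :=
  (continuousOn_iff_continuous_domRestrict.1 hg).comp continuous_projIcc

/-- The parameter space of the boundary. -/
def paramMeasure : Measure ℝ := volume.restrict (Set.Ico 0 (2 * Real.pi))

instance : IsFiniteMeasure paramMeasure :=
  inferInstanceAs (IsFiniteMeasure (volume.restrict (Set.Ico 0 (2 * Real.pi))))

theorem ae_paramMeasure : ∀ᵐ α ∂paramMeasure, α ∈ paramI := by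
  filter_upwards [ae_restrict_mem measurableSet_Ico] with α hα
  exact Set.Ico_subset_Icc_self hα

theorem intervalIntegral_eq {E : Type*} [NormedAddCommGroup E] [NormedSpace ℝ E] (f : ℝ → E) :
    ∫ α in (0 : ℝ)..(2 * Real.pi), f α = ∫ α, f α ∂paramMeasure := by
  rw [intervalIntegral.integral_of_le two_pi_pos'.le, ← integral_Ico_eq_integral_Ioc]
  rfl

theorem intervalIntegrable_iff_paramMeasure {E : Type*} [NormedAddCommGroup E] {f : ℝ → E} :
    IntervalIntegrable f volume 0 (2 * Real.pi) ↔ Integrable f paramMeasure := by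
  rw [intervalIntegrable_iff_integrableOn_Ico_of_le two_pi_pos'.le]
  rfl

/-- Nothing is known of the curves outside the parameter interval. Their continuous extensions
furnish a jointly measurable representative. -/
theorem aestronglyMeasurable_integrand_prod (hγ : IsBoundaryParam Ω γ) (j : Fin J)
    (μ : Measure Cyl) [SFinite μ] :
    AEStronglyMeasurable (fun q : Cyl × ℝ => integrand (γ j) q.1 q.2) (μ.prod paramMeasure) := by
  have h1 : Measurable fun q : Cyl × ℝ =>
      logRho (q.1 - toCyl (extend (γ j) q.2)) • extend (tangent (γ j)) q.2 :=
    (measurable_logRho.comp (continuous_fst.sub (continuous_toCyl.comp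
      ((continuous_extend (hγ.continuousOn j)).comp continuous_snd))).measurable).smul
      ((continuous_extend (hγ.continuousOn_tangent j)).comp continuous_snd).measurable
  refine h1.aestronglyMeasurable.congr ?_
  have h2 : ∀ᵐ q : Cyl × ℝ ∂(μ.prod paramMeasure), q.2 ∈ paramI :=
    Measure.quasiMeasurePreserving_snd.ae ae_paramMeasure
  filter_upwards [h2] with q hq
  simp only [extend_eq _ hq]
  rfl

theorem integrable_integrand {ε : ℝ≥0} (hΩ : IsC1HolderRegion ε Ω) (hγ : IsBoundaryParam Ω γ)
    (j : Fin J) (x : Cyl) : Integrable (integrand (γ j) x) paramMeasure := by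
  have h1 : Measurable fun α =>
      logRho (x - toCyl (extend (γ j) α)) • extend (tangent (γ j)) α :=
    (measurable_logRho.comp (continuous_const.sub (continuous_toCyl.comp
      (continuous_extend (hγ.continuousOn j)))).measurable).smul
      (continuous_extend (hγ.continuousOn_tangent j)).measurable
  refine ⟨h1.aestronglyMeasurable.congr ?_, ?_⟩
  · filter_upwards [ae_paramMeasure] with α hα
    simp only [extend_eq _ hα]
    rfl
  · obtain ⟨C, hC, h⟩ := exists_sum_lintegral_le hΩ hγ |x.2|
    refine lt_of_le_of_lt ?_ hC.lt_top
    refine le_trans ?_ (h x le_rfl)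
    have h2 : ∫⁻ α, ‖integrand (γ j) x α‖ₑ ∂paramMeasure =
        ∫⁻ α in Set.Ico 0 (2 * Real.pi),
          ‖logRho (x - toCyl (γ j α))‖ₑ * ‖tangent (γ j) α‖ₑ := by
      simp only [integrand, enorm_smul]
      rfl
    rw [h2]
    exact Finset.single_le_sum (f := fun j => ∫⁻ α in Set.Ico 0 (2 * Real.pi),
      ‖logRho (x - toCyl (γ j α))‖ₑ * ‖tangent (γ j) α‖ₑ) (fun _ _ => zero_le)
      (Finset.mem_univ j)

end boundary

/-! ### The velocity field of a patch -/

section boundary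

variable {Ω : Set Cyl} {J : ℕ} {γ : Fin J → ℝ → ℝ × ℝ}

/-- The sum of the boundary integrals. -/
def boundaryLayer (γ : Fin J → ℝ → ℝ × ℝ) (x : Cyl) : ℝ × ℝ :=
  ∑ j, ∫ α, integrand (γ j) x α ∂paramMeasure

theorem patchVelocity_eq (ω₀ : ℝ) (γ : Fin J → ℝ → ℝ × ℝ) (x : Cyl) :
    patchVelocity ω₀ γ x = (-(ω₀ / (2 * Real.pi))) • boundaryLayer γ x := by
  simp only [patchVelocity, intervalIntegral_eq, boundaryLayer]

theorem aestronglyMeasurable_boundaryLayer (hγ : IsBoundaryParam Ω γ) (μ : Measure Cyl)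
    [SFinite μ] : AEStronglyMeasurable (boundaryLayer γ) μ :=
  Finset.aestronglyMeasurable_fun_sum _ fun j _ =>
    (aestronglyMeasurable_integrand_prod hγ j μ).integral_prod_right'

theorem lintegral_enorm_integrand_le {x : Cyl} {C : ENNReal}
    (h : ∑ j, ∫⁻ α in Set.Ico 0 (2 * Real.pi),
        ‖logRho (x - toCyl (γ j α))‖ₑ * ‖tangent (γ j) α‖ₑ ≤ C) (j : Fin J) :
    ∫⁻ α, ‖integrand (γ j) x α‖ₑ ∂paramMeasure ≤ C := by
  have h2 : ∫⁻ α, ‖integrand (γ j) x α‖ₑ ∂paramMeasure =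
      ∫⁻ α in Set.Ico 0 (2 * Real.pi),
        ‖logRho (x - toCyl (γ j α))‖ₑ * ‖tangent (γ j) α‖ₑ := by
    simp only [integrand, enorm_smul]
    rfl
  rw [h2]
  exact (Finset.single_le_sum (f := fun j => ∫⁻ α in Set.Ico 0 (2 * Real.pi),
    ‖logRho (x - toCyl (γ j α))‖ₑ * ‖tangent (γ j) α‖ₑ) (fun _ _ => zero_le)
    (Finset.mem_univ j)).trans h

/-- The bound along the boundary is uniform on bounded heights, so Tonelli applies. The measure is
left general because the statement serves both for area and for arc length on a horizontal circle.
-/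
theorem integrable_smul_integrand {ε : ℝ≥0} (hΩ : IsC1HolderRegion ε Ω)
    (hγ : IsBoundaryParam Ω γ) {μ : Measure Cyl} [SFinite μ] {ψ : Cyl → ℝ} (hψ : Integrable ψ μ)
    {R : ℝ} (hR : ∀ᵐ x ∂μ, ψ x ≠ 0 → |x.2| ≤ R) (j : Fin J) :
    Integrable (fun q : Cyl × ℝ => ψ q.1 • integrand (γ j) q.1 q.2) (μ.prod paramMeasure) := by
  have hm : AEStronglyMeasurable (fun q : Cyl × ℝ => ψ q.1 • integrand (γ j) q.1 q.2)
      (μ.prod paramMeasure) :=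
    hψ.aestronglyMeasurable.comp_fst.smul (aestronglyMeasurable_integrand_prod hγ j μ)
  refine ⟨hm, ?_⟩
  obtain ⟨C, hC, h⟩ := exists_sum_lintegral_le hΩ hγ R
  rw [HasFiniteIntegral, lintegral_prod _ hm.enorm]
  calc ∫⁻ x, ∫⁻ α, ‖ψ x • integrand (γ j) x α‖ₑ ∂paramMeasure ∂μ
      ≤ ∫⁻ x, ‖ψ x‖ₑ * C ∂μ := by
        refine lintegral_mono_ae ?_
        filter_upwards [hR] with x hx
        simp only [enorm_smul]
        rw [lintegral_const_mul' _ _ enorm_ne_top]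
        by_cases h0 : ψ x = 0
        · simp [h0]
        · gcongr
          exact lintegral_enorm_integrand_le (h x (hx h0)) j
    _ = (∫⁻ x, ‖ψ x‖ₑ ∂μ) * C := lintegral_mul_const' _ _ hC
    _ < ⊤ := ENNReal.mul_lt_top hψ.2 hC.lt_top

theorem integrable_smul_boundaryLayer {ε : ℝ≥0} (hΩ : IsC1HolderRegion ε Ω)
    (hγ : IsBoundaryParam Ω γ) {μ : Measure Cyl} [SFinite μ] {ψ : Cyl → ℝ} (hψ : Integrable ψ μ)
    {R : ℝ} (hR : ∀ᵐ x ∂μ, ψ x ≠ 0 → |x.2| ≤ R) :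
    Integrable (fun x => ψ x • boundaryLayer γ x) μ := by
  have h := integrable_finsetSum Finset.univ fun j _ =>
    (integrable_smul_integrand hΩ hγ hψ hR j).integral_prod_left
  refine h.congr (.of_forall fun x => ?_)
  simp only [boundaryLayer, Finset.smul_sum, ← integral_smul]

theorem integral_smul_boundaryLayer {ε : ℝ≥0} (hΩ : IsC1HolderRegion ε Ω)
    (hγ : IsBoundaryParam Ω γ) {μ : Measure Cyl} [SFinite μ] {ψ : Cyl → ℝ} (hψ : Integrable ψ μ)
    {R : ℝ} (hR : ∀ᵐ x ∂μ, ψ x ≠ 0 → |x.2| ≤ R) :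
    ∫ x, ψ x • boundaryLayer γ x ∂μ =
      ∑ j, ∫ α, (∫ x, ψ x * logRho (x - toCyl (γ j α)) ∂μ) • tangent (γ j) α ∂paramMeasure := by
  have hi := integrable_smul_integrand hΩ hγ hψ hR
  simp only [boundaryLayer, Finset.smul_sum, ← integral_smul]
  rw [integral_finsetSum _ fun j _ => (hi j).integral_prod_left]
  refine Finset.sum_congr rfl fun j _ => ?_
  rw [integral_integral_swap (hi j)]
  refine integral_congr_ae (.of_forall fun α => ?_)
  simp only [integrand, smul_smul]
  exact integral_smul_const _ _

theorem integrable_tangent (hγ : IsBoundaryParam Ω γ) (j : Fin J) {f : ℝ → ℝ}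
    (hf : ContinuousOn f paramI) :
    Integrable (fun α => f α • tangent (γ j) α) paramMeasure := by
  rw [← intervalIntegrable_iff_paramMeasure]
  refine ContinuousOn.intervalIntegrable ?_
  rw [Set.uIcc_of_le two_pi_pos'.le]
  exact hf.smul (hγ.continuousOn_tangent j)

theorem integral_deriv_eq_sub {f f' : ℝ → ℝ} (hf : ∀ α ∈ paramI, HasDerivWithinAt f (f' α) paramI α)
    (hf' : ContinuousOn f' paramI) : ∫ α, f' α ∂paramMeasure = f (2 * Real.pi) - f 0 := by
  rw [← intervalIntegral_eq]
  refine intervalIntegral.integral_eq_sub_of_hasDerivAt_of_le two_pi_pos'.le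
    (fun α hα => (hf α hα).continuousWithinAt) (fun α hα => ?_) ?_
  · exact (hf α (Set.Ioo_subset_Icc_self hα)).hasDerivAt (Icc_mem_nhds hα.1 hα.2)
  · refine ContinuousOn.intervalIntegrable ?_
    rwa [Set.uIcc_of_le two_pi_pos'.le]

theorem continuousOn_toCyl (hγ : IsBoundaryParam Ω γ) (j : Fin J) :
    ContinuousOn (fun α => toCyl (γ j α)) paramI :=
  continuous_toCyl.comp_continuousOn (hγ.continuousOn j)

/-- A gradient has no circulation along the boundary. -/
theorem integral_gradient_eq_zero (hγ : IsBoundaryParam Ω γ) (j : Fin J) {G G₁ G₂ : Cyl → ℝ}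
    (hG : ∀ y, HasFDerivAt (G ∘ toCyl) (G₁ (toCyl y) • ContinuousLinearMap.fst ℝ ℝ ℝ +
        G₂ (toCyl y) • ContinuousLinearMap.snd ℝ ℝ ℝ) y)
    (h₁ : Continuous G₁) (h₂ : Continuous G₂) :
    ∫ α, (G₁ (toCyl (γ j α)) * (tangent (γ j) α).1 + G₂ (toCyl (γ j α)) * (tangent (γ j) α).2)
      ∂paramMeasure = 0 := by
  rw [integral_deriv_eq_sub (f := fun α => G (toCyl (γ j α)))]
  · simp only [hγ.closed j, sub_self]
  · exact fun α hα => (hG (γ j α)).comp_hasDerivWithinAt α (hγ.hasDerivWithinAt j hα)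
  · exact ((h₁.comp_continuousOn (continuousOn_toCyl hγ j)).mul
      (continuous_fst.comp_continuousOn (hγ.continuousOn_tangent j))).add
      ((h₂.comp_continuousOn (continuousOn_toCyl hγ j)).mul
      (continuous_snd.comp_continuousOn (hγ.continuousOn_tangent j)))

/-- Green's theorem for the two constant fields. A single curve that winds around the strip has a
nonzero integral; only the sum over all components vanishes. -/
theorem sum_integral_tangent {ε : ℝ≥0} (hΩ : IsC1HolderRegion ε Ω) (hγ : IsBoundaryParam Ω γ) :
    ∑ j, ∫ α, tangent (γ j) α ∂paramMeasure = 0 := by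
  have hi : ∀ j, Integrable (tangent (γ j)) paramMeasure := fun j => by
    simpa using integrable_tangent hγ j (f := fun _ => 1) continuousOn_const
  have p1 : ∀ (c : ℝ) x, partial₁ (fun _ => c) x = 0 := fun c x => by simp [partial₁]
  have p2 : ∀ (c : ℝ) x, partial₂ (fun _ => c) x = 0 := fun c x => by simp [partial₂]
  have g1 := green_theorem hΩ hγ (F₁ := fun _ => 1) (F₂ := fun _ => 0) contDiff_const contDiff_const
  have g2 := green_theorem hΩ hγ (F₁ := fun _ => 0) (F₂ := fun _ => 1) contDiff_const contDiff_const
  simp only [p1, p2, sub_self, integral_zero, one_mul, zero_mul, add_zero, zero_add,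
    intervalIntegral_eq] at g1 g2
  refine Prod.ext ?_ ?_
  · rw [Prod.fst_sum, Prod.fst_zero, ← g1]
    exact Finset.sum_congr rfl fun j _ => fst_integral (hi j)
  · rw [Prod.snd_sum, Prod.snd_zero, ← g2]
    exact Finset.sum_congr rfl fun j _ => snd_integral (hi j)

theorem exists_height_bound_param (hγ : IsBoundaryParam Ω γ) :
    ∃ R, 0 < R ∧ ∀ j, ∀ α ∈ paramI, |(γ j α).2| ≤ R := by
  have h : ∀ j, ∃ R, ∀ α ∈ paramI, ‖(γ j α).2‖ ≤ R := fun j =>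
    isCompact_Icc.exists_bound_of_continuousOn
      (continuous_snd.comp_continuousOn (hγ.continuousOn j))
  choose R hR using h
  refine ⟨∑ j, |R j| + 1, by positivity, fun j α hα => ?_⟩
  have := Finset.single_le_sum (f := fun j => |R j|) (fun _ _ => abs_nonneg _) (Finset.mem_univ j)
  exact ((hR j α hα).trans (le_abs_self _)).trans (this.trans (by simp))

/-- At bounded heights the kernel is uniformly integrable along the boundary. Above that, π|x₂| may
be subtracted from the kernel because it multiplies `sum_integral_tangent`, and the difference is at
most 2 plus π times the greatest height of the curves. -/
theorem exists_norm_boundaryLayer_le {ε : ℝ≥0} (hΩ : IsC1HolderRegion ε Ω)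
    (hγ : IsBoundaryParam Ω γ) : ∃ B, ∀ x, ‖boundaryLayer γ x‖ ≤ B := by
  obtain ⟨R, hR0, hR⟩ := exists_height_bound_param hγ
  obtain ⟨C, hC, h⟩ := exists_sum_lintegral_le hΩ hγ (R + 1)
  have hi : ∀ j, Integrable (tangent (γ j)) paramMeasure := fun j => by
    simpa using integrable_tangent hγ j (f := fun _ => 1) continuousOn_const
  refine ⟨max (∑ _ : Fin J, C.toReal)
    (∑ j, ∫ α, (2 + Real.pi * R) * ‖tangent (γ j) α‖ ∂paramMeasure), fun x => ?_⟩
  by_cases hx : |x.2| ≤ R + 1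
  · refine le_max_of_le_left ((norm_sum_le _ _).trans (Finset.sum_le_sum fun j _ => ?_))
    refine (norm_integral_le_lintegral_norm _).trans ?_
    refine ENNReal.toReal_mono hC ?_
    simp only [ofReal_norm]
    exact lintegral_enorm_integrand_le (h x hx) j
  · rw [not_le] at hx
    have e : boundaryLayer γ x = ∑ j, ∫ α,
        (logRho (x - toCyl (γ j α)) - Real.pi * |x.2|) • tangent (γ j) α ∂paramMeasure := by
      have : ∀ j, ∫ α, (logRho (x - toCyl (γ j α)) - Real.pi * |x.2|) • tangent (γ j) α
          ∂paramMeasure = (∫ α, integrand (γ j) x α ∂paramMeasure) -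
            (Real.pi * |x.2|) • ∫ α, tangent (γ j) α ∂paramMeasure := fun j => by
        rw [← integral_smul]
        refine Eq.trans ?_ (integral_sub (integrable_integrand hΩ hγ j x)
          (integrable_tangent hγ j (f := fun _ => Real.pi * |x.2|) continuousOn_const))
        simp only [sub_smul]
        rfl
      rw [Finset.sum_congr rfl fun j _ => this j, Finset.sum_sub_distrib, ← Finset.smul_sum,
        sum_integral_tangent hΩ hγ, smul_zero, sub_zero]
      rfl
    rw [e]
    refine le_max_of_le_right ((norm_sum_le _ _).trans (Finset.sum_le_sum fun j _ => ?_))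
    refine norm_integral_le_of_norm_le ((hi j).norm.const_mul _) ?_
    filter_upwards [ae_paramMeasure] with α hα
    rw [norm_smul]
    refine mul_le_mul_of_nonneg_right ?_ (norm_nonneg _)
    have h2 : (x - toCyl (γ j α)).2 = x.2 - (γ j α).2 := rfl
    have h3 := hR j α hα
    have h4 : |x.2| - |(γ j α).2| ≤ |x.2 - (γ j α).2| := abs_sub_abs_le_abs_sub _ _
    have h5 := abs_logRho_sub_le (z := x - toCyl (γ j α)) (by rw [h2]; linarith)
    rw [h2] at h5
    have h6 := abs_le.1 (abs_abs_sub_abs_le_abs_sub (x.2 - (γ j α).2) x.2)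
    rw [sub_sub_cancel_left, abs_neg] at h6
    rw [abs_le] at h5
    have hπ := Real.pi_pos
    rw [Real.norm_eq_abs, abs_le]
    constructor <;> nlinarith

instance : (volume : Measure Cyl).IsAddRightInvariant :=
  inferInstanceAs
    ((volume : Measure (AddCircle (1 : ℝ))).prod (volume : Measure ℝ)).IsAddRightInvariant

theorem integral_mul_logRho_sub (ψ : Cyl → ℝ) (c : Cyl) :
    ∫ x, ψ x * logRho (x - c) = conv logRho ψ c := by
  rw [conv, ← integral_sub_right_eq_self (fun z => logRho z * ψ (z + c)) c]
  simp only [sub_add_cancel, mul_comm]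

theorem integral_test_smul_boundaryLayer {ε : ℝ≥0} (hΩ : IsC1HolderRegion ε Ω)
    (hγ : IsBoundaryParam Ω γ) {ψ : Cyl → ℝ} (hψ : IsTest ψ) :
    Integrable (fun x => ψ x • boundaryLayer γ x) ∧ ∫ x, ψ x • boundaryLayer γ x =
      ∑ j, ∫ α, conv logRho ψ (toCyl (γ j α)) • tangent (γ j) α ∂paramMeasure := by
  obtain ⟨R, -, hR⟩ := exists_height_bound hψ.2
  have hi := hψ.continuous.integrable_of_hasCompactSupport hψ.2 (μ := volume)
  refine ⟨integrable_smul_boundaryLayer hΩ hγ hi (.of_forall hR), ?_⟩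
  rw [integral_smul_boundaryLayer hΩ hγ hi (.of_forall hR)]
  simp only [integral_mul_logRho_sub]

theorem integrable_conv_tangent (hγ : IsBoundaryParam Ω γ) (j : Fin J) {ψ : Cyl → ℝ}
    (hψ : IsTest ψ) :
    Integrable (fun α => conv logRho ψ (toCyl (γ j α)) • tangent (γ j) α) paramMeasure :=
  integrable_tangent hγ j
    ((continuous_conv locInt_logRho hψ).comp_continuousOn (continuousOn_toCyl hγ j))

theorem integrable_conv_tangent_fst (hγ : IsBoundaryParam Ω γ) (j : Fin J) {ψ : Cyl → ℝ}
    (hψ : IsTest ψ) :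
    Integrable (fun α => conv logRho ψ (toCyl (γ j α)) * (tangent (γ j) α).1) paramMeasure :=
  (integrable_conv_tangent hγ j hψ).fst

theorem integrable_conv_tangent_snd (hγ : IsBoundaryParam Ω γ) (j : Fin J) {ψ : Cyl → ℝ}
    (hψ : IsTest ψ) :
    Integrable (fun α => conv logRho ψ (toCyl (γ j α)) * (tangent (γ j) α).2) paramMeasure :=
  (integrable_conv_tangent hγ j hψ).snd

theorem integral_fst_boundaryLayer {ε : ℝ≥0} (hΩ : IsC1HolderRegion ε Ω)
    (hγ : IsBoundaryParam Ω γ) {ψ : Cyl → ℝ} (hψ : IsTest ψ) :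
    Integrable (fun x => (boundaryLayer γ x).1 * ψ x) ∧ ∫ x, (boundaryLayer γ x).1 * ψ x =
      ∑ j, ∫ α, conv logRho ψ (toCyl (γ j α)) * (tangent (γ j) α).1 ∂paramMeasure := by
  obtain ⟨h1, h2⟩ := integral_test_smul_boundaryLayer hΩ hγ hψ
  refine ⟨by simpa [mul_comm] using h1.fst, ?_⟩
  have h3 := congrArg Prod.fst h2
  rw [fst_integral h1, Prod.fst_sum] at h3
  simp only [mul_comm _ (ψ _)]
  refine h3.trans (Finset.sum_congr rfl fun j _ => ?_)
  exact fst_integral (integrable_conv_tangent hγ j hψ)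

theorem integral_snd_boundaryLayer {ε : ℝ≥0} (hΩ : IsC1HolderRegion ε Ω)
    (hγ : IsBoundaryParam Ω γ) {ψ : Cyl → ℝ} (hψ : IsTest ψ) :
    Integrable (fun x => (boundaryLayer γ x).2 * ψ x) ∧ ∫ x, (boundaryLayer γ x).2 * ψ x =
      ∑ j, ∫ α, conv logRho ψ (toCyl (γ j α)) * (tangent (γ j) α).2 ∂paramMeasure := by
  obtain ⟨h1, h2⟩ := integral_test_smul_boundaryLayer hΩ hγ hψ
  refine ⟨by simpa [mul_comm] using h1.snd, ?_⟩
  have h3 := congrArg Prod.snd h2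
  rw [snd_integral h1, Prod.snd_sum] at h3
  simp only [mul_comm _ (ψ _)]
  refine h3.trans (Finset.sum_congr rfl fun j _ => ?_)
  exact snd_integral (integrable_conv_tangent hγ j hψ)

/-- After Fubini the pairing is the circulation of the gradient of `conv logRho φ` along each curve,
zero because the curve closes up in the strip. -/
theorem weakDivFree_patchVelocity {ε : ℝ≥0} (hΩ : IsC1HolderRegion ε Ω)
    (hγ : IsBoundaryParam Ω γ) (ω₀ : ℝ) : WeakDivFree (patchVelocity ω₀ γ) := by
  intro φ hφ
  obtain ⟨i₁, e₁⟩ := integral_fst_boundaryLayer hΩ hγ hφ.partial₁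
  obtain ⟨i₂, e₂⟩ := integral_snd_boundaryLayer hΩ hγ hφ.partial₂
  simp only [patchVelocity_eq, Prod.smul_fst, Prod.smul_snd, smul_eq_mul, mul_assoc, ← mul_add]
  rw [integral_const_mul, integral_add i₁ i₂, e₁, e₂, ← Finset.sum_add_distrib,
    Finset.sum_eq_zero, mul_zero]
  intro j _
  rw [← integral_add (integrable_conv_tangent_fst hγ j hφ.partial₁)
    (integrable_conv_tangent_snd hγ j hφ.partial₂)]
  exact integral_gradient_eq_zero hγ j (hasFDerivAt_conv locInt_logRho hφ)
    (continuous_conv locInt_logRho hφ.partial₁) (continuous_conv locInt_logRho hφ.partial₂)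

/-- After Fubini the pairing is the boundary integral of the field (log ρ ∗ ∂₂φ, −log ρ ∗ ∂₁φ). Its
curl is −Δ(log ρ ∗ φ) = −2πφ, and the prefactor −ω₀/2π restores ω₀ φ. -/
theorem hasWeakCurl_patchVelocity {ε : ℝ≥0} (hΩ : IsC1HolderRegion ε Ω)
    (hγ : IsBoundaryParam Ω γ) (ω₀ : ℝ) :
    HasWeakCurl (patchVelocity ω₀ γ) (Ω.indicator fun _ => ω₀) := by
  intro φ hφ
  obtain ⟨i₁, e₁⟩ := integral_fst_boundaryLayer hΩ hγ hφ.partial₂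
  obtain ⟨i₂, e₂⟩ := integral_snd_boundaryLayer hΩ hγ hφ.partial₁
  simp only [patchVelocity_eq, Prod.smul_fst, Prod.smul_snd, smul_eq_mul, mul_assoc, ← mul_sub]
  have green := green_theorem hΩ hγ (F₁ := conv logRho (partial₂ φ))
    (F₂ := fun x => -conv logRho (partial₁ φ) x) (contDiff_conv locInt_logRho hφ.partial₂)
    (contDiff_conv locInt_logRho hφ.partial₁).neg
  have hcurl : ∀ x, partial₁ (fun x => -conv logRho (partial₁ φ) x) x -
      partial₂ (conv logRho (partial₂ φ)) x = -(2 * Real.pi * φ x) := fun x => by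
    have h1 : partial₁ (fun x => -conv logRho (partial₁ φ) x) x =
        -partial₁ (conv logRho (partial₁ φ)) x := deriv.fun_neg
    rw [h1, partial₁_conv locInt_logRho hφ.partial₁, partial₂_conv locInt_logRho hφ.partial₂,
      ← conv_logRho_laplacian hφ]
    ring
  have hsum : (∑ j, ∫ α, conv logRho (partial₂ φ) (toCyl (γ j α)) * (tangent (γ j) α).1
        ∂paramMeasure) - ∑ j, ∫ α, conv logRho (partial₁ φ) (toCyl (γ j α)) * (tangent (γ j) α).2
        ∂paramMeasure = -(2 * Real.pi * ∫ x in Ω, φ x) := by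
    rw [← integral_const_mul, ← integral_neg, ← Finset.sum_sub_distrib]
    simp only [hcurl] at green
    rw [← green]
    refine Finset.sum_congr rfl fun j _ => ?_
    rw [intervalIntegral_eq, ← integral_sub (integrable_conv_tangent_fst hγ j hφ.partial₂)
      (integrable_conv_tangent_snd hγ j hφ.partial₁)]
    simp only [neg_mul, sub_eq_add_neg]
  rw [integral_const_mul, integral_sub i₁ i₂, e₁, e₂, hsum]
  have hind : ∫ x, Ω.indicator (fun _ => ω₀) x * φ x = ω₀ * ∫ x in Ω, φ x := by
    rw [← integral_const_mul, ← integral_indicator hΩ.isOpen.measurableSet]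
    congr 1 with x
    by_cases hx : x ∈ Ω <;> simp [hx]
  rw [hind]
  field_simp [Real.pi_ne_zero]

end boundary

/-! ### Horizontal means of the velocity -/

section boundary

variable {Ω : Set Cyl} {J : ℕ} {γ : Fin J → ℝ → ℝ × ℝ}

/-- Fubini against the length measure of the circle at height `a`, carried to the strip as `μ`; the
circle means of the kernel are then explicit. -/
theorem integral_circle_boundaryLayer {ε : ℝ≥0} (hΩ : IsC1HolderRegion ε Ω)
    (hγ : IsBoundaryParam Ω γ) (a : ℝ) :
    Integrable (fun t : AddCircle (1 : ℝ) => boundaryLayer γ (t, a)) ∧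
    ∫ t : AddCircle (1 : ℝ), boundaryLayer γ (t, a) =
      ∑ j, ∫ α, (Real.pi * |a - (γ j α).2| - Real.log 2) • tangent (γ j) α ∂paramMeasure := by
  have hm : Measurable fun t : AddCircle (1 : ℝ) => ((t, a) : Cyl) := by fun_prop
  set μ : Measure Cyl := Measure.map (fun t : AddCircle (1 : ℝ) => ((t, a) : Cyl)) volume with hμ
  have : IsFiniteMeasure μ := Measure.isFiniteMeasure_map _ _
  have hR : ∀ᵐ x ∂μ, (1 : ℝ) ≠ 0 → |x.2| ≤ |a| := by
    rw [hμ, ae_map_iff hm.aemeasurable]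
    · simp
    · simp only [ne_eq, one_ne_zero, not_false_eq_true, forall_const]
      exact measurableSet_band _
  have h1 := integrable_smul_boundaryLayer hΩ hγ (μ := μ) (ψ := fun _ => 1)
    (integrable_const _) hR
  have h2 := integral_smul_boundaryLayer hΩ hγ (μ := μ) (ψ := fun _ => 1)
    (integrable_const _) hR
  simp only [one_smul, one_mul] at h1 h2
  have h3 := aestronglyMeasurable_boundaryLayer hγ μ
  refine ⟨(integrable_map_measure h3 hm.aemeasurable).1 h1, ?_⟩
  rw [← integral_map hm.aemeasurable h3, ← hμ, h2]
  refine Finset.sum_congr rfl fun j _ => integral_congr_ae (.of_forall fun α => ?_)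
  have h4 : ∫ x, logRho (x - toCyl (γ j α)) ∂μ = Real.pi * |a - (γ j α).2| - Real.log 2 := by
    have h5 : Measurable fun x => logRho (x - toCyl (γ j α)) :=
      measurable_logRho.comp (measurable_id.sub_const _)
    rw [hμ, integral_map hm.aemeasurable h5.aestronglyMeasurable]
    have h6 : ∀ t : AddCircle (1 : ℝ), ((t, a) : Cyl) - toCyl (γ j α) =
        (t - ((γ j α).1 : AddCircle (1 : ℝ)), a - (γ j α).2) := fun t => rfl
    simp only [h6]
    exact integral_circle_logRho _ _
  simp only [h4]

theorem snd_closed (hγ : IsBoundaryParam Ω γ) (j : Fin J) : (γ j (2 * Real.pi)).2 = (γ j 0).2 :=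
  (congrArg Prod.snd (hγ.closed j)).symm

/-- The integrand is the derivative of a primitive of `k` evaluated at the height, and the height
returns to its initial value. -/
theorem integral_height_mul_tangent_snd (hγ : IsBoundaryParam Ω γ) (j : Fin J) {k : ℝ → ℝ}
    (hk : Continuous k) : ∫ α, k (γ j α).2 * (tangent (γ j) α).2 ∂paramMeasure = 0 := by
  rw [integral_deriv_eq_sub (f := fun α => ∫ s in (0 : ℝ)..(γ j α).2, k s)]
  · rw [snd_closed hγ, sub_self]
  · intro α hα
    have h1 : HasDerivAt (fun u => ∫ s in (0 : ℝ)..u, k s) (k (γ j α).2) (γ j α).2 :=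
      intervalIntegral.integral_hasDerivAt_right (hk.intervalIntegrable _ _)
        (hk.stronglyMeasurableAtFilter _ _) hk.continuousAt
    have h2 : HasDerivWithinAt (fun α => (γ j α).2) (tangent (γ j) α).2 paramI α :=
      (ContinuousLinearMap.snd ℝ ℝ ℝ).hasFDerivAt.comp_hasDerivWithinAt α
        (hγ.hasDerivWithinAt j hα)
    exact h1.comp_hasDerivWithinAt α h2
  · exact (hk.comp_continuousOn (continuous_snd.comp_continuousOn (hγ.continuousOn j))).mul
      (continuous_snd.comp_continuousOn (hγ.continuousOn_tangent j))

theorem continuousOn_mean (hγ : IsBoundaryParam Ω γ) (j : Fin J) {k : ℝ → ℝ} (hk : Continuous k) :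
    ContinuousOn (fun α => k (γ j α).2) paramI :=
  hk.comp_continuousOn (continuous_snd.comp_continuousOn (hγ.continuousOn j))

theorem integral_circle_snd_boundaryLayer {ε : ℝ≥0} (hΩ : IsC1HolderRegion ε Ω)
    (hγ : IsBoundaryParam Ω γ) (a : ℝ) :
    ∫ t : AddCircle (1 : ℝ), (boundaryLayer γ (t, a)).2 = 0 := by
  obtain ⟨h1, h2⟩ := integral_circle_boundaryLayer hΩ hγ a
  rw [← snd_integral h1, h2, Prod.snd_sum]
  refine Finset.sum_eq_zero fun j _ => ?_
  have hk : Continuous fun s : ℝ => Real.pi * |a - s| - Real.log 2 := by fun_prop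
  rw [snd_integral (integrable_tangent hγ j (continuousOn_mean hγ j hk))]
  exact integral_height_mul_tangent_snd hγ j hk

/-- The circulation moment that determines the means at infinity. -/
def heightMoment (γ : Fin J → ℝ → ℝ × ℝ) : ℝ :=
  ∑ j, ∫ α, (γ j α).2 * (tangent (γ j) α).1 ∂paramMeasure

/-- Here `s` is 1 above all the curves and −1 below them. The absolute value is then affine in the
height of the curve; its constant part drops out by `sum_integral_tangent`, and the moment remains
with the sign −s. -/
theorem integral_circle_fst_boundaryLayer {ε : ℝ≥0} (hΩ : IsC1HolderRegion ε Ω)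
    (hγ : IsBoundaryParam Ω γ) {a s : ℝ}
    (hs : ∀ j, ∀ α ∈ paramI, |a - (γ j α).2| = s * (a - (γ j α).2)) :
    ∫ t : AddCircle (1 : ℝ), (boundaryLayer γ (t, a)).1 = -(s * Real.pi * heightMoment γ) := by
  obtain ⟨h1, h2⟩ := integral_circle_boundaryLayer hΩ hγ a
  have hi : ∀ j, Integrable (tangent (γ j)) paramMeasure := fun j => by
    simpa using integrable_tangent hγ j (f := fun _ => 1) continuousOn_const
  have h0 := congrArg Prod.fst (sum_integral_tangent hΩ hγ)
  rw [Prod.fst_sum, Prod.fst_zero] at h0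
  rw [← fst_integral h1, h2, Prod.fst_sum]
  have key : ∀ j, (∫ α, (Real.pi * |a - (γ j α).2| - Real.log 2) • tangent (γ j) α
      ∂paramMeasure).1 = (Real.pi * s * a - Real.log 2) * (∫ α, tangent (γ j) α ∂paramMeasure).1 -
        (Real.pi * s) * ∫ α, (γ j α).2 * (tangent (γ j) α).1 ∂paramMeasure := fun j => by
    have i2 : Integrable (fun α => (γ j α).2 * (tangent (γ j) α).1) paramMeasure :=
      (integrable_tangent hγ j (continuousOn_mean hγ j continuous_id)).fst
    have hk : Continuous fun s : ℝ => Real.pi * |a - s| - Real.log 2 := by fun_prop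
    rw [fst_integral (integrable_tangent hγ j (continuousOn_mean hγ j hk)), fst_integral (hi j),
      ← integral_const_mul, ← integral_const_mul,
      ← integral_sub ((hi j).fst.const_mul _) (i2.const_mul _)]
    refine integral_congr_ae ?_
    filter_upwards [ae_paramMeasure] with α hα
    rw [Prod.smul_fst, smul_eq_mul, hs j α hα]
    ring
  rw [Finset.sum_congr rfl fun j _ => key j, Finset.sum_sub_distrib, ← Finset.mul_sum,
    ← Finset.mul_sum, h0, heightMoment]
  ring

theorem isPatchField_patchVelocity {ε : ℝ≥0} (hΩ : IsC1HolderRegion ε Ω)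
    (hγ : IsBoundaryParam Ω γ) (ω₀ : ℝ) : IsPatchField ω₀ Ω (patchVelocity ω₀ γ) := by
  have hcurl := hasWeakCurl_patchVelocity hΩ hγ ω₀
  have hw : MemLp (Ω.indicator fun _ => ω₀) ⊤ (volume : Measure Cyl) :=
    (memLp_top_const ω₀).indicator hΩ.isOpen.measurableSet
  have hu : MemLp (patchVelocity ω₀ γ) ⊤ (volume : Measure Cyl) := by
    obtain ⟨B, hB⟩ := exists_norm_boundaryLayer_le hΩ hγ
    have : MemLp (boundaryLayer γ) ⊤ (volume : Measure Cyl) :=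
      memLp_top_of_bound (aestronglyMeasurable_boundaryLayer hγ _) B (.of_forall hB)
    have h := this.const_smul (-(ω₀ / (2 * Real.pi)))
    exact h.congr_norm (h.aestronglyMeasurable.congr
      (.of_forall fun x => (patchVelocity_eq ω₀ γ x).symm))
      (.of_forall fun x => by rw [patchVelocity_eq]; rfl)
  refine ⟨⟨hu, weakDivFree_patchVelocity hΩ hγ ω₀, _, hw, hcurl⟩, hcurl, ?_, ?_⟩
  · refine .of_forall fun a => ?_
    simp only [patchVelocity_eq, Prod.smul_snd, smul_eq_mul]
    rw [integral_const_mul, integral_circle_snd_boundaryLayer hΩ hγ, mul_zero]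
  · obtain ⟨R, -, hR⟩ := exists_height_bound_param hγ
    have hm : ∀ a s : ℝ, (∀ j, ∀ α ∈ paramI, |a - (γ j α).2| = s * (a - (γ j α).2)) →
        m₁ (patchVelocity ω₀ γ) a = s * (ω₀ / 2 * heightMoment γ) := fun a s hs => by
      simp only [m₁, patchVelocity_eq, Prod.smul_fst, smul_eq_mul]
      rw [integral_const_mul, integral_circle_fst_boundaryLayer hΩ hγ hs]
      field_simp [Real.pi_ne_zero]
    refine ⟨-(ω₀ / 2 * heightMoment γ), ω₀ / 2 * heightMoment γ, ?_, ?_, neg_add_cancel _⟩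
    · refine Tendsto.mono_left ?_ inf_le_left
      refine tendsto_const_nhds.congr' ?_
      filter_upwards [Iic_mem_atBot (-R)] with a ha
      rw [hm a (-1) fun j α hα => ?_, neg_one_mul]
      have := (abs_le.1 (hR j α hα)).1
      have ha' : a ≤ -R := ha
      rw [abs_of_nonpos (by linarith), neg_one_mul]
    · refine Tendsto.mono_left ?_ inf_le_left
      refine tendsto_const_nhds.congr' ?_
      filter_upwards [Ici_mem_atTop R] with a ha
      rw [hm a 1 fun j α hα => ?_, one_mul]
      have := (abs_le.1 (hR j α hα)).2
      have ha' : R ≤ a := ha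
      rw [abs_of_nonneg (by linarith), one_mul]

end boundary

/-! ### Test functions determine locally integrable functions -/

/-- The function on the strip whose restriction to `[-1/2, 1/2) × ℝ` is `f`. -/
def descend (f : ℝ × ℝ → ℝ) (x : Cyl) : ℝ :=
  f (nearLift 0 (Function.surjInv toCyl_surjective x))

/-- The open fundamental domain. -/
def openSlab : Set (ℝ × ℝ) := {y | |y.1| < 1 / 2}

theorem isOpen_openSlab : IsOpen openSlab :=
  isOpen_lt (by fun_prop) continuous_const

theorem nearLift_zero_eq_self {y : ℝ × ℝ} (hy : y ∈ openSlab) : nearLift 0 y = y := by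
  have : round (y.1 - 0) = 0 := round_eq_of_abs_sub_lt (by
    have : |y.1| < 1 / 2 := hy
    simpa using this)
  simp [nearLift, show round y.1 = 0 by simpa using this]

theorem nearLift_zero_add_int (y : ℝ × ℝ) (n : ℤ) :
    nearLift 0 (y + ((n : ℝ), 0)) = nearLift 0 y := by
  simp only [nearLift, Prod.fst_add, Prod.fst_zero, sub_zero, round_add_intCast]
  ext <;> simp

theorem descend_toCyl (f : ℝ × ℝ → ℝ) (y : ℝ × ℝ) :
    descend f (toCyl y) = f (nearLift 0 y) := by
  obtain ⟨n, hn⟩ := toCyl_eq_iff.1 (Function.surjInv_eq toCyl_surjective (toCyl y)).symm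
  rw [descend, hn, nearLift_zero_add_int]

theorem descend_eq_zero {f : ℝ × ℝ → ℝ} {x : Cyl} (hx : x ∉ toCyl '' tsupport f) :
    descend f x = 0 := by
  by_contra h
  obtain ⟨y, rfl⟩ := toCyl_surjective x
  rw [descend_toCyl] at h
  exact hx ⟨_, subset_tsupport _ h, toCyl_nearLift _ _⟩

theorem isTest_descend {f : ℝ × ℝ → ℝ} (hf : ContDiff ℝ ∞ f) (hc : HasCompactSupport f)
    (hs : tsupport f ⊆ openSlab) : IsTest (descend f) := by
  have hK : IsCompact (toCyl '' tsupport f) := hc.isCompact.image continuous_toCyl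
  refine ⟨?_, HasCompactSupport.intro hK fun x hx => descend_eq_zero hx⟩
  rw [contDiff_iff_contDiffAt]
  intro y
  by_cases hy : toCyl y ∈ toCyl '' tsupport f
  · obtain ⟨z, hz, hzy⟩ := hy
    have hz' : |z.1| < 1 / 2 := hs hz
    set δ := (|z.1| + 1 / 2) / 2
    have hδ : δ < 1 / 2 := by simp only [δ]; linarith
    -- Only the abscissa of the centre enters `nearLift`, so the centre may be moved to the height
    -- of `z` without changing the lift.
    have hball : z ∈ Metric.ball (0, z.2) δ := by
      have h0 := abs_nonneg z.1
      rw [mem_ball_iff_norm, Prod.norm_def]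
      simp only [Prod.fst_sub, Prod.snd_sub, sub_zero, sub_self, norm_zero, Real.norm_eq_abs]
      rw [max_lt_iff]
      constructor <;> simp only [δ] <;> linarith
    have hn : nearLift (0, z.2) y ∈ Metric.ball (0, z.2) δ := by
      rwa [nearLift_eq hδ hball hzy.symm]
    have hev := nearLift_eventuallyEq hδ hn
    have : (descend f ∘ toCyl) =ᶠ[𝓝 y] fun w => f (w - ((round (y.1 - 0) : ℝ), 0)) := by
      filter_upwards [hev] with w hw
      rw [Function.comp_apply, descend_toCyl]
      exact congrArg f hw
    exact ((hf.comp (contDiff_id.sub contDiff_const)).contDiffAt).congr_of_eventuallyEq this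
  · have : (descend f ∘ toCyl) =ᶠ[𝓝 y] fun _ => 0 := by
      filter_upwards [continuous_toCyl.continuousAt.eventually
        (hK.isClosed.isOpen_compl.mem_nhds hy)] with w hw
      exact descend_eq_zero hw
    exact contDiffAt_const.congr_of_eventuallyEq this

theorem LocInt.integrableOn_comp_toCyl {g : Cyl → ℝ} (hg : LocInt g) (R : ℝ) :
    IntegrableOn (fun y => g (toCyl y)) (slab (-1 / 2) ∩ {y | |y.2| ≤ R}) := by
  have h1 := ((integrable_indicator_iff (measurableSet_band R)).2 (hg R))
  have h2 := ((measurePreserving_toCyl (-1 / 2)).integrable_comp h1.aestronglyMeasurable).2 h1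
  have hB : MeasurableSet {y : ℝ × ℝ | |y.2| ≤ R} :=
    measurableSet_le (by fun_prop) measurable_const
  have h3 : IntegrableOn (fun y => {z : Cyl | |z.2| ≤ R}.indicator g (toCyl y))
    (slab (-1 / 2) ∩ {y | |y.2| ≤ R}) := IntegrableOn.mono_set h2 Set.inter_subset_left
  refine h3.congr_fun (fun y hy => ?_) ((measurableSet_slab _).inter hB)
  exact Set.indicator_of_mem (show toCyl y ∈ {z : Cyl | |z.2| ≤ R} from hy.2) g

/-- A planar test function supported in the open fundamental domain descends to the strip. The
planar statement then applies there, and the seam left out is a null set. -/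
theorem LocInt.ae_eq_zero {g : Cyl → ℝ} (hg : LocInt g) (hm : AEStronglyMeasurable g volume)
    (h : ∀ η, IsTest η → ∫ x, g x * η x = 0) : g =ᵐ[volume] 0 := by
  have hsub : openSlab ⊆ slab (-1 / 2) := fun y hy => by
    have := abs_lt.1 (show |y.1| < 1 / 2 from hy)
    exact ⟨⟨by linarith [this.1], by linarith [this.2]⟩, trivial⟩
  have hloc : LocallyIntegrableOn (fun y => g (toCyl y)) openSlab := by
    rw [locallyIntegrableOn_iff isOpen_openSlab.isLocallyClosed]
    intro K hK hKc
    obtain ⟨R, hR⟩ := (hKc.image continuous_snd).isBounded.exists_norm_le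
    exact (hg.integrableOn_comp_toCyl R).mono_set fun y hy =>
      ⟨hsub (hK hy), hR _ ⟨y, hy, rfl⟩⟩
  have h1 : ∀ᵐ y : ℝ × ℝ, y ∈ openSlab → g (toCyl y) = 0 := by
    refine isOpen_openSlab.ae_eq_zero_of_integral_contDiff_smul_eq_zero hloc fun f hf hc hs => ?_
    have ht := isTest_descend hf hc hs
    have h2 := h _ ht
    rw [integral_cyl_eq_slab (-1 / 2) (f := fun x => g x * descend f x)
      (hm.mul ht.continuous.aestronglyMeasurable),
      ← integral_indicator (measurableSet_slab _)] at h2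
    rw [← h2]
    congr 1 with y
    have h0 : y ∉ openSlab → f y = 0 := fun hy =>
      image_eq_zero_of_notMem_tsupport fun h => hy (hs h)
    by_cases hy : y ∈ slab (-1 / 2)
    · rw [Set.indicator_of_mem hy, descend_toCyl]
      by_cases hy' : y ∈ openSlab
      · rw [nearLift_zero_eq_self hy', smul_eq_mul, mul_comm]
      · have hn : nearLift 0 y ∉ openSlab := by
          have h3 : y.1 = 1 / 2 := by
            have h4 : y.1 ≤ 1 / 2 := by
              have := hy.1.2
              linarith
            have h5 : -(1 / 2) < y.1 := by
              have := hy.1.1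
              linarith
            refine h4.antisymm (not_lt.1 fun h6 => hy' (abs_lt.2 ⟨h5, h6⟩))
          -- On the seam rounding goes up, so the lift moves to abscissa −1/2, which is again
          -- outside the open domain.
          have h7 : round (y.1 - (0 : ℝ × ℝ).1) = 1 := by
            rw [h3, Prod.fst_zero, sub_zero, one_div, round_two_inv]
          rw [openSlab, Set.mem_ofPred_eq, nearLift, h7, Prod.fst_sub, h3]
          norm_num
        rw [h0 hy', image_eq_zero_of_notMem_tsupport fun h => hn (hs h)]
        simp
    · rw [Set.indicator_of_notMem hy, h0 fun h => hy (hsub h), zero_smul]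
  have h2 : ∀ᵐ y ∂(volume.restrict (slab (-1 / 2))), g (toCyl y) = 0 := by
    have hae : openSlab =ᵐ[volume] slab (-1 / 2) := by
      have e : openSlab = Set.Ioo (-1 / 2 : ℝ) (-1 / 2 + 1) ×ˢ Set.univ := by
        ext y
        simp only [openSlab, Set.mem_ofPred_eq, abs_lt, Set.mem_prod, Set.mem_Ioo, Set.mem_univ,
          and_true]
        norm_num
      rw [e]
      exact Measure.set_prod_ae_eq Ioo_ae_eq_Ioc (ae_eq_refl _)
    rw [← Measure.restrict_congr_set hae, ae_restrict_iff' isOpen_openSlab.measurableSet]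
    exact h1
  have h3 : NullMeasurableSet {x | ¬ g x = 0} volume :=
    (hm.nullMeasurableSet_eq_fun aestronglyMeasurable_const).compl
  have h4 := (measurePreserving_toCyl (-1 / 2)).measure_preimage h3
  rw [EventuallyEq, ae_iff]
  exact h4.symm.trans h2

/-! ### Bounded fields without divergence and curl -/

theorem locInt_of_memLp_top {g : Cyl → ℝ} (hg : MemLp g ⊤ (volume : Measure Cyl)) : LocInt g := by
  intro R
  have : IsFiniteMeasure (volume.restrict {z : Cyl | |z.2| ≤ R}) :=
    ⟨by rw [Measure.restrict_apply_univ]; exact volume_band_lt_top R⟩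
  exact (hg.restrict _).integrable le_top

theorem exists_abs_conv_le {g η : Cyl → ℝ} (hg : MemLp g ⊤ (volume : Measure Cyl))
    (hη : IsTest η) : ∃ C, ∀ x, |conv g η x| ≤ C := by
  obtain ⟨M, hM⟩ : ∃ M : ℝ, ∀ᵐ z : Cyl, ‖g z‖ ≤ M := by
    refine ⟨(eLpNorm g ⊤ volume).toReal, ?_⟩
    filter_upwards [ae_le_eLpNormEssSup (f := g) (μ := volume)] with z hz
    rw [← toReal_enorm]
    exact ENNReal.toReal_mono hg.2.ne hz
  have hi := hη.continuous.integrable_of_hasCompactSupport hη.2 (μ := volume)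
  refine ⟨∫ z, M * ‖η z‖, fun x => ?_⟩
  rw [← integral_add_right_eq_self (fun z => M * ‖η z‖) x]
  rw [← Real.norm_eq_abs, conv]
  refine norm_integral_le_of_norm_le ((hi.comp_add_right x).norm.const_mul M) ?_
  filter_upwards [hM] with z hz
  rw [norm_mul]
  exact mul_le_mul_of_nonneg_right hz (norm_nonneg _)

/-- Liouville's theorem for bounded fields without divergence and curl. -/
theorem conv_eq_conv_zero {w₁ w₂ : Cyl → ℝ} (h₁ : MemLp w₁ ⊤ (volume : Measure Cyl))
    (h₂ : MemLp w₂ ⊤ (volume : Measure Cyl))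
    (hdiv : ∀ φ, IsTest φ → ∫ x, (w₁ x * partial₁ φ x + w₂ x * partial₂ φ x) = 0)
    (hcurl : ∀ φ, IsTest φ → ∫ x, (w₁ x * partial₂ φ x - w₂ x * partial₁ φ x) = 0)
    {η : Cyl → ℝ} (hη : IsTest η) (x : Cyl) :
    conv w₁ η x = conv w₁ η 0 ∧ conv w₂ η x = conv w₂ η 0 := by
  have l₁ := locInt_of_memLp_top h₁
  have l₂ := locInt_of_memLp_top h₂
  have hd : ∀ y, conv w₁ (partial₁ η) (toCyl y) + conv w₂ (partial₂ η) (toCyl y) = 0 := fun y => by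
    have t := hη.comp_add y
    have h := hdiv _ t
    simp only [partial₁_comp_add, partial₂_comp_add] at h
    rw [conv, conv, ← integral_add, h]
    · exact l₁.integrable_mul (hη.partial₁.comp_add y).continuous (hη.partial₁.comp_add y).2
    · exact l₂.integrable_mul (hη.partial₂.comp_add y).continuous (hη.partial₂.comp_add y).2
  have hc : ∀ y, conv w₁ (partial₂ η) (toCyl y) - conv w₂ (partial₁ η) (toCyl y) = 0 := fun y => by
    have t := hη.comp_add y
    have h := hcurl _ t
    simp only [partial₁_comp_add, partial₂_comp_add] at h
    rw [conv, conv, ← integral_sub, h]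
    · exact l₁.integrable_mul (hη.partial₂.comp_add y).continuous (hη.partial₂.comp_add y).2
    · exact l₂.integrable_mul (hη.partial₁.comp_add y).continuous (hη.partial₁.comp_add y).2
  -- For w₁ − i w₂ the vanishing of divergence and curl are the two Cauchy–Riemann equations.
  let F : ℂ → ℂ := fun z => (conv w₁ η (toCyl (z.re, z.im)) : ℂ) -
    Complex.I * (conv w₂ η (toCyl (z.re, z.im)) : ℂ)
  have hF : Differentiable ℂ F := by
    intro z
    have hz : HasFDerivAt (fun z : ℂ => (z.re, z.im)) (Complex.reCLM.prod Complex.imCLM) z :=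
      Complex.reCLM.hasFDerivAt.prodMk Complex.imCLM.hasFDerivAt
    have d₁ := Complex.ofRealCLM.hasFDerivAt.comp z
      ((hasFDerivAt_conv l₁ hη (z.re, z.im)).comp z hz)
    have d₂ := Complex.ofRealCLM.hasFDerivAt.comp z
      ((hasFDerivAt_conv l₂ hη (z.re, z.im)).comp z hz)
    have dF : HasFDerivAt F _ z := d₁.sub (d₂.const_mul Complex.I)
    rw [differentiableAt_complex_iff_differentiableAt_real]
    refine ⟨dF.differentiableAt, ?_⟩
    rw [dF.fderiv]
    have e₁ := hd (z.re, z.im)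
    have e₂ := hc (z.re, z.im)
    apply Complex.ext
    · simp
      linarith
    · simp
      linarith
  obtain ⟨C₁, hC₁⟩ := exists_abs_conv_le h₁ hη
  obtain ⟨C₂, hC₂⟩ := exists_abs_conv_le h₂ hη
  have hb : Bornology.IsBounded (Set.range F) := by
    rw [isBounded_iff_forall_norm_le]
    refine ⟨C₁ + C₂, ?_⟩
    rintro _ ⟨z, rfl⟩
    refine (norm_sub_le _ _).trans (add_le_add ?_ ?_)
    · rw [Complex.norm_real]; exact hC₁ _
    · rw [norm_mul, Complex.norm_I, one_mul, Complex.norm_real]; exact hC₂ _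
  obtain ⟨y, rfl⟩ := toCyl_surjective x
  have h := hF.apply_eq_apply_of_bounded hb ⟨y.1, y.2⟩ 0
  have hre := congrArg Complex.re h
  have him := congrArg Complex.im h
  have h0 : toCyl (0, 0) = 0 := rfl
  simp [F, h0] at hre him
  exact ⟨hre, him⟩

instance : (volume : Measure Cyl).IsNegInvariant :=
  ⟨((Measure.measurePreserving_neg (volume : Measure (AddCircle (1 : ℝ)))).prod
    (Measure.measurePreserving_neg (volume : Measure ℝ))).map_eq⟩

instance : (volume : Measure Cyl).IsAddLeftInvariant :=
  inferInstanceAs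
    ((volume : Measure (AddCircle (1 : ℝ))).prod (volume : Measure ℝ)).IsAddLeftInvariant

/-- By Fubini the left side averages, with weight `χ`, the values of `conv g η` at the points −x,
which are all equal. -/
theorem integral_mul_integral_sub {g χ η : Cyl → ℝ} (hg : MemLp g ⊤ (volume : Measure Cyl))
    (hχ : IsTest χ) (hη : IsTest η) (h : ∀ x, conv g η x = conv g η 0) :
    ∫ z, g z * ∫ x, χ x * η (z - x) = (∫ x, χ x) * conv g η 0 := by
  have lg := locInt_of_memLp_top hg
  have hχi := hχ.continuous.integrable_of_hasCompactSupport hχ.2 (μ := volume)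
  obtain ⟨R, hR0, hR⟩ := exists_height_bound hη.2
  obtain ⟨S, hS0, hS⟩ := exists_height_bound hχ.2
  obtain ⟨M, hM0, hM⟩ := exists_abs_bound hη.continuous hη.2
  have hint : Integrable (fun q : Cyl × Cyl => g q.1 * (χ q.2 * η (q.1 - q.2)))
      ((volume : Measure Cyl).prod volume) := by
    have hB := (integrable_indicator_iff (measurableSet_band (R + S))).2 (lg (R + S))
    refine ((hB.norm.mul_prod hχi.norm).mul_const M).mono' ?_ (.of_forall fun q => ?_)
    · exact hg.aestronglyMeasurable.comp_fst.mul ((hχ.continuous.comp continuous_snd).mul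
        (hη.continuous.comp (continuous_fst.sub continuous_snd))).aestronglyMeasurable
    · rw [norm_mul, norm_mul, ← mul_assoc]
      by_cases h0 : χ q.2 = 0
      · simp [h0]
      by_cases h1 : η (q.1 - q.2) = 0
      · rw [h1, norm_zero, mul_zero]; positivity
      have h2 : q.1 ∈ {z : Cyl | |z.2| ≤ R + S} := by
        have h3 : |q.1.2 - q.2.2| ≤ R := hR _ h1
        have h4 := hS _ h0
        have h5 := abs_sub_abs_le_abs_sub q.1.2 q.2.2
        change |q.1.2| ≤ R + S
        linarith
      rw [Set.indicator_of_mem h2]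
      exact mul_le_mul_of_nonneg_left (hM _) (by positivity)
  have e1 : ∫ z, g z * ∫ x, χ x * η (z - x) = ∫ z, ∫ x, g z * (χ x * η (z - x)) := by
    simp only [integral_const_mul]
  have e2 : ∀ x, ∫ z, g z * (χ x * η (z - x)) = χ x * conv g η 0 := fun x => by
    rw [← h (-x), conv, ← integral_const_mul]
    congr 1 with z
    rw [sub_eq_add_neg]
    ring
  rw [e1, integral_integral_swap hint]
  simp only [e2, integral_mul_const]

/-- A locally integrable function whose averages do not depend on the position is constant. -/
theorem ae_eq_const_of_conv {g : Cyl → ℝ} (hg : MemLp g ⊤ (volume : Measure Cyl))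
    (h : ∀ η, IsTest η → ∀ x, conv g η x = conv g η 0) : ∃ c : ℝ, g =ᵐ[volume] fun _ => c := by
  have lg := locInt_of_memLp_top hg
  obtain ⟨χ, hχ, hχ0⟩ : ∃ χ, IsTest χ ∧ ∫ x, χ x ≠ 0 := by
    -- If all test functions had integral zero, the constant 1 would vanish almost everywhere.
    by_contra! hall
    have h1 : LocInt fun _ => 1 := locInt_of_memLp_top (memLp_top_const 1)
    have h2 := h1.ae_eq_zero aestronglyMeasurable_const fun η hη => by simpa using hall η hη
    have h3 : ∀ᵐ _ : Cyl, False := by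
      filter_upwards [h2] with x hx
      exact one_ne_zero hx
    rw [ae_iff] at h3
    simp only [not_false_eq_true, Set.ofPred_true] at h3
    have h4 : (volume : Measure Cyl) ≠ 0 := NeZero.ne _
    exact h4 (Measure.measure_univ_eq_zero.1 h3)
  have hχi := hχ.continuous.integrable_of_hasCompactSupport hχ.2 (μ := volume)
  refine ⟨conv g χ 0 / ∫ x, χ x, ?_⟩
  set c := conv g χ 0 / ∫ x, χ x with hc
  have key : ∀ η, IsTest η → ∫ z, g z * η z = c * ∫ x, η x := by
    intro η hη
    -- The convolution of `χ` and `η` is symmetric, so evaluating one integral in two ways gives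
    -- (∫χ) ∫gη = (∫η) ∫gχ.
    have h1 := integral_mul_integral_sub hg hχ hη (h η hη)
    have h2 := integral_mul_integral_sub hg hη hχ (h χ hχ)
    have e : ∀ z, ∫ x, χ x * η (z - x) = ∫ x, η x * χ (z - x) := fun z => by
      rw [← integral_sub_left_eq_self (fun x => η x * χ (z - x)) volume z]
      simp only [sub_sub_cancel, mul_comm]
    simp only [e] at h1
    rw [h1] at h2
    have e0 : conv g η 0 = ∫ z, g z * η z := by simp only [conv, add_zero]
    rw [e0] at h2
    rw [hc, div_mul_eq_mul_div, eq_div_iff hχ0]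
    linarith
  have hsub : MemLp (fun x => g x - c) ⊤ (volume : Measure Cyl) := hg.sub (memLp_top_const c)
  have hz := (locInt_of_memLp_top hsub).ae_eq_zero hsub.aestronglyMeasurable fun η hη => by
    have i1 := lg.integrable_mul hη.continuous hη.2
    have i2 := (hη.continuous.integrable_of_hasCompactSupport hη.2 (μ := volume)).const_mul c
    simp only [sub_mul]
    rw [integral_sub i1 i2, key η hη, integral_const_mul, sub_self]
  filter_upwards [hz] with x hx
  exact sub_eq_zero.1 hx

/-! ### Uniqueness -/

theorem integral_sub_eq_zero_of_eq {v u : Cyl → ℝ × ℝ} (hv : MemLp v ⊤ (volume : Measure Cyl))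
    (hu : MemLp u ⊤ (volume : Measure Cyl)) {a b : Cyl → ℝ} (ha : IsTest a) (hb : IsTest b)
    (h : ∫ x, ((v x).1 * a x + (v x).2 * b x) = ∫ x, ((u x).1 * a x + (u x).2 * b x)) :
    ∫ x, (((v x).1 - (u x).1) * a x + ((v x).2 - (u x).2) * b x) = 0 := by
  have i : ∀ {w : Cyl → ℝ × ℝ}, MemLp w ⊤ (volume : Measure Cyl) →
      Integrable fun x => (w x).1 * a x + (w x).2 * b x := fun hw =>
    ((locInt_of_memLp_top hw.fst).integrable_mul ha.continuous ha.2).add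
      ((locInt_of_memLp_top hw.snd).integrable_mul hb.continuous hb.2)
  rw [← sub_eq_zero, ← integral_sub (i hv) (i hu)] at h
  rw [← h]
  congr 1 with x
  ring

theorem IsTest.neg {φ : Cyl → ℝ} (h : IsTest φ) : IsTest fun x => -φ x :=
  ⟨h.1.neg, h.2.neg⟩

/-- The horizontal means of a field that is constant almost everywhere. -/
theorem ae_integral_circle_sub {v u : Cyl → ℝ} (hv : MemLp v ⊤ (volume : Measure Cyl))
    (hu : MemLp u ⊤ (volume : Measure Cyl)) {c : ℝ}
    (h : (fun x => v x - u x) =ᵐ[volume] fun _ => c) :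
    ∀ᵐ a : ℝ, (∫ t : AddCircle (1 : ℝ), v (t, a)) - ∫ t : AddCircle (1 : ℝ), u (t, a) = c := by
  have slice : ∀ {P : Cyl → Prop}, (∀ᵐ x, P x) → ∀ᵐ a : ℝ, ∀ᵐ t : AddCircle (1 : ℝ), P (t, a) :=
    fun hP => Measure.ae_ae_of_ae_prod (Measure.measurePreserving_swap.quasiMeasurePreserving.ae hP)
  have hint : ∀ {w : Cyl → ℝ}, MemLp w ⊤ (volume : Measure Cyl) →
      ∀ᵐ a : ℝ, Integrable fun t : AddCircle (1 : ℝ) => w (t, a) := by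
    intro w hw
    have hb : ∀ᵐ x : Cyl, ‖w x‖ ≤ (eLpNorm w ⊤ volume).toReal := by
      filter_upwards [ae_le_eLpNormEssSup (f := w) (μ := volume)] with z hz
      rw [← toReal_enorm]
      exact ENNReal.toReal_mono hw.2.ne hz
    have hm : ∀ᵐ a : ℝ, AEStronglyMeasurable (fun t : AddCircle (1 : ℝ) => w (t, a)) volume :=
      (hw.aestronglyMeasurable.prod_swap).prodMk_left
    filter_upwards [slice hb, hm] with a h1 h2
    exact (integrable_const _).mono' h2 h1
  filter_upwards [slice h, hint hv, hint hu] with a h1 h2 h3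
  rw [← integral_sub h2 h3, integral_congr_ae h1]
  simp [Measure.real, AddCircle.measure_univ]

/-- Essential limits at ±∞ are unique only because half-lines are not null, which makes the filters
proper. -/
theorem neBot_inf_ae {l : Filter ℝ} (h : ∀ s ∈ l, volume s ≠ 0) :
    (l ⊓ ae (volume : Measure ℝ)).NeBot := by
  rw [inf_neBot_iff]
  intro s hs t ht
  by_contra hne
  refine h s hs (measure_mono_null (fun x hx hxt => hne ⟨x, hx, hxt⟩) (mem_ae_iff.1 ht))

/-- The difference is a constant vector (c₁, c₂). The means m₂ give c₂ = 0. The limits of m₁ differ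
by c₁ at both ends, and as each pair of limits has sum zero, 2c₁ = 0. -/
theorem IsPatchField.ae_eq {ω₀ : ℝ} {Ω : Set Cyl} {v u : Cyl → ℝ × ℝ} (hv : IsPatchField ω₀ Ω v)
    (hu : IsPatchField ω₀ Ω u) : v =ᵐ[volume] u := by
  have mv := hv.mem.1
  have mu := hu.mem.1
  have hdiv : ∀ φ, IsTest φ → ∫ x, (((v x).1 - (u x).1) * partial₁ φ x +
      ((v x).2 - (u x).2) * partial₂ φ x) = 0 := fun φ hφ =>
    integral_sub_eq_zero_of_eq mv mu hφ.partial₁ hφ.partial₂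
      ((hv.mem.2.1 φ hφ).trans (hu.mem.2.1 φ hφ).symm)
  have hcurl : ∀ φ, IsTest φ → ∫ x, (((v x).1 - (u x).1) * partial₂ φ x -
      ((v x).2 - (u x).2) * partial₁ φ x) = 0 := fun φ hφ => by
    have h := (hv.curl φ hφ).trans (hu.curl φ hφ).symm
    have := integral_sub_eq_zero_of_eq mv mu hφ.partial₂ hφ.partial₁.neg (by
      simpa only [mul_neg, ← sub_eq_add_neg] using h)
    simpa only [mul_neg, ← sub_eq_add_neg] using this
  have l := fun {η} (hη : IsTest η) x =>
    conv_eq_conv_zero (mv.fst.sub mu.fst) (mv.snd.sub mu.snd) hdiv hcurl hη x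
  obtain ⟨c₁, h₁⟩ := ae_eq_const_of_conv (mv.fst.sub mu.fst) fun η hη x => (l hη x).1
  obtain ⟨c₂, h₂⟩ := ae_eq_const_of_conv (mv.snd.sub mu.snd) fun η hη x => (l hη x).2
  have n₁ := ae_integral_circle_sub mv.fst mu.fst h₁
  have n₂ := ae_integral_circle_sub mv.snd mu.snd h₂
  have z₂ : c₂ = 0 := by
    obtain ⟨a, h3, h4, h5⟩ := (n₂.and (hv.m₂_eq.and hu.m₂_eq)).exists
    rw [← h3, h4, h5, sub_zero]
  have z₁ : c₁ = 0 := by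
    obtain ⟨a, b, ha, hb, hab⟩ := hv.m₁_eq
    obtain ⟨a', b', ha', hb', hab'⟩ := hu.m₁_eq
    have hlim : ∀ {l : Filter ℝ} {p q : ℝ}, (l ⊓ ae (volume : Measure ℝ)).NeBot →
        Tendsto (m₁ v) (l ⊓ ae volume) (𝓝 p) → Tendsto (m₁ u) (l ⊓ ae volume) (𝓝 q) →
        p - q = c₁ := by
      intro l p q hl hp hq
      refine tendsto_nhds_unique (hp.sub hq) (tendsto_const_nhds.congr' ?_)
      filter_upwards [mem_inf_of_right n₁] with a ha
      exact ha.symm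
    have nb : (atBot ⊓ ae (volume : Measure ℝ)).NeBot := by
      refine neBot_inf_ae fun s hs h0 => ?_
      obtain ⟨N, hN⟩ := mem_atBot_sets.1 hs
      simpa using measure_mono_null (show Set.Iic N ⊆ s from hN) h0
    have nt : (atTop ⊓ ae (volume : Measure ℝ)).NeBot := by
      refine neBot_inf_ae fun s hs h0 => ?_
      obtain ⟨N, hN⟩ := mem_atTop_sets.1 hs
      simpa using measure_mono_null (show Set.Ici N ⊆ s from hN) h0
    have e1 := hlim nb ha ha'
    have e2 := hlim nt hb hb'
    linarith
  filter_upwards [h₁, h₂] with x h3 h4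
  rw [z₁] at h3
  rw [z₂] at h4
  exact Prod.ext (sub_eq_zero.1 h3) (sub_eq_zero.1 h4)

end PatchLaw

end

theorem theoremT (ε : ℝ≥0) (hε : 0 < ε) (Ω : Set PatchLaw.Cyl)
    (hΩ : PatchLaw.IsC1HolderRegion ε Ω)
    (J : ℕ) (γ : Fin J → ℝ → ℝ × ℝ) (hγ : PatchLaw.IsBoundaryParam Ω γ) (ω₀ : ℝ) :
    (∀ (j : Fin J) (x : PatchLaw.Cyl),
      IntervalIntegrable (PatchLaw.integrand (γ j) x) volume 0 (2 * Real.pi)) ∧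
    PatchLaw.IsPatchField ω₀ Ω (PatchLaw.patchVelocity ω₀ γ) ∧
    ∀ v : PatchLaw.Cyl → ℝ × ℝ, PatchLaw.IsPatchField ω₀ Ω v →
      v =ᵐ[volume] PatchLaw.patchVelocity ω₀ γ :=
  ⟨fun j x => PatchLaw.intervalIntegrable_iff_paramMeasure.2
      (PatchLaw.integrable_integrand hΩ hγ j x),
    PatchLaw.isPatchField_patchVelocity hΩ hγ ω₀,
    fun _ hv => hv.ae_eq (PatchLaw.isPatchField_patchVelocity hΩ hγ ω₀)⟩
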